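/- **Setting.** Let $m\ge 1$ and $n$ be integers with $m\le 2n$, let $[-n:n]=\{-n,\dots,n\}$, and for $j\in[-n:n]\setminus\{0\}$ put $$d^{(m)}_{n,j}=\frac{(-1)^{m+n-j}\,m!\,a^{(m)}_{n,j}}{(n+j)!\,(n-j)!},\qquad a^{(m)}_{n,j}=\sum_{P\subset[-n:n]\setminus\{0,j\},\ |P|=2n-m}\ \prod_{l\in P}l,\qquad d^{(m)}_{n,0}=-\sum_{j\ne0}d^{(m)}_{n,j}$$ (the coefficients of the central difference formula $f^{(m)}(x)\approx h^{-m}\sum_{j}d^{(m)}_{n,j}f(x+jh)$), and $D^{(m)}_n=\sum_{j=-n}^n|d^{(m)}_{n,j}|$. For $A,c>0$ and $\sigma\in\mathbb R$ let $\mathcal G_{A,c,\sigma}$ be the set of smooth $f:\mathbb R\to\mathbb R$ with $|f^{(k)}(x)|\le Ac^k(k!)^\sigma$ for all $k\ge0$, $x\in\mathbb R$. Write $\sigma^+=\max\{\sigma,0\}$. Let $\mathcal S$ be a finite set with probabilities $p_s\in[0,1]$, $\sum_sp_s=1$; let $F:\mathcal S\times\mathbb R\to\mathbb R$ satisfy $|F|\le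 B$, and let $V(x)=\sum_sp_sF(s,x)$ be in $\mathcal G_{A,c,\sigma}$. Let $x\in\mathbb R$, $\epsilon>0$, $h>0$, $\tilde\epsilon=h^m\epsilon/D^{(m)}_n$. The elements of $\mathcal S$, the integers $j\in[-n:n]$ and the points $x+jh$ are represented by distinct computational basis states of registers of qubits. An algorithm may call the following unitary oracles and their inverses (both count as calls), and apply any other unitary operations, which do not depend on the oracles, at no cost: $$O_S|0\rangle=\sum_s\sqrt{p_s}|s\rangle,\qquad O_{F,\tilde\epsilon}|s\rangle|\xi\rangle|0\rangle=|s\rangle|\xi\rangle|F_{\tilde\epsilon}(s,\xi)\rangle\quad(\xi=x+jh,\ j\in[-n:n]),$$ $$O_{\rm coef}|0\rangle=\sum_{j=-n}^n\sqrt{|d^{(m)}_{n,j}|/D^{(m)}_n}\,|j\rangle,\qquad O_{\rm sign}|j\rangle|0\rangle=|j\rangle|\theta_j\rangle,\quad \theta_j=1\text{ if }d^{(m)}_{n,j}\ge0,\ \theta_j=0\text{ otherwise},$$ where $|F_{\tilde\epsilon}-F|\le\tilde\epsilon$ everywhere. **Theorem 4 (sum-in-QAE method).** There are quantum algorithms $\mathcal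 A_3(m,\epsilon;n,h)$, which may depend on $m,\epsilon,n,h,x,B$ and on the formats of the registers but not otherwise on $p$, $F$ or the oracles, and an absolute constant $K$, such that the following holds. 1. Whenever $$Ac^{2n+1}((2n+1)!)^\sigma\,m\left(\tfrac{em}{2}\right)^{2n}h^{2n-m+1}\le\epsilon,\tag{1}$$ $\mathcal A_3(m,\epsilon;n,h)$ outputs a number within $3\epsilon$ of $V^{(m)}(x)$ with probability at least $0.99$. It calls each of the four oracles at most $K\,\dfrac{m[2(1+\log n)]^mB}{h^m\epsilon}$ times. 2. Suppose that, for some $a,C,\delta_0>0$, the oracles $O_{F,\delta}$ use at most $C\log^a(1/\delta)$ qubits, ancillas included, for all $0<\delta\le\delta_0$. If $\tilde\epsilon\le\min\{\delta_0,1/4\}$, then $O_{F,\tilde\epsilon}$ uses at most $K_aC\log^a\!\left(\dfrac{m[2(1+\log n)]^m}{h^m\epsilon}\right)$ qubits, where $K_a$ depends only on $a$. 3. Let $A,c>0$, $\sigma\in\mathbb R$ and $$\epsilon'=\frac{e}{2(ecm)^m}\frac{\epsilon}{A},\quad L=\log_2\frac{2^{m\sigma^+}}{\epsilon'},\quad n_{\rm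 th}=\left\lceil\tfrac12\left(L+\max\{1,m\sigma^+\}\log_2L-\tfrac12\right)\right\rceil,\quad h_{\rm th}=\frac{1}{ecm(2n_{\rm th}+1)^{\sigma^+}}.$$ If $\epsilon'\le2^{m\sigma^+-(m\sigma^+/\log2)^2}$ in the case $m\sigma^+\ge\log2$, respectively $\epsilon'\le2^{m\sigma^+-1}$ in the case $m\sigma^+<\log2$, and if $m\le2n_{\rm th}$, then $n=n_{\rm th}$ and $h=h_{\rm th}$ satisfy (1). For all sufficiently small $\epsilon'$ (how small depends only on $m$ and $\sigma$) these two conditions hold, and $\mathcal A_3(m,\epsilon;n_{\rm th},h_{\rm th})$ calls each of the four oracles at most $$K\,\frac{m(2ecm)^mB}{\epsilon}\,L^{m\sigma^+}\,(\log L)^m$$ times. Finally, under the assumption on qubits in 2, if $B>0$ and $\epsilon$ is sufficiently small (depending on $a,m,A,c,\sigma,B,\delta_0$), then for $n=n_{\rm th}$, $h=h_{\rm th}$ the oracle $O_{F,\tilde\epsilon}$ uses at most $K_aC\log^a\!\left(\dfrac{m(2ecm)^mB}{\epsilon}\right)$ qubits, with the same $K_a$. -/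

import Mathlib

open scoped Matrix Nat ContDiff

universe u

noncomputable section

namespace SumInQAE

/-! ### Central difference formula -/

/-- The integer interval `[-n : n]`. -/
def nodes (n : ℕ) : Finset ℤ := Finset.Icc (-(n : ℤ)) (n : ℤ)

/-- `a_{n,j}^{(m)}`: the sum, over all `(2n-m)`-element subsets of `[-n:n] \ {0, j}`, of the product
of the elements of the subset. -/
def aCoef (m n : ℕ) (j : ℤ) : ℝ :=
  ∑ P ∈ (((nodes n).erase 0).erase j).powersetCard (2 * n - m), ∏ l ∈ P, (l : ℝ)

/-- The coefficient `d_{n,j}^{(m)}` for `j ≠ 0`. -/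
def dOff (m n : ℕ) (j : ℤ) : ℝ :=
  (-1 : ℝ) ^ ((m : ℤ) + n - j) * (m ! : ℝ) * aCoef m n j
    / ((((n : ℤ) + j).toNat ! : ℝ) * (((n : ℤ) - j).toNat ! : ℝ))

/-- The coefficient `d_{n,j}^{(m)}` of the central difference formula. -/
def dCoef (m n : ℕ) (j : ℤ) : ℝ :=
  if j = 0 then -∑ i ∈ (nodes n).erase 0, dOff m n i else dOff m n j

/-- `D_n^{(m)} = ∑_j |d_{n,j}^{(m)}|`. -/
def DSum (m n : ℕ) : ℝ := ∑ j ∈ nodes n, |dCoef m n j|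

/-- `ε̃ = h^m ε / D_n^{(m)}`, the precision at which the integrand is computed. -/
def epsTilde (m n : ℕ) (h ε : ℝ) : ℝ := h ^ m * ε / DSum m n

/-! ### Gevrey functions, step condition, the special choice of `n` and `h` -/

/-- The class `𝒢_{A,c,σ}` of smooth functions with `|f^{(k)}(x)| ≤ A c^k (k!)^σ`. -/
def Gevrey (A c σ : ℝ) (f : ℝ → ℝ) : Prop :=
  ContDiff ℝ ∞ f ∧ ∀ (k : ℕ) (x : ℝ), |iteratedDeriv k f x| ≤ A * c ^ k * (k ! : ℝ) ^ σ

/-- The condition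
`A c^{2n+1} ((2n+1)!)^σ m (em/2)^{2n} h^{2n-m+1} ≤ ε`. -/
def StepCondition (A c σ : ℝ) (m n : ℕ) (h ε : ℝ) : Prop :=
  A * c ^ (2 * n + 1) * (((2 * n + 1)! : ℕ) : ℝ) ^ σ * m * (Real.exp 1 * m / 2) ^ (2 * n)
    * h ^ (2 * n + 1 - m) ≤ ε

/-- `m σ⁺`, where `σ⁺ = max σ 0`. -/
def mSig (m : ℕ) (σ : ℝ) : ℝ := m * max σ 0

/-- `ε' = e / (2 (ecm)^m) · ε / A`. -/
def epsPrime (A c : ℝ) (m : ℕ) (ε : ℝ) : ℝ :=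
  Real.exp 1 / (2 * (Real.exp 1 * c * m) ^ m) * (ε / A)

/-- `log₂ (2^{mσ⁺} / ε')`. -/
def logTerm (A c σ : ℝ) (m : ℕ) (ε : ℝ) : ℝ :=
  Real.logb 2 ((2 : ℝ) ^ mSig m σ / epsPrime A c m ε)

/-- The smallness condition on `ε'`. -/
def EpsCondition (A c σ : ℝ) (m : ℕ) (ε : ℝ) : Prop :=
  epsPrime A c m ε ≤
    if Real.log 2 ≤ mSig m σ then (2 : ℝ) ^ (mSig m σ - (mSig m σ / Real.log 2) ^ 2)
    else (2 : ℝ) ^ (mSig m σ - 1)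

/-- `n_th = ⌈(L + max(1, mσ⁺) log₂ L - 1/2) / 2⌉` with `L = log₂ (2^{mσ⁺} / ε')`. -/
def nTh (A c σ : ℝ) (m : ℕ) (ε : ℝ) : ℕ :=
  ⌈(1 / 2 : ℝ) * (logTerm A c σ m ε + max 1 (mSig m σ) * Real.logb 2 (logTerm A c σ m ε) - 1 / 2)⌉₊

/-- `h_th = 1 / (e c m (2n+1)^{σ⁺})`. -/
def hTh (c σ : ℝ) (m n : ℕ) : ℝ :=
  1 / (Real.exp 1 * c * m * ((2 * n + 1 : ℕ) : ℝ) ^ max σ 0)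

/-! ### Quantum query algorithms

Qubits are labelled by the elements of a finite type `Q`; the computational basis states are the bit
strings `Q → Bool`, and a state is a vector of amplitudes `(Q → Bool) → ℂ`. -/

/-- The computational basis state `|b⟩`. -/
def ket {Q : Type} (b : Q → Bool) : (Q → Bool) → ℂ :=
  open Classical in fun b' => if b' = b then 1 else 0

/-- The operator that acts as `U` on the qubits `f r`, `r : R`, and as the identity on all others. -/
def onQubits {R Q : Type} (f : R ↪ Q) (U : Matrix (R → Bool) (R → Bool) ℂ) :
    Matrix (Q → Bool) (Q → Bool) ℂ :=
  open Classical in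
  Matrix.of fun b b' => if ∀ q, q ∉ Set.range f → b q = b' q then U (b ∘ f) (b' ∘ f) else 0

/-- The four oracles: `O_S`, `O_{F,ε̃}`, `O_coef` and `O_sign`. -/
inductive OracleName : Type
  | prob
  | func
  | coef
  | sgn

/-- A gate on the qubits `Q`: either a fixed unitary, which costs nothing, or one call of an oracle `k`
or, if `inv` is true, of its inverse, on the qubits selected by `f`. The qubits of the register on which
oracle `k` acts are labelled by `R k`. -/
inductive Gate (R : OracleName → Type) (Q : Type) [Fintype Q] [DecidableEq Q] : Type
  | free (V : Matrix.unitaryGroup (Q → Bool) ℂ)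
  | query (k : OracleName) (inv : Bool) (f : R k ↪ Q)

/-- The operator performed by a gate when the oracles are given by the matrices `O k`. -/
def Gate.op {R : OracleName → Type} {Q : Type} [Fintype Q] [DecidableEq Q]
    (O : (k : OracleName) → Matrix (R k → Bool) (R k → Bool) ℂ) :
    Gate R Q → Matrix (Q → Bool) (Q → Bool) ℂ
  | .free V => (V : Matrix (Q → Bool) (Q → Bool) ℂ)
  | .query k false f => onQubits f (O k)
  | .query k true f => onQubits f (O k)ᴴ

/-- The number of calls (0 or 1) that a gate makes to oracle `k`, inverse calls included. -/
def Gate.cost {R : OracleName → Type} {Q : Type} [Fintype Q] [DecidableEq Q] (k : OracleName) :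
    Gate R Q → ℕ
  | .free _ => 0
  | .query k' _ _ => open Classical in if k' = k then 1 else 0

/-- A quantum query algorithm with real output: start with all qubits in `|0⟩`, apply the gates of the
circuit in order (the head of the list first), measure all qubits in the computational basis and output
`readout` of the bit string found. The circuit and `readout` do not depend on the oracles. -/
structure Algorithm (R : OracleName → Type) where
  Q : Type
  [fintypeQ : Fintype Q]
  [decEqQ : DecidableEq Q]
  circuit : List (Gate R Q)
  readout : (Q → Bool) → ℝ

attribute [instance] Algorithm.fintypeQ Algorithm.decEqQ

namespace Algorithm

variable {R : OracleName → Type}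

/-- The number of calls to oracle `k` and its inverse. -/
def calls (𝒜 : Algorithm R) (k : OracleName) : ℕ := (𝒜.circuit.map (Gate.cost k)).sum

/-- The state before the measurement. -/
def finalState (𝒜 : Algorithm R) (O : (k : OracleName) → Matrix (R k → Bool) (R k → Bool) ℂ) :
    (𝒜.Q → Bool) → ℂ :=
  𝒜.circuit.foldl (fun ψ g => g.op O *ᵥ ψ) (ket fun _ => false)

/-- The probability that the output is a `tol`-approximation of `v`. -/
def successProb (𝒜 : Algorithm R) (O : (k : OracleName) → Matrix (R k → Bool) (R k → Bool) ℂ)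
    (v tol : ℝ) : ℝ :=
  open Classical in
  ∑ b : 𝒜.Q → Bool, if |𝒜.readout b - v| ≤ tol then ‖𝒜.finalState O b‖ ^ 2 else 0

end Algorithm

/-! ### The computational task -/

/-- The registers of an oracle `O_{F,δ}` other than the one for `s`: numbers of qubits of the register
holding the parameter, of the register receiving the value, and of the ancillas; the bit string that
represents a parameter; and the real number represented by a bit string in the value register. -/
structure FuncFormat where
  wX : ℕ
  wY : ℕ
  wA : ℕ
  codeX : ℝ → (Fin wX → Bool)
  valY : (Fin wY → Bool) → ℝ

/-- The data known to the algorithm: the finite set `S`, the numbers `m, n, h, ε`, the point `x`, the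
bound `B`, and the formats of the registers of the oracles. Nothing about the probabilities `p`
or the integrand `F` other than the bound `B` enters here. -/
structure Task where
  S : Type u
  [fintypeS : Fintype S]
  m : ℕ
  n : ℕ
  h : ℝ
  ε : ℝ
  x : ℝ
  B : ℝ
  one_le_m : 1 ≤ m
  m_le : m ≤ 2 * n
  h_pos : 0 < h
  ε_pos : 0 < ε
  B_nonneg : 0 ≤ B
  /-- the register for `s`, with distinct bit strings for distinct elements -/
  wS : ℕ
  codeS : S → (Fin wS → Bool)
  codeS_inj : Function.Injective codeS
  /-- the register for `j ∈ [-n:n]` -/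
  wJ : ℕ
  codeJ : ℤ → (Fin wJ → Bool)
  codeJ_inj : Set.InjOn codeJ (nodes n)
  /-- the format of `O_{F,δ}` for every precision `δ` -/
  fmt : ℝ → FuncFormat
  /-- the grid points are distinguished by the parameter register of `O_{F,ε̃}` -/
  codeX_inj : Set.InjOn (fmt (epsTilde m n h ε)).codeX ((fun j : ℤ => x + j * h) '' (nodes n))

attribute [instance] Task.fintypeS

namespace Task

variable (T : Task.{u})

/-- `ε̃` of the task. -/
def εt : ℝ := epsTilde T.m T.n T.h T.ε

/-- The number of qubits, ancillas included, on which `O_{F,δ}` acts. -/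
def qubitsF (δ : ℝ) : ℕ := T.wS + (T.fmt δ).wX + (T.fmt δ).wY + (T.fmt δ).wA

/-- The qubits of `O_S`. -/
abbrev RegProb : Type := Fin T.wS

/-- The qubits of `O_{F,ε̃}`: registers for `s`, the parameter, the value, and ancillas. -/
abbrev RegFunc : Type :=
  Fin T.wS ⊕ Fin (T.fmt T.εt).wX ⊕ Fin (T.fmt T.εt).wY ⊕ Fin (T.fmt T.εt).wA

/-- The qubits of `O_coef`. -/
abbrev RegCoef : Type := Fin T.wJ

/-- The qubits of `O_sign`: a register for `j` and one qubit for the sign. -/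
abbrev RegSgn : Type := Fin T.wJ ⊕ Unit

/-- The qubits on which each oracle acts. -/
def Reg : OracleName → Type
  | .prob => T.RegProb
  | .func => T.RegFunc
  | .coef => T.RegCoef
  | .sgn => T.RegSgn

/-- Four unitary operators, on the registers of the four oracles. -/
structure Oracles where
  prob : Matrix.unitaryGroup (T.RegProb → Bool) ℂ
  func : Matrix.unitaryGroup (T.RegFunc → Bool) ℂ
  coef : Matrix.unitaryGroup (T.RegCoef → Bool) ℂ
  sgn : Matrix.unitaryGroup (T.RegSgn → Bool) ℂ

variable {T}

/-- The matrix of each oracle. -/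
def Oracles.mat (O : T.Oracles) : (k : OracleName) → Matrix (T.Reg k → Bool) (T.Reg k → Bool) ℂ
  | .prob => (O.prob : Matrix (T.RegProb → Bool) (T.RegProb → Bool) ℂ)
  | .func => (O.func : Matrix (T.RegFunc → Bool) (T.RegFunc → Bool) ℂ)
  | .coef => (O.coef : Matrix (T.RegCoef → Bool) (T.RegCoef → Bool) ℂ)
  | .sgn => (O.sgn : Matrix (T.RegSgn → Bool) (T.RegSgn → Bool) ℂ)

variable (T)

/-- The basis state label `|s⟩|ξ⟩|y⟩|0⟩` of the register of `O_{F,ε̃}`. -/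
def funcBits (s : T.S) (ξ : ℝ) (y : Fin (T.fmt T.εt).wY → Bool) : T.RegFunc → Bool :=
  Sum.elim (T.codeS s) (Sum.elim ((T.fmt T.εt).codeX ξ) (Sum.elim y fun _ => false))

variable {T}

/-- The operators `O` are oracles for the distribution `p`, the approximate integrand `G` and the
difference coefficients:
`O_S |0⟩ = ∑_s √p_s |s⟩`; `O_{F,ε̃} |s⟩|ξ⟩|0⟩ = |s⟩|ξ⟩|G(s,ξ)⟩` at the grid points `ξ = x + jh`, with
ancillas returned to `|0⟩`; `O_coef |0⟩ = ∑_j √(|d_j| / D_n) |j⟩`; `O_sign |j⟩|0⟩ = |j⟩|θ_j⟩` with `θ_j = 1`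
if and only if `d_j ≥ 0`. -/
structure Oracles.Implements (O : T.Oracles) (p : T.S → ℝ) (G : T.S → ℝ → ℝ) : Prop where
  prob : (O.prob : Matrix (T.RegProb → Bool) (T.RegProb → Bool) ℂ) *ᵥ ket (fun _ => false) =
    ∑ s, ((Real.sqrt (p s) : ℝ) : ℂ) • ket (T.codeS s)
  func : ∀ (s : T.S), ∀ j ∈ nodes T.n, ∃ y : Fin (T.fmt T.εt).wY → Bool,
    (T.fmt T.εt).valY y = G s (T.x + j * T.h) ∧
    (O.func : Matrix (T.RegFunc → Bool) (T.RegFunc → Bool) ℂ) *ᵥ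
        ket (T.funcBits s (T.x + j * T.h) fun _ => false) =
      ket (T.funcBits s (T.x + j * T.h) y)
  coef : (O.coef : Matrix (T.RegCoef → Bool) (T.RegCoef → Bool) ℂ) *ᵥ ket (fun _ => false) =
    ∑ j ∈ nodes T.n, ((Real.sqrt (|dCoef T.m T.n j| / DSum T.m T.n) : ℝ) : ℂ) • ket (T.codeJ j)
  sgn : ∀ j ∈ nodes T.n,
    (O.sgn : Matrix (T.RegSgn → Bool) (T.RegSgn → Bool) ℂ) *ᵥ
        ket (Sum.elim (T.codeJ j) fun _ => false) =
      ket (Sum.elim (T.codeJ j) fun _ => decide (0 ≤ dCoef T.m T.n j))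

variable (T)

/-- `V(ξ) = ∑_s p_s F(s, ξ)`. -/
def V (p : T.S → ℝ) (F : T.S → ℝ → ℝ) (ξ : ℝ) : ℝ := ∑ s, p s * F s ξ

/-- `p` is a probability distribution on `S`, `|F| ≤ B`, and `V` is in `𝒢_{A,c,σ}` for some `A, c, σ` for
which the step condition holds. -/
structure Admissible (p : T.S → ℝ) (F : T.S → ℝ → ℝ) : Prop where
  p_mem : ∀ s, 0 ≤ p s ∧ p s ≤ 1
  p_sum : ∑ s, p s = 1
  F_bound : ∀ s ξ, |F s ξ| ≤ T.B
  V_gevrey : ∃ A c σ : ℝ, 0 < A ∧ 0 < c ∧ Gevrey A c σ (T.V p F) ∧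
    StepCondition A c σ T.m T.n T.h T.ε

/-- `𝒜` outputs a `3ε`-approximation of `V^{(m)}(x)` with probability at least `0.99`, for all admissible
`p` and `F`, all `F_{ε̃}` with `|F_{ε̃} - F| ≤ ε̃`, and all operators that act as the oracles have to. -/
def SolvedBy (𝒜 : Algorithm T.Reg) : Prop :=
  ∀ (p : T.S → ℝ) (F G : T.S → ℝ → ℝ) (O : T.Oracles),
    T.Admissible p F → (∀ s ξ, |G s ξ - F s ξ| ≤ T.εt) → O.Implements p G →
      0.99 ≤ 𝒜.successProb O.mat (iteratedDeriv T.m (T.V p F) T.x) (3 * T.ε)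

/-- The oracles `O_{F,δ}` use at most `C log^a (1/δ)` qubits for all precisions `0 < δ ≤ δ₀`. -/
def QubitGrowth (a C δ₀ : ℝ) : Prop :=
  ∀ δ : ℝ, 0 < δ → δ ≤ δ₀ → (T.qubitsF δ : ℝ) ≤ C * Real.log (1 / δ) ^ a

end Task

end SumInQAE

end

open SumInQAE

noncomputable section

namespace SumInQAE

/-! ### Elementary symmetric sums -/

/-! Three estimates, each costing at most `ε`, separate the output from the derivative: the error of
the difference formula, the error of replacing `F` by its approximation, and the statistical error
of the quantum estimate.

Difference formula. Lagrange interpolation makes the formula exact on polynomials of degree at most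
`2n` (`sum_dCoef_mul_pow`), so only Taylor remainders of order `2n+1` survive. Writing `aCoef` as
the product of all nonzero nodes other than `j`, times an elementary symmetric function of
reciprocals, gives `|d_j| ≤ m (2 H_n)^(m-1) / |j|` with `H_n` the harmonic number. Hence `D` is at
most `2 m (2 (1 + log n))^m`, and the remainder sum is bounded by the constant of the step condition
(`sum_abs_dCoef_mul_pow_le`).

Quantum estimate. One call of each oracle prepares `Ψ`, a superposition over `(s, j)` with weights
`p_s |d_j| / D` that carries the value and the sign. A one-qubit reflection controlled by these
registers is an involution `S` whose mean in `Ψ` is the normalised difference quotient `c`. If `W`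
is the reflection about `Ψ` times `S`, the vectors `W^k Ψ` satisfy the Chebyshev recurrence with
parameter `c` (`walk_recurrence`). Attached to a clock register with slowly varying amplitudes that
vanish at both ends, they form an approximate eigenvector, with eigenvalue `2c`, of the operator
that hops between neighbouring clock values (`sqNorm_hop_sub_le`). Measuring that operator yields
`c` with mean square error `O(1/N²)` after `N` steps, and Chebyshev's inequality gives the success
probability (`estimator_successProb`). Taking `N` proportional to `B D / (h^m ε)` gives the query
bound.

Parameters. With `h_th` the step condition reduces to `(2n+1)^(mσ⁺) ≤ ε' 2^(2n+1)`, which the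
logarithmic correction in `n_th` solves (`mul_log_threshold_le`). The asymptotic claims hold because
`2 n_th / L` tends to 1. The qubit bounds hold because `1/ε̃` is at most the square of the argument
of the logarithm, so the constant is `2^a`. -/

lemma factorial_mul_sum_powersetCard_prod_le {ι : Type*} [DecidableEq ι] (s : Finset ι) (x : ι → ℝ)
    (hx : ∀ i ∈ s, 0 ≤ x i) (k : ℕ) :
    (k ! : ℝ) * ∑ P ∈ s.powersetCard k, ∏ i ∈ P, x i ≤ (∑ i ∈ s, x i) ^ k := by
  induction s using Finset.induction_on generalizing k with
  | empty =>
    cases k with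
    | zero => simp
    | succ k => rw [Finset.powersetCard_eq_empty.2 (by simp)]; simp
  | insert a s ha ih =>
    cases k with
    | zero => simp
    | succ k =>
      have hs : ∀ i ∈ s, 0 ≤ x i := fun i hi => hx i (Finset.mem_insert_of_mem hi)
      have ha0 : 0 ≤ x a := hx a (Finset.mem_insert_self _ _)
      have hdisj : Disjoint (s.powersetCard (k + 1)) ((s.powersetCard k).image (insert a)) := by
        rw [Finset.disjoint_left]
        intro P hP hP'
        obtain ⟨P', -, rfl⟩ := Finset.mem_image.1 hP'
        exact ha ((Finset.mem_powersetCard.1 hP).1 (Finset.mem_insert_self _ _))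
      have hnot : ∀ P ∈ s.powersetCard k, a ∉ P := fun P hP h =>
        ha ((Finset.mem_powersetCard.1 hP).1 h)
      have himage : ∑ P ∈ (s.powersetCard k).image (insert a), ∏ i ∈ P, x i
          = x a * ∑ P ∈ s.powersetCard k, ∏ i ∈ P, x i := by
        rw [Finset.sum_image, Finset.mul_sum]
        · exact Finset.sum_congr rfl fun P hP => Finset.prod_insert (hnot P hP)
        · intro P hP P' hP' h
          have := congrArg (fun t => t.erase a) h
          simpa [Finset.erase_insert (hnot P hP), Finset.erase_insert (hnot P' hP')] using this
      rw [Finset.powersetCard_succ_insert ha, Finset.sum_union hdisj, himage,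
        Finset.sum_insert ha]
      have hp : 0 ≤ ∑ i ∈ s, x i := Finset.sum_nonneg hs
      have h1 := ih hs (k + 1)
      have h2 := ih hs k
      -- The inductive step is the Bernoulli-type bound `p^(k+1) + (k+1) p^k x_a ≤ (p + x_a)^(k+1)`:
      -- subsets avoiding `a` go to the first term, those containing `a` to the second.
      have h3 := pow_add_mul_le_add_pow (a := ∑ i ∈ s, x i) (b := x a) hp (by linarith) (k + 1)
      simp only [add_tsub_cancel_right] at h3
      rw [add_comm (x a)]
      refine le_trans ?_ h3
      rw [mul_add]
      refine add_le_add h1 ?_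
      rw [Nat.factorial_succ]
      push_cast
      have := mul_le_mul_of_nonneg_left h2 (mul_nonneg (Nat.cast_add_one_pos k).le ha0)
      linarith

/-- Complementation of subsets. It trades the symmetric function of large degree in `aCoef` for one
of degree `m - 1` in the reciprocals, whose sum is only logarithmic in `n`. -/
lemma sum_powersetCard_prod_eq_prod_mul_inv {ι : Type*} [DecidableEq ι] (s : Finset ι) (x : ι → ℝ)
    (hx : ∀ i ∈ s, x i ≠ 0) {k : ℕ} (hk : k ≤ s.card) :
    ∑ P ∈ s.powersetCard (s.card - k), ∏ i ∈ P, x i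
      = (∏ i ∈ s, x i) * ∑ P ∈ s.powersetCard k, ∏ i ∈ P, (x i)⁻¹ := by
  rw [Finset.mul_sum]
  refine Finset.sum_bij' (fun P _ => s \ P) (fun P _ => s \ P) ?_ ?_ ?_ ?_ ?_
  · intro P hP
    obtain ⟨h1, h2⟩ := Finset.mem_powersetCard.1 hP
    refine Finset.mem_powersetCard.2 ⟨Finset.sdiff_subset, ?_⟩
    rw [Finset.card_sdiff_of_subset h1, h2]; omega
  · intro P hP
    obtain ⟨h1, h2⟩ := Finset.mem_powersetCard.1 hP
    refine Finset.mem_powersetCard.2 ⟨Finset.sdiff_subset, ?_⟩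
    rw [Finset.card_sdiff_of_subset h1, h2]
  · intro P hP
    exact Finset.sdiff_sdiff_eq_self (Finset.mem_powersetCard.1 hP).1
  · intro P hP
    exact Finset.sdiff_sdiff_eq_self (Finset.mem_powersetCard.1 hP).1
  · intro P hP
    have h1 := (Finset.mem_powersetCard.1 hP).1
    rw [← Finset.prod_sdiff h1, mul_right_comm, ← Finset.prod_mul_distrib,
      Finset.prod_congr rfl (fun i hi => mul_inv_cancel₀ (hx i (Finset.mem_sdiff.1 hi).1))]
    simp

/-! ### The grid -/

lemma mem_nodes {n : ℕ} {j : ℤ} : j ∈ nodes n ↔ -(n : ℤ) ≤ j ∧ j ≤ n := Finset.mem_Icc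

lemma zero_mem_nodes (n : ℕ) : (0 : ℤ) ∈ nodes n := by simp [mem_nodes]

lemma card_nodes (n : ℕ) : (nodes n).card = 2 * n + 1 := by
  simp [nodes]; omega

lemma nodes_succ_erase_zero (n : ℕ) : (nodes (n + 1)).erase 0 =
    insert ((n : ℤ) + 1) (insert (-((n : ℤ) + 1)) ((nodes n).erase 0)) := by
  ext j
  simp only [Finset.mem_erase, Finset.mem_insert, mem_nodes]
  push_cast
  omega

lemma sum_nodes_inv_abs (n : ℕ) :
    ∑ l ∈ (nodes n).erase 0, |(l : ℝ)|⁻¹ = 2 * (harmonic n : ℝ) := by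
  induction n with
  | zero => simp [nodes]
  | succ n ih =>
    have h2 : (-((n : ℤ) + 1)) ∉ (nodes n).erase 0 := by
      simp only [Finset.mem_erase, mem_nodes]; omega
    have h1 : ((n : ℤ) + 1) ∉ insert (-((n : ℤ) + 1)) ((nodes n).erase 0) := by
      simp only [Finset.mem_insert, Finset.mem_erase, mem_nodes]; omega
    rw [nodes_succ_erase_zero, Finset.sum_insert h1, Finset.sum_insert h2, ih, harmonic_succ]
    push_cast
    rw [abs_neg, abs_of_pos (by positivity : (0 : ℝ) < (n : ℝ) + 1)]
    ring

lemma prod_nodes_abs (n : ℕ) : ∏ l ∈ (nodes n).erase 0, |(l : ℝ)| = (n ! : ℝ) ^ 2 := by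
  induction n with
  | zero => simp [nodes]
  | succ n ih =>
    have h2 : (-((n : ℤ) + 1)) ∉ (nodes n).erase 0 := by
      simp only [Finset.mem_erase, mem_nodes]; omega
    have h1 : ((n : ℤ) + 1) ∉ insert (-((n : ℤ) + 1)) ((nodes n).erase 0) := by
      simp only [Finset.mem_insert, Finset.mem_erase, mem_nodes]; omega
    rw [nodes_succ_erase_zero, Finset.prod_insert h1, Finset.prod_insert h2, ih,
      Nat.factorial_succ]
    push_cast
    rw [abs_neg, abs_of_pos (by positivity : (0 : ℝ) < (n : ℝ) + 1)]
    ring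

lemma prod_range_erase_sub (N i : ℕ) (hi : i ≤ N) :
    ∏ l ∈ (Finset.range (N + 1)).erase i, ((i : ℝ) - l) = (-1) ^ (N - i) * (i ! * (N - i)!) := by
  induction N, hi using Nat.le_induction with
  | base =>
    have : (Finset.range (i + 1)).erase i = Finset.range i := by
      ext l; simp only [Finset.mem_erase, Finset.mem_range]; omega
    rw [this, ← Finset.prod_range_reflect]
    simp only [tsub_self, pow_zero, Nat.factorial_zero, Nat.cast_one, mul_one, one_mul]
    rw [← Finset.prod_range_add_one_eq_factorial]
    push_cast
    refine Finset.prod_congr rfl fun l hl => ?_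
    have hl' := Finset.mem_range.1 hl
    rw [Nat.cast_sub (by omega), Nat.cast_sub (by omega)]
    push_cast; ring
  | succ N hN ih =>
    have : (Finset.range (N + 1 + 1)).erase i = insert (N + 1) ((Finset.range (N + 1)).erase i) := by
      ext l; simp only [Finset.mem_erase, Finset.mem_range, Finset.mem_insert]; omega
    rw [this, Finset.prod_insert (by simp), ih, show N + 1 - i = (N - i) + 1 by omega,
      Nat.factorial_succ]
    push_cast [Nat.cast_sub hN]
    ring

/-- These are the denominators of the Lagrange basis polynomials; shifting by `n` turns the nodes
into `0, …, 2n`. -/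
lemma prod_nodes_erase_sub {n : ℕ} {j : ℤ} (hj : j ∈ nodes n) :
    ∏ l ∈ (nodes n).erase j, ((j : ℝ) - l)
      = (-1) ^ ((n : ℤ) - j).toNat * ((((n : ℤ) + j).toNat ! : ℝ) * (((n : ℤ) - j).toNat ! : ℝ)) := by
  obtain ⟨h1, h2⟩ := mem_nodes.1 hj
  obtain ⟨i, hi⟩ : ∃ i : ℕ, (i : ℤ) = n + j := ⟨((n : ℤ) + j).toNat, by omega⟩
  have e1 : ((n : ℤ) + j).toNat = i := by omega
  have e2 : ((n : ℤ) - j).toNat = 2 * n - i := by omega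
  rw [e1, e2, ← prod_range_erase_sub (2 * n) i (by omega)]
  refine Finset.prod_bij' (fun l _ => (l + n).toNat) (fun l _ => (l : ℤ) - n) ?_ ?_ ?_ ?_ ?_
  · intro l hl
    simp only [Finset.mem_erase, mem_nodes, Finset.mem_range] at hl ⊢; omega
  · intro l hl
    simp only [Finset.mem_erase, mem_nodes, Finset.mem_range] at hl ⊢; omega
  · intro l hl
    simp only [Finset.mem_erase, mem_nodes] at hl; omega
  · intro l hl
    omega
  · intro l hl
    simp only [Finset.mem_erase, mem_nodes] at hl
    obtain ⟨r, hr⟩ : ∃ r : ℕ, (r : ℤ) = l + n := ⟨(l + n).toNat, by omega⟩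
    rw [show (l + n).toNat = r by omega, show j = (i : ℤ) - n by omega,
      show l = (r : ℤ) - n by omega]
    push_cast; ring

/-- Equivalent to the central binomial coefficient being the largest in its row. -/
lemma factorial_sq_le {n : ℕ} {j : ℤ} (hj : j ∈ nodes n) :
    (n ! : ℝ) ^ 2 ≤ (((n : ℤ) + j).toNat ! : ℝ) * (((n : ℤ) - j).toNat ! : ℝ) := by
  obtain ⟨h1, h2⟩ := mem_nodes.1 hj
  obtain ⟨i, hi⟩ : ∃ i : ℕ, (i : ℤ) = n + j := ⟨((n : ℤ) + j).toNat, by omega⟩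
  have e1 : ((n : ℤ) + j).toNat = i := by omega
  have e2 : ((n : ℤ) - j).toNat = 2 * n - i := by omega
  rw [e1, e2]
  have h3 := Nat.choose_le_centralBinom i n
  have h4 := Nat.choose_mul_factorial_mul_factorial (show i ≤ 2 * n by omega)
  have h5 := Nat.choose_mul_factorial_mul_factorial (show n ≤ 2 * n by omega)
  rw [show 2 * n - n = n by omega, ← Nat.centralBinom_eq_two_mul_choose, ← h4] at h5
  have hpos : 0 < (2 * n).choose i := Nat.choose_pos (by omega)
  have : n ! ^ 2 ≤ i ! * (2 * n - i)! := by
    by_contra! hlt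
    have := Nat.mul_lt_mul_of_le_of_lt h3 hlt (Nat.centralBinom_pos n)
    nlinarith
  exact_mod_cast this

/-! ### Bounds on the coefficients -/

/-- The product of all nodes other than `0` and `j` has modulus `(n!)² / |j|`; what remains is a
symmetric function of degree `m - 1` in the reciprocals, whose sum is at most `2 H_n`. -/
lemma abs_aCoef_le {m n : ℕ} (hm : 1 ≤ m) (hmn : m ≤ 2 * n) {j : ℤ} (hj : j ∈ nodes n)
    (hj0 : j ≠ 0) :
    ((m - 1)! : ℝ) * |aCoef m n j| ≤ (n ! : ℝ) ^ 2 / |(j : ℝ)| * (2 * (harmonic n : ℝ)) ^ (m - 1) := by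
  set E := ((nodes n).erase 0).erase j with hE
  have hjE : j ∈ (nodes n).erase 0 := Finset.mem_erase.2 ⟨hj0, hj⟩
  have hcard : E.card = 2 * n - 1 := by
    rw [Finset.card_erase_of_mem hjE, Finset.card_erase_of_mem (zero_mem_nodes n), card_nodes]
    omega
  have hne : ∀ l ∈ E, |(l : ℝ)| ≠ 0 := by
    intro l hl
    have : l ≠ 0 := (Finset.mem_erase.1 (Finset.mem_erase.1 hl).2).1
    simpa using this
  have hjpos : 0 < |(j : ℝ)| := by simpa using hj0
  have h1 : |aCoef m n j| ≤ ∑ P ∈ E.powersetCard (E.card - (m - 1)), ∏ l ∈ P, |(l : ℝ)| := by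
    rw [aCoef, hcard, show 2 * n - 1 - (m - 1) = 2 * n - m by omega]
    refine (Finset.abs_sum_le_sum_abs _ _).trans (le_of_eq ?_)
    exact Finset.sum_congr rfl fun P _ => Finset.abs_prod _ _
  rw [sum_powersetCard_prod_eq_prod_mul_inv E _ hne (by omega)] at h1
  have h2 : ∏ l ∈ E, |(l : ℝ)| = (n ! : ℝ) ^ 2 / |(j : ℝ)| := by
    rw [eq_div_iff hjpos.ne', ← prod_nodes_abs, mul_comm, hE,
      Finset.mul_prod_erase _ (fun l : ℤ => |(l : ℝ)|) hjE]
  have h3 := factorial_mul_sum_powersetCard_prod_le E (fun l : ℤ => |(l : ℝ)|⁻¹)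
    (fun _ _ => by positivity) (m - 1)
  have h4 : ∑ l ∈ E, |(l : ℝ)|⁻¹ ≤ 2 * (harmonic n : ℝ) := by
    rw [← sum_nodes_inv_abs]
    exact Finset.sum_le_sum_of_subset_of_nonneg (Finset.erase_subset _ _)
      fun _ _ _ => by positivity
  have h5 := h3.trans (pow_le_pow_left₀ (Finset.sum_nonneg fun _ _ => by positivity) h4 (m - 1))
  rw [h2] at h1
  calc ((m - 1)! : ℝ) * |aCoef m n j|
      ≤ ((m - 1)! : ℝ) * ((n ! : ℝ) ^ 2 / |(j : ℝ)| *
        ∑ P ∈ E.powersetCard (m - 1), ∏ l ∈ P, |(l : ℝ)|⁻¹) := by gcongr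
    _ = (n ! : ℝ) ^ 2 / |(j : ℝ)| * (((m - 1)! : ℝ) *
        ∑ P ∈ E.powersetCard (m - 1), ∏ l ∈ P, |(l : ℝ)|⁻¹) := by ring
    _ ≤ _ := by gcongr

lemma abs_dOff_le {m n : ℕ} (hm : 1 ≤ m) (hmn : m ≤ 2 * n) {j : ℤ} (hj : j ∈ nodes n)
    (hj0 : j ≠ 0) :
    |dOff m n j| ≤ m * (2 * (harmonic n : ℝ)) ^ (m - 1) * |(j : ℝ)|⁻¹ := by
  have hjpos : 0 < |(j : ℝ)| := by simpa using hj0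
  have h1 := abs_aCoef_le hm hmn hj hj0
  have h2 := factorial_sq_le hj
  have hn : (0 : ℝ) < (n ! : ℝ) ^ 2 := by positivity
  have hfac : (m ! : ℝ) = m * ((m - 1)! : ℝ) := by
    exact_mod_cast (Nat.mul_factorial_pred (by omega)).symm
  have hH : 0 ≤ (harmonic n : ℝ) := by
    have := sum_nodes_inv_abs n
    have h : 0 ≤ ∑ l ∈ (nodes n).erase 0, |(l : ℝ)|⁻¹ := Finset.sum_nonneg fun _ _ => by positivity
    linarith
  rw [dOff, abs_div, abs_mul, abs_mul, abs_zpow, abs_neg, abs_one, one_zpow, one_mul,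
    abs_of_nonneg (by positivity : (0 : ℝ) ≤ m !),
    abs_of_nonneg (by positivity : (0 : ℝ) ≤
      (((n : ℤ) + j).toNat ! : ℝ) * (((n : ℤ) - j).toNat ! : ℝ)), hfac]
  rw [div_le_iff₀ (by positivity)]
  calc m * ((m - 1)! : ℝ) * |aCoef m n j| = m * (((m - 1)! : ℝ) * |aCoef m n j|) := by ring
    _ ≤ m * ((n ! : ℝ) ^ 2 / |(j : ℝ)| * (2 * (harmonic n : ℝ)) ^ (m - 1)) := by gcongr
    _ = m * (2 * (harmonic n : ℝ)) ^ (m - 1) * |(j : ℝ)|⁻¹ * (n ! : ℝ) ^ 2 := by ring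
    _ ≤ _ := by gcongr

lemma dCoef_of_ne {m n : ℕ} {j : ℤ} (hj0 : j ≠ 0) : dCoef m n j = dOff m n j := if_neg hj0

lemma DSum_le_harmonic {m n : ℕ} (hm : 1 ≤ m) (hmn : m ≤ 2 * n) :
    DSum m n ≤ 2 * (m * (2 * (harmonic n : ℝ)) ^ m) := by
  have h1 : ∑ j ∈ (nodes n).erase 0, |dOff m n j| ≤ m * (2 * (harmonic n : ℝ)) ^ m := by
    calc ∑ j ∈ (nodes n).erase 0, |dOff m n j|
        ≤ ∑ j ∈ (nodes n).erase 0, m * (2 * (harmonic n : ℝ)) ^ (m - 1) * |(j : ℝ)|⁻¹ :=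
          Finset.sum_le_sum fun j hj => abs_dOff_le hm hmn (Finset.mem_erase.1 hj).2
            (Finset.mem_erase.1 hj).1
      _ = m * (2 * (harmonic n : ℝ)) ^ m := by
          rw [← Finset.mul_sum, sum_nodes_inv_abs, mul_assoc, ← pow_succ,
            Nat.sub_add_cancel hm]
  rw [DSum, ← Finset.add_sum_erase _ _ (zero_mem_nodes n)]
  have h2 : ∑ j ∈ (nodes n).erase 0, |dCoef m n j| = ∑ j ∈ (nodes n).erase 0, |dOff m n j| :=
    Finset.sum_congr rfl fun j hj => by rw [dCoef_of_ne (Finset.mem_erase.1 hj).1]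
  have h3 : |dCoef m n 0| ≤ ∑ j ∈ (nodes n).erase 0, |dOff m n j| := by
    rw [dCoef, if_pos rfl, abs_neg]
    exact Finset.abs_sum_le_sum_abs _ _
  rw [h2]
  linarith

lemma harmonic_nonneg (n : ℕ) : 0 ≤ (harmonic n : ℝ) := by
  rw [harmonic]; push_cast; positivity

lemma DSum_le_log {m n : ℕ} (hm : 1 ≤ m) (hmn : m ≤ 2 * n) :
    DSum m n ≤ 2 * (m * (2 * (1 + Real.log n)) ^ m) := by
  refine (DSum_le_harmonic hm hmn).trans ?_
  have := harmonic_nonneg n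
  gcongr
  exact harmonic_le_one_add_log n

/-! ### Exactness of the formula for polynomials -/

/-- The formula differentiates the interpolation polynomial `m` times at 0, and interpolation
reproduces `X^k`. The constant monomial needs no interpolation, since the central coefficient is
defined to make the coefficients sum to 0; for `k > 0` the central node contributes nothing. -/
lemma sum_dCoef_mul_pow {m n : ℕ} (hm : 1 ≤ m) (hmn : m ≤ 2 * n) {k : ℕ} (hk : k ≤ 2 * n) :
    ∑ j ∈ nodes n, dCoef m n j * (j : ℝ) ^ k = if k = m then (m ! : ℝ) else 0 := by
  rcases Nat.eq_zero_or_pos k with rfl | hk0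
  · rw [if_neg (by omega), ← Finset.add_sum_erase _ _ (zero_mem_nodes n),
      Finset.sum_congr rfl fun j hj => by rw [dCoef_of_ne (Finset.mem_erase.1 hj).1]]
    simp [dCoef]
  have hinj : Set.InjOn (fun j : ℤ => (j : ℝ)) (nodes n) := Int.cast_injective.injOn
  have key := Lagrange.eval_iterate_derivative_eq_sum (s := nodes n) (F := ℝ) hinj
    (P := Polynomial.X ^ k) (by rw [Polynomial.degree_X_pow, card_nodes]; exact_mod_cast by omega)
    (k := m) (by rw [card_nodes]; omega) 0
  have hL : ((Polynomial.derivative^[m] (Polynomial.X ^ k : Polynomial ℝ)).eval 0)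
      = if k = m then (m ! : ℝ) else 0 := by
    rw [Polynomial.iterate_derivative_X_pow_eq_natCast_mul]
    split_ifs with h
    · subst h; simp [Nat.descFactorial_self]
    · rcases lt_or_gt_of_ne h with h | h
      · simp [Nat.descFactorial_of_lt h]
      · simp [zero_pow (show k - m ≠ 0 by omega)]
  rw [← hL, key, Finset.mul_sum]
  refine Finset.sum_congr rfl fun j hj => ?_
  rcases eq_or_ne j 0 with rfl | hj0
  · simp [zero_pow hk0.ne']
  rw [dCoef_of_ne hj0, dOff, prod_nodes_erase_sub hj, card_nodes,
    show 2 * n + 1 - (m + 1) = 2 * n - m by omega]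
  have ha : ∑ t ∈ ((nodes n).erase j).powersetCard (2 * n - m), ∏ a ∈ t, (0 - (a : ℝ))
      = (-1) ^ (2 * n - m) * aCoef m n j := by
    rw [aCoef, Finset.mul_sum, Finset.erase_right_comm]
    symm
    refine (Finset.sum_congr rfl (g := fun t : Finset ℤ => ∏ a ∈ t, (0 - (a : ℝ))) ?_).trans
      (Finset.sum_subset (Finset.powersetCard_mono (Finset.erase_subset _ _)) ?_)
    · intro P hP
      rw [← (Finset.mem_powersetCard.1 hP).2, ← Finset.prod_const, ← Finset.prod_mul_distrib]
      exact Finset.prod_congr rfl fun _ _ => by ring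
    -- Evaluation at 0 kills every subset that contains the node 0, which is why `aCoef` omits that
    -- node.
    · intro P hP hP'
      have h0 : (0 : ℤ) ∈ P := by
        by_contra h0
        refine hP' (Finset.mem_powersetCard.2 ⟨fun l hl => ?_, (Finset.mem_powersetCard.1 hP).2⟩)
        refine Finset.mem_erase.2 ⟨?_, (Finset.mem_powersetCard.1 hP).1 hl⟩
        rintro rfl; exact h0 hl
      exact Finset.prod_eq_zero h0 (by simp)
  rw [ha]
  obtain ⟨h1, h2⟩ := mem_nodes.1 hj
  obtain ⟨i, hi⟩ : ∃ i : ℕ, (i : ℤ) = n - j := ⟨((n : ℤ) - j).toNat, by omega⟩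
  have e2 : ((n : ℤ) - j).toNat = i := by omega
  rw [e2, show (m : ℤ) + n - j = ((m + i : ℕ) : ℤ) by push_cast; omega, zpow_natCast, pow_add]
  have e3 : (-1 : ℝ) ^ (2 * n - m) = (-1) ^ m := by
    have : (-1 : ℝ) ^ (2 * n - m) * (-1) ^ m = 1 := by
      rw [← pow_add, Nat.sub_add_cancel hmn, pow_mul]; norm_num
    rcases neg_one_pow_eq_or ℝ m with h | h <;> rw [h] at this ⊢ <;> linarith
  rw [e3]
  simp only [Polynomial.eval_pow, Polynomial.eval_X]
  rcases neg_one_pow_eq_or ℝ i with h | h <;> rw [h] <;> field_simp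

/-- Exactness on `X^m` bounds `D` from below. This gives positivity of `D`, and later an upper bound
on `ε̃`. -/
lemma factorial_le_DSum_mul_pow {m n : ℕ} (hm : 1 ≤ m) (hmn : m ≤ 2 * n) :
    (m ! : ℝ) ≤ DSum m n * (n : ℝ) ^ m := by
  have h := sum_dCoef_mul_pow hm hmn hmn
  rw [if_pos rfl] at h
  rw [← h, DSum, Finset.sum_mul]
  refine Finset.sum_le_sum fun j hj => ?_
  obtain ⟨h1, h2⟩ := mem_nodes.1 hj
  refine (le_abs_self _).trans ?_
  rw [abs_mul, abs_pow]
  have : |(j : ℝ)| ≤ n := by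
    rw [abs_le]; constructor
    · exact_mod_cast h1
    · exact_mod_cast h2
  gcongr

lemma DSum_pos {m n : ℕ} (hm : 1 ≤ m) (hmn : m ≤ 2 * n) : 0 < DSum m n := by
  have h := factorial_le_DSum_mul_pow hm hmn
  have h0 : (0 : ℝ) < m ! := by positivity
  have h1 : 0 ≤ (n : ℝ) ^ m := by positivity
  by_contra! hD
  nlinarith [mul_nonneg_of_nonpos_of_nonpos hD (neg_nonpos.2 h1)]

/-! ### Error of the central difference formula -/

lemma abs_sub_taylor_le {f : ℝ → ℝ} (hf : ContDiff ℝ ∞ f) {N : ℕ} {M : ℝ}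
    (hM : ∀ y, |iteratedDeriv (N + 1) f y| ≤ M) (x t : ℝ) :
    |f (x + t) - ∑ k ∈ Finset.range (N + 1), iteratedDeriv k f x * t ^ k / k !|
      ≤ M * |t| ^ (N + 1) / (N + 1)! := by
  rcases eq_or_ne t 0 with rfl | ht
  · rw [Finset.sum_range_succ']
    simp
  have hx : x ≠ x + t := by simpa using ht
  have hfN : ContDiff ℝ ((N : WithTop ℕ∞) + 1) f := hf.of_le (by exact_mod_cast le_top)
  obtain ⟨y, -, hy⟩ := taylor_mean_remainder_lagrange_iteratedDeriv (n := N) hx hfN.contDiffOn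
  have hT : taylorWithinEval f N (Set.uIcc x (x + t)) x (x + t)
      = ∑ k ∈ Finset.range (N + 1), iteratedDeriv k f x * t ^ k / k ! := by
    rw [taylor_within_apply]
    refine Finset.sum_congr rfl fun k _ => ?_
    rw [iteratedDerivWithin_eq_iteratedDeriv (uniqueDiffOn_uIcc hx)
      (hf.contDiffAt.of_le (by exact_mod_cast le_top)) Set.left_mem_uIcc, smul_eq_mul,
      add_sub_cancel_left]
    ring
  rw [hT, add_sub_cancel_left] at hy
  rw [hy, abs_div, abs_mul, abs_pow, Nat.abs_cast]
  gcongr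
  exact hM y

/-- The formula is exact on the Taylor polynomial of degree `2n`, so the error is the formula
applied to the remainders at the grid points. -/
lemma abs_iteratedDeriv_sub_le {m n : ℕ} (hm : 1 ≤ m) (hmn : m ≤ 2 * n) {f : ℝ → ℝ}
    (hf : ContDiff ℝ ∞ f) {M : ℝ} (hM : ∀ y, |iteratedDeriv (2 * n + 1) f y| ≤ M) {h : ℝ}
    (hh : 0 < h) (x : ℝ) :
    |iteratedDeriv m f x - (∑ j ∈ nodes n, dCoef m n j * f (x + j * h)) / h ^ m|
      ≤ M * h ^ (2 * n + 1 - m) *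
        ((∑ j ∈ nodes n, |dCoef m n j| * |(j : ℝ)| ^ (2 * n + 1)) / (2 * n + 1)!) := by
  have hmain : ∑ j ∈ nodes n, dCoef m n j *
      (∑ k ∈ Finset.range (2 * n + 1), iteratedDeriv k f x * ((j : ℝ) * h) ^ k / k !)
      = iteratedDeriv m f x * h ^ m := by
    simp_rw [Finset.mul_sum]
    rw [Finset.sum_comm]
    have : ∀ k ∈ Finset.range (2 * n + 1),
        ∑ j ∈ nodes n, dCoef m n j * (iteratedDeriv k f x * ((j : ℝ) * h) ^ k / k !)
        = if k = m then iteratedDeriv m f x * h ^ m else 0 := by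
      intro k hk
      have h1 := sum_dCoef_mul_pow hm hmn (k := k) (by have := Finset.mem_range.1 hk; omega)
      have h2 : ∑ j ∈ nodes n, dCoef m n j * (iteratedDeriv k f x * ((j : ℝ) * h) ^ k / k !)
          = iteratedDeriv k f x * h ^ k / k ! * ∑ j ∈ nodes n, dCoef m n j * (j : ℝ) ^ k := by
        rw [Finset.mul_sum]
        exact Finset.sum_congr rfl fun j _ => by rw [mul_pow]; ring
      rw [h2, h1]
      split_ifs with hkm
      · subst hkm; field_simp
      · simp
    rw [Finset.sum_congr rfl this, Finset.sum_ite_eq' _ m, if_pos (Finset.mem_range.2 (by omega))]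
  have hpos : 0 < h ^ m := pow_pos hh m
  have h1 : iteratedDeriv m f x - (∑ j ∈ nodes n, dCoef m n j * f (x + j * h)) / h ^ m
      = -(∑ j ∈ nodes n, dCoef m n j * (f (x + j * h) -
        ∑ k ∈ Finset.range (2 * n + 1), iteratedDeriv k f x * ((j : ℝ) * h) ^ k / k !)) / h ^ m := by
    simp_rw [mul_sub, Finset.sum_sub_distrib]
    rw [hmain, eq_div_iff hpos.ne', sub_mul, div_mul_cancel₀ _ hpos.ne']
    ring
  rw [h1, abs_div, abs_neg, abs_of_pos hpos, div_le_iff₀ hpos]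
  calc |∑ j ∈ nodes n, dCoef m n j * (f (x + j * h) -
        ∑ k ∈ Finset.range (2 * n + 1), iteratedDeriv k f x * ((j : ℝ) * h) ^ k / k !)|
      ≤ ∑ j ∈ nodes n, |dCoef m n j| * (M * |(j : ℝ) * h| ^ (2 * n + 1) / (2 * n + 1)!) := by
        refine (Finset.abs_sum_le_sum_abs _ _).trans (Finset.sum_le_sum fun j _ => ?_)
        rw [abs_mul]
        gcongr
        exact abs_sub_taylor_le hf hM x _
    _ = M * h ^ (2 * n + 1) *
        ((∑ j ∈ nodes n, |dCoef m n j| * |(j : ℝ)| ^ (2 * n + 1)) / (2 * n + 1)!) := by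
        rw [Finset.sum_div, Finset.mul_sum]
        refine Finset.sum_congr rfl fun j _ => ?_
        rw [abs_mul, mul_pow, abs_of_pos hh]; ring
    _ = _ := by
        rw [show h ^ (2 * n + 1) = h ^ (2 * n + 1 - m) * h ^ m by
          rw [← pow_add, Nat.sub_add_cancel (by omega)]]
        ring

/-! ### Size of the remainder constant. -/

lemma two_mul_harmonic_le (n : ℕ) : 2 * (harmonic n : ℝ) ≤ n + 1 := by
  induction n with
  | zero => simp
  | succ n ih =>
    rcases Nat.eq_zero_or_pos n with rfl | hn
    · norm_num [harmonic_succ]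
    · have h1 : (1 : ℝ) ≤ n := by exact_mod_cast hn
      rw [harmonic_succ]
      push_cast
      have : ((n : ℝ) + 1)⁻¹ ≤ 1 / 2 := by
        rw [inv_eq_one_div]; gcongr; linarith
      linarith

/-- For `m ≤ n`, `x ≤ exp (x - 1)` at `x = (n+1)/m` gives `((n+1)/m)^m ≤ e^(n+1-m) ≤ 4^(n+1-m)`. The
exponent `2(n+1-m)` of 2 is at most `2n - m` exactly because `m ≥ 2`. -/
lemma succ_pow_le_pow_two_mul {m n : ℕ} (hm : 2 ≤ m) (hmn : m ≤ 2 * n) :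
    ((n : ℝ) + 1) ^ m ≤ (m : ℝ) ^ (2 * n) := by
  have hm' : (2 : ℝ) ≤ m := by exact_mod_cast hm
  rcases le_or_gt (n + 1) m with h | h
  · calc ((n : ℝ) + 1) ^ m ≤ (m : ℝ) ^ m := by gcongr; exact_mod_cast h
      _ ≤ _ := pow_le_pow_right₀ (by linarith) hmn
  · have h1 : ((n : ℝ) + 1) / m ≤ Real.exp (((n : ℝ) + 1) / m - 1) := by
      have := Real.add_one_le_exp (((n : ℝ) + 1) / m - 1)
      linarith
    have h2 : (((n : ℝ) + 1) / m) ^ m ≤ Real.exp 1 ^ (n + 1 - m) := by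
      refine (pow_le_pow_left₀ (by positivity) h1 m).trans (le_of_eq ?_)
      rw [← Real.exp_nat_mul, ← Real.exp_nat_mul, Nat.cast_sub h.le]
      congr 1
      field_simp
      push_cast
      ring
    have h3 : Real.exp 1 ^ (n + 1 - m) ≤ (m : ℝ) ^ (2 * n - m) := by
      calc Real.exp 1 ^ (n + 1 - m) ≤ (2 ^ 2) ^ (n + 1 - m) := by
            gcongr; linarith [Real.exp_one_lt_d9]
        _ = 2 ^ (2 * (n + 1 - m)) := by rw [pow_mul]
        _ ≤ 2 ^ (2 * n - m) := pow_le_pow_right₀ (by norm_num) (by omega)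
        _ ≤ _ := by gcongr
    rw [div_pow, div_le_iff₀ (by positivity)] at h2
    calc ((n : ℝ) + 1) ^ m ≤ (m : ℝ) ^ (2 * n - m) * (m : ℝ) ^ m := h2.trans (by gcongr)
      _ = _ := by rw [← pow_add, Nat.sub_add_cancel hmn]

lemma pow_div_factorial_le (n : ℕ) :
    (n : ℝ) ^ (2 * n) / (2 * n)! ≤ (Real.exp 1 / 2) ^ (2 * n) := by
  have := Real.pow_div_factorial_le_exp (x := 2 * n) (by positivity) (2 * n)
  rw [mul_pow, mul_div_assoc] at this
  rw [div_pow, le_div_iff₀ (by positivity), ← Real.exp_nat_mul, mul_one, mul_comm]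
  push_cast
  exact this

lemma pow_succ_div_factorial_le (n : ℕ) :
    (n : ℝ) ^ (2 * n + 1) / (2 * n + 1)! ≤ 1 / 2 * (Real.exp 1 / 2) ^ (2 * n) := by
  have h := pow_div_factorial_le n
  have h1 : (n : ℝ) / (2 * n + 1) ≤ 1 / 2 := by
    rw [div_le_div_iff₀ (by positivity) (by norm_num)]; linarith
  calc (n : ℝ) ^ (2 * n + 1) / (2 * n + 1)!
      = (n : ℝ) / (2 * n + 1) * ((n : ℝ) ^ (2 * n) / (2 * n)!) := by
        rw [Nat.factorial_succ, pow_succ]; push_cast; field_simp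
    _ ≤ _ := by gcongr

lemma sum_abs_dCoef_mul_pow_le {m n : ℕ} (hm : 1 ≤ m) (hmn : m ≤ 2 * n) :
    (∑ j ∈ nodes n, |dCoef m n j| * |(j : ℝ)| ^ (2 * n + 1)) / (2 * n + 1)!
      ≤ m * (Real.exp 1 * m / 2) ^ (2 * n) := by
  have habs : ∀ j ∈ nodes n, |(j : ℝ)| ≤ n := by
    intro j hj
    obtain ⟨h1, h2⟩ := mem_nodes.1 hj
    rw [abs_le]; constructor
    · exact_mod_cast h1
    · exact_mod_cast h2
  -- Bounding the sum by `D n^(2n+1)` is too lossy for `m = 1`, where `m^(2n)` cannot absorb the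
  -- logarithm in `D`. There the decay `|d_j| ≤ 1/|j|` is kept, and each of the `2n` nonzero nodes
  -- contributes at most `n^(2n)`.
  rcases eq_or_lt_of_le hm with rfl | hm2
  · have h1 : ∑ j ∈ nodes n, |dCoef 1 n j| * |(j : ℝ)| ^ (2 * n + 1)
        ≤ 2 * n * (n : ℝ) ^ (2 * n) := by
      rw [← Finset.add_sum_erase _ _ (zero_mem_nodes n)]
      have : ∀ j ∈ (nodes n).erase 0, |dCoef 1 n j| * |(j : ℝ)| ^ (2 * n + 1)
          ≤ (n : ℝ) ^ (2 * n) := by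
        intro j hj
        obtain ⟨hj0, hj⟩ := Finset.mem_erase.1 hj
        have hjpos : 0 < |(j : ℝ)| := by simpa using hj0
        have hd := abs_dOff_le le_rfl hmn hj hj0
        simp only [Nat.cast_one, tsub_self, pow_zero, mul_one, one_mul] at hd
        rw [dCoef_of_ne hj0]
        calc |dOff 1 n j| * |(j : ℝ)| ^ (2 * n + 1)
            ≤ |(j : ℝ)|⁻¹ * |(j : ℝ)| ^ (2 * n + 1) := by gcongr
          _ = |(j : ℝ)| ^ (2 * n) := by rw [pow_succ]; field_simp
          _ ≤ _ := by gcongr; exact habs j hj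
      refine (add_le_add_right (Finset.sum_le_sum this) _).trans ?_
      rw [Finset.sum_const, Finset.card_erase_of_mem (zero_mem_nodes n), card_nodes]
      simp
    have h2 := pow_div_factorial_le n
    rw [div_le_iff₀ (by positivity)] at h2 ⊢
    refine h1.trans ?_
    rw [Nat.factorial_succ]
    push_cast
    rw [one_mul, mul_one]
    have h3 : (0 : ℝ) ≤ (Real.exp 1 / 2) ^ (2 * n) * ((2 * n)! : ℝ) := by positivity
    nlinarith [mul_le_mul_of_nonneg_left h2 (by positivity : (0 : ℝ) ≤ 2 * n)]
  · have h1 : ∑ j ∈ nodes n, |dCoef m n j| * |(j : ℝ)| ^ (2 * n + 1)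
        ≤ DSum m n * (n : ℝ) ^ (2 * n + 1) := by
      rw [DSum, Finset.sum_mul]
      refine Finset.sum_le_sum fun j hj => ?_
      gcongr
      exact habs j hj
    have h2 : DSum m n ≤ 2 * (m * (m : ℝ) ^ (2 * n)) := by
      refine (DSum_le_harmonic hm hmn).trans ?_
      have h3 := pow_le_pow_left₀ (mul_nonneg zero_le_two (harmonic_nonneg n))
        (two_mul_harmonic_le n) m
      have h4 := h3.trans (succ_pow_le_pow_two_mul hm2 hmn)
      gcongr
    calc (∑ j ∈ nodes n, |dCoef m n j| * |(j : ℝ)| ^ (2 * n + 1)) / (2 * n + 1)!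
        ≤ DSum m n * (n : ℝ) ^ (2 * n + 1) / (2 * n + 1)! := by gcongr
      _ = DSum m n * ((n : ℝ) ^ (2 * n + 1) / (2 * n + 1)!) := by ring
      _ ≤ 2 * (m * (m : ℝ) ^ (2 * n)) * (1 / 2 * (Real.exp 1 / 2) ^ (2 * n)) := by
        gcongr
        exact pow_succ_div_factorial_le n
      _ = _ := by rw [mul_div_right_comm, mul_pow]; ring

/-- Under the step condition, the central difference formula is accurate to `ε`. -/
theorem abs_iteratedDeriv_sub_centralDifference_le {m n : ℕ} (hm : 1 ≤ m) (hmn : m ≤ 2 * n)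
    {A c σ h ε : ℝ} {f : ℝ → ℝ} (hf : Gevrey A c σ f) (hh : 0 < h)
    (hstep : StepCondition A c σ m n h ε) (x : ℝ) :
    |iteratedDeriv m f x - (∑ j ∈ nodes n, dCoef m n j * f (x + j * h)) / h ^ m| ≤ ε := by
  have hM := hf.2 (2 * n + 1)
  have hM0 : 0 ≤ A * c ^ (2 * n + 1) * (((2 * n + 1)! : ℕ) : ℝ) ^ σ := (abs_nonneg _).trans (hM 0)
  refine (abs_iteratedDeriv_sub_le hm hmn hf.1 hM hh x).trans (le_trans ?_ hstep)
  have := mul_le_mul_of_nonneg_left (sum_abs_dCoef_mul_pow_le hm hmn)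
    (mul_nonneg hM0 (pow_pos hh (2 * n + 1 - m)).le)
  linarith

open Filter Topology

/-! ### The parameters `n_th` and `h_th` -/

lemma mSig_nonneg (m : ℕ) (σ : ℝ) : 0 ≤ mSig m σ := by unfold mSig; positivity

lemma epsPrime_pos {A c ε : ℝ} {m : ℕ} (hA : 0 < A) (hc : 0 < c) (hε : 0 < ε) (hm : 1 ≤ m) :
    0 < epsPrime A c m ε := by
  have : (0 : ℝ) < m := by exact_mod_cast hm
  unfold epsPrime; positivity

lemma logTerm_eq {A c σ ε : ℝ} {m : ℕ} (hA : 0 < A) (hc : 0 < c) (hε : 0 < ε) (hm : 1 ≤ m) :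
    logTerm A c σ m ε = mSig m σ - Real.logb 2 (epsPrime A c m ε) := by
  have := epsPrime_pos hA hc hε hm
  rw [logTerm, Real.logb_div (by positivity) this.ne', Real.logb_rpow (by norm_num) (by norm_num)]

lemma epsPrime_eq {A c σ ε : ℝ} {m : ℕ} (hA : 0 < A) (hc : 0 < c) (hε : 0 < ε) (hm : 1 ≤ m) :
    epsPrime A c m ε = 2 ^ (mSig m σ - logTerm A c σ m ε) := by
  have := epsPrime_pos hA hc hε hm
  rw [logTerm_eq hA hc hε hm, sub_sub_cancel, Real.rpow_logb (by norm_num) (by norm_num) this]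

/-- Turns every smallness condition on `ε'` into a lower bound on `L`; in particular `EpsCondition`
becomes `L ≥ (τ / log 2)²` or `L ≥ 1`, where `τ = mσ⁺`. -/
lemma le_logTerm_iff {A c σ ε : ℝ} {m : ℕ} (hA : 0 < A) (hc : 0 < c) (hε : 0 < ε) (hm : 1 ≤ m)
    {l : ℝ} : l ≤ logTerm A c σ m ε ↔ epsPrime A c m ε ≤ 2 ^ (mSig m σ - l) := by
  rw [epsPrime_eq (σ := σ) hA hc hε hm, Real.rpow_le_rpow_left_iff (by norm_num)]
  constructor <;> intro h <;> linarith

lemma hTh_pow (c σ : ℝ) (m n : ℕ) :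
    hTh c σ m n ^ m = 1 / ((Real.exp 1 * c * m) ^ m * ((2 * n + 1 : ℕ) : ℝ) ^ mSig m σ) := by
  rw [hTh, div_pow, one_pow, mul_pow, ← Real.rpow_mul_natCast (by positivity), mSig, mul_comm (m : ℝ)]

/-- With `P = (2n+1)^(σ⁺)`, the bound `N! ≤ N^N` replaces the factorial by `P^(2n+1)`. The step
length is the reciprocal of `e c m P`, so all but `m` of the `2n+1` factors `e c m P` cancel,
leaving a factor `2^(-2n)`. -/
lemma stepCondition_hTh {A c σ ε : ℝ} {m n : ℕ} (hm : 1 ≤ m) (hA : 0 < A) (hc : 0 < c)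
    (hmn : m ≤ 2 * n)
    (h : ((2 * n + 1 : ℕ) : ℝ) ^ mSig m σ ≤ epsPrime A c m ε * 2 ^ (2 * n + 1)) :
    StepCondition A c σ m n (hTh c σ m n) ε := by
  have hm0 : (0 : ℝ) < m := by exact_mod_cast hm
  set P : ℝ := ((2 * n + 1 : ℕ) : ℝ) ^ max σ 0 with hP
  have hN1 : (1 : ℝ) ≤ ((2 * n + 1 : ℕ) : ℝ) := by exact_mod_cast (by omega : 1 ≤ 2 * n + 1)
  have hPpos : 0 < P := by positivity
  have hPm : ((2 * n + 1 : ℕ) : ℝ) ^ mSig m σ = P ^ m := by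
    rw [hP, ← Real.rpow_mul_natCast (by positivity), mSig, mul_comm (m : ℝ)]
  have hfac : (((2 * n + 1)! : ℕ) : ℝ) ^ σ ≤ P ^ (2 * n + 1) := by
    calc (((2 * n + 1)! : ℕ) : ℝ) ^ σ ≤ (((2 * n + 1)! : ℕ) : ℝ) ^ max σ 0 :=
          Real.rpow_le_rpow_of_exponent_le (by exact_mod_cast Nat.factorial_pos _) (le_max_left _ _)
      _ ≤ (((2 * n + 1 : ℕ) : ℝ) ^ (2 * n + 1)) ^ max σ 0 :=
          Real.rpow_le_rpow (by positivity) (by exact_mod_cast Nat.factorial_le_pow _)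
            (le_max_right _ _)
      _ = P ^ (2 * n + 1) := by
          rw [hP, ← Real.rpow_natCast, ← Real.rpow_natCast, ← Real.rpow_mul (by positivity),
            ← Real.rpow_mul (by positivity), mul_comm (max σ 0)]
  rw [hPm] at h
  have hx : 0 < Real.exp 1 * c * m * P := by positivity
  have hpow : (Real.exp 1 * c * m * P) ^ (2 * n + 1) * (1 / (Real.exp 1 * c * m * P)) ^ (2 * n + 1 - m)
      = (Real.exp 1 * c * m) ^ m * P ^ m := by
    rw [← mul_pow, one_div, inv_pow, ← div_eq_mul_inv, div_eq_iff (by positivity), ← pow_add]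
    congr 1; omega
  unfold StepCondition
  rw [hTh, ← hP]
  calc A * c ^ (2 * n + 1) * (((2 * n + 1)! : ℕ) : ℝ) ^ σ * m * (Real.exp 1 * m / 2) ^ (2 * n)
        * (1 / (Real.exp 1 * c * m * P)) ^ (2 * n + 1 - m)
      ≤ A * c ^ (2 * n + 1) * P ^ (2 * n + 1) * m * (Real.exp 1 * m / 2) ^ (2 * n)
        * (1 / (Real.exp 1 * c * m * P)) ^ (2 * n + 1 - m) := by gcongr
    _ = A / (Real.exp 1 * 2 ^ (2 * n)) * ((Real.exp 1 * c * m * P) ^ (2 * n + 1) *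
          (1 / (Real.exp 1 * c * m * P)) ^ (2 * n + 1 - m)) := by
        rw [← mul_assoc]
        congr 1
        simp only [mul_pow, div_pow, pow_succ]
        field_simp
    _ = A / (Real.exp 1 * 2 ^ (2 * n)) * ((Real.exp 1 * c * m) ^ m * P ^ m) := by rw [hpow]
    _ ≤ A / (Real.exp 1 * 2 ^ (2 * n)) * ((Real.exp 1 * c * m) ^ m *
          (epsPrime A c m ε * 2 ^ (2 * n + 1))) := by gcongr
    _ = ε := by
        rw [epsPrime, pow_succ]
        field_simp

/-! ### Solving the threshold inequality for `n`. -/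

lemma log_le_div_exp_one {x : ℝ} (hx : 0 < x) : Real.log x ≤ x / Real.exp 1 := by
  have := Real.log_le_sub_one_of_pos (div_pos hx (Real.exp_pos 1))
  rw [Real.log_div hx.ne' (Real.exp_pos 1).ne', Real.log_exp] at this
  linarith

/-- By concavity, beyond `s` the function `τ log` has slope at most `τ / s ≤ log 2`. An inequality
against a line of slope `log 2` thus passes from `s` to any larger number, which makes rounding up
in `n_th` harmless. -/
lemma mul_log_sub_le {τ s t : ℝ} (hs : 0 < s) (hτ : 0 ≤ τ) (hτs : τ ≤ Real.log 2 * s)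
    (hst : s ≤ t) : τ * Real.log t ≤ τ * Real.log s + Real.log 2 * (t - s) := by
  have ht : 0 < t := hs.trans_le hst
  have h1 := Real.log_le_sub_one_of_pos (div_pos ht hs)
  rw [Real.log_div ht.ne' hs.ne'] at h1
  have h2 : τ * (t / s - 1) ≤ Real.log 2 * (t - s) := by
    rw [div_sub_one hs.ne', mul_div_assoc', div_le_iff₀ hs]
    nlinarith
  nlinarith

lemma mul_log_threshold_le {τ l : ℝ} (hτ : 0 ≤ τ)
    (hl : if Real.log 2 ≤ τ then (τ / Real.log 2) ^ 2 ≤ l else 1 ≤ l) :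
    0 < l ∧ τ ≤ Real.log 2 * (l + max 1 τ * Real.logb 2 l + 1 / 2) ∧
    τ * Real.log (l + max 1 τ * Real.logb 2 l + 1 / 2)
      ≤ max 1 τ * Real.log l + Real.log 2 * (1 / 2 + τ) := by
  have hlog := Real.log_two_gt_d9
  have hlog' := Real.log_two_lt_d9
  have hexp := Real.exp_one_gt_d9
  set ℓ := Real.log 2 with hℓ
  have hℓ0 : 0 < ℓ := by linarith
  have h1l : 1 ≤ l ∧ τ ≤ ℓ * l := by
    split_ifs at hl with h
    · have h1 : 1 ≤ τ / ℓ := by rwa [le_div_iff₀ hℓ0, one_mul]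
      have h2 : τ / ℓ ≤ (τ / ℓ) ^ 2 := by nlinarith
      refine ⟨by linarith, ?_⟩
      rw [mul_comm, ← div_le_iff₀ hℓ0]; linarith
    · push Not at h
      exact ⟨hl, by nlinarith⟩
  obtain ⟨h1l, hτl⟩ := h1l
  have hl0 : 0 < l := by linarith
  have hlogl : 0 ≤ Real.log l := Real.log_nonneg h1l
  have hM : 1 ≤ max 1 τ := le_max_left _ _
  have hlogb : Real.logb 2 l = Real.log l / ℓ := rfl
  have hlogb0 : 0 ≤ Real.log l / ℓ := by positivity
  have hM0 : 0 ≤ max 1 τ * Real.logb 2 l := by rw [hlogb]; positivity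
  refine ⟨hl0, by nlinarith, ?_⟩
  have hpos : 0 < l + max 1 τ * Real.logb 2 l + 1 / 2 := by linarith
  -- The split at 1 is that of `max 1 τ`; for `τ` between `log 2` and 1 the hypothesis still gives
  -- `l ≥ 1`, which is all the second case uses.
  rcases le_or_gt 1 τ with h1 | h1
  · rw [if_pos (by linarith)] at hl
    rw [max_eq_right h1] at *
    have hsq : τ / ℓ ≤ Real.sqrt l := Real.le_sqrt_of_sq_le hl
    have hlogsq : Real.log l ≤ 2 * (Real.sqrt l / Real.exp 1) := by
      have h3 := log_le_div_exp_one (Real.sqrt_pos.2 hl0)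
      rw [Real.log_sqrt hl0.le] at h3
      linarith
    have h4 : τ * Real.logb 2 l ≤ 2 / Real.exp 1 * l := by
      calc τ * Real.logb 2 l = τ / ℓ * Real.log l := by rw [hlogb]; ring
        _ ≤ Real.sqrt l * (2 * (Real.sqrt l / Real.exp 1)) := by gcongr
        _ = 2 / Real.exp 1 * (Real.sqrt l * Real.sqrt l) := by ring
        _ = _ := by rw [Real.mul_self_sqrt hl0.le]
    have h5 : 2 / Real.exp 1 ≤ 0.736 := by
      rw [div_le_iff₀ (Real.exp_pos 1)]; linarith
    have h6 : 2 ≤ l := by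
      have : 1.44 ≤ τ / ℓ := by rw [le_div_iff₀ hℓ0]; linarith
      nlinarith
    -- The hypothesis says `τ / log 2 ≤ √l`, and `log l ≤ 2√l / e`, so the logarithmic correction is
    -- at most `0.736 l`. Doubling `l` then costs `τ log 2`, which the right-hand side allows.
    have h7 : l + τ * Real.logb 2 l + 1 / 2 ≤ 2 * l := by nlinarith
    have h8 := Real.log_le_log hpos h7
    rw [Real.log_mul (by norm_num) hl0.ne'] at h8
    nlinarith
  · rw [max_eq_left h1.le] at *
    have h3 := log_le_div_exp_one hl0
    have h4 : Real.logb 2 l ≤ 0.6 * l := by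
      rw [hlogb, div_le_iff₀ hℓ0]
      refine h3.trans ?_
      rw [div_le_iff₀ (Real.exp_pos 1)]
      have : 1 ≤ 0.6 * ℓ * Real.exp 1 := by nlinarith
      nlinarith
    -- Any factor whose square is at most 8 would do in place of 2.25: since `τ < 1`, the allowance
    -- `log 2 (1/2 + τ)` is at least `(3/2) τ log 2`.
    have h7 : l + 1 * Real.logb 2 l + 1 / 2 ≤ 2.25 * l := by linarith
    have h8 := Real.log_le_log hpos h7
    rw [Real.log_mul (by norm_num) hl0.ne'] at h8
    have h9 : 2 * Real.log 2.25 ≤ 3 * ℓ := by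
      have e1 : 2 * Real.log 2.25 = Real.log (2.25 ^ 2) := by rw [Real.log_pow]; norm_num
      have e2 : 3 * ℓ = Real.log (2 ^ 3) := by rw [Real.log_pow]; norm_num [hℓ]
      rw [e1, e2]
      exact Real.log_le_log (by norm_num) (by norm_num)
    nlinarith

theorem stepCondition_nTh_hTh {A c σ ε : ℝ} {m : ℕ} (hm : 1 ≤ m) (hA : 0 < A) (hc : 0 < c)
    (hε : 0 < ε) (hcond : EpsCondition A c σ m ε) (hmn : m ≤ 2 * nTh A c σ m ε) :
    StepCondition A c σ m (nTh A c σ m ε) (hTh c σ m (nTh A c σ m ε)) ε := by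
  refine stepCondition_hTh hm hA hc hmn ?_
  set l := logTerm A c σ m ε with hl
  set τ := mSig m σ with hτ
  have hτ0 : 0 ≤ τ := mSig_nonneg m σ
  have hcond' : if Real.log 2 ≤ τ then (τ / Real.log 2) ^ 2 ≤ l else 1 ≤ l := by
    unfold EpsCondition at hcond
    rw [← hτ] at hcond
    split_ifs at hcond ⊢ with h
    · exact (le_logTerm_iff hA hc hε hm).2 hcond
    · exact (le_logTerm_iff hA hc hε hm).2 hcond
  obtain ⟨hl0, h1, h2⟩ := mul_log_threshold_le hτ0 hcond'
  set s := l + max 1 τ * Real.logb 2 l + 1 / 2 with hs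
  set n := nTh A c σ m ε with hn
  have hlog2 : 0 < Real.log 2 := Real.log_pos (by norm_num)
  -- The `-1/2` in `n_th` and the `+1/2` in `s` differ by the 1 in `2n + 1`.
  have hst : s ≤ ((2 * n + 1 : ℕ) : ℝ) := by
    have : (1 / 2 : ℝ) * (l + max 1 τ * Real.logb 2 l - 1 / 2) ≤ n := Nat.le_ceil _
    push_cast; linarith
  have hs0 : 0 < s := by
    by_contra! hs0
    have hτ' : τ = 0 := le_antisymm (h1.trans (mul_nonpos_of_nonneg_of_nonpos hlog2.le hs0)) hτ0
    rw [hτ', if_neg (not_le.2 hlog2)] at hcond'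
    have := Real.logb_nonneg (b := 2) (by norm_num) hcond'
    have hM : (0 : ℝ) ≤ max 1 τ := by positivity
    nlinarith
  have h3 := mul_log_sub_le hs0 hτ0 h1 hst
  have hlogb : Real.log 2 * Real.logb 2 l = Real.log l := by
    rw [Real.logb]; field_simp
  have h4 : τ * Real.log ((2 * n + 1 : ℕ) : ℝ) ≤ Real.log 2 * (((2 * n + 1 : ℕ) : ℝ) + τ - l) := by
    have : max 1 τ * Real.log l = Real.log 2 * (max 1 τ * Real.logb 2 l) := by rw [← hlogb]; ring
    rw [this] at h2
    have e : Real.log 2 * s = Real.log 2 * l + Real.log 2 * (max 1 τ * Real.logb 2 l)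
      + Real.log 2 * (1 / 2) := by rw [hs]; ring
    nlinarith
  rw [epsPrime_eq (σ := σ) hA hc hε hm, ← hτ, ← hl, ← Real.rpow_natCast 2,
    ← Real.rpow_add (by norm_num), Real.rpow_def_of_pos (by positivity),
    Real.rpow_def_of_pos (by norm_num), Real.exp_le_exp]
  linarith

/-! ### Asymptotics of the parameters -/

lemma tendsto_add_mul_logb_div (M C : ℝ) :
    Tendsto (fun l : ℝ => (l + M * Real.logb 2 l + C) / l) atTop (𝓝 1) := by
  have h1 : Tendsto (fun l : ℝ => Real.log l / l) atTop (𝓝 0) :=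
    Real.isLittleO_log_id_atTop.tendsto_div_nhds_zero
  have h2 : Tendsto (fun l : ℝ => C / l) atTop (𝓝 0) := tendsto_const_nhds.div_atTop tendsto_id
  have h3 : Tendsto (fun l : ℝ => 1 + M / Real.log 2 * (Real.log l / l) + C / l) atTop
      (𝓝 (1 + M / Real.log 2 * 0 + 0)) :=
    (tendsto_const_nhds.add (tendsto_const_nhds.mul h1)).add h2
  simp only [mul_zero, add_zero] at h3
  refine h3.congr' ?_
  filter_upwards [eventually_gt_atTop 0] with l hl
  rw [Real.logb]
  field_simp

/-- `n_th` as a function of `mσ⁺` and `L`. -/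
def nOfLog (τ l : ℝ) : ℕ := ⌈(1 / 2 : ℝ) * (l + max 1 τ * Real.logb 2 l - 1 / 2)⌉₊

lemma nTh_eq (A c σ : ℝ) (m : ℕ) (ε : ℝ) :
    nTh A c σ m ε = nOfLog (mSig m σ) (logTerm A c σ m ε) := rfl

lemma eventually_nOfLog {τ : ℝ} (hτ : 0 ≤ τ) (m : ℕ) : ∀ᶠ l : ℝ in atTop,
    1 ≤ l ∧ m ≤ 2 * nOfLog τ l ∧ (nOfLog τ l : ℝ) ≤ l ∧
    ((2 * nOfLog τ l + 1 : ℕ) : ℝ) ^ τ ≤ 2 * l ^ τ ∧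
    0 ≤ Real.log (nOfLog τ l) ∧
    (1 + Real.log (nOfLog τ l)) ^ m ≤ 2 * Real.log l ^ m := by
  -- The ceiling adds less than 1 to `n`, so `2n + 1` is below `L + max(1, τ) log₂ L - 1/2 + 2 + 1`;
  -- hence the constant `5/2`.
  have hg := tendsto_add_mul_logb_div (max 1 τ) (5 / 2)
  have hlog : Tendsto Real.log atTop atTop := Real.tendsto_log_atTop
  have hgτ := hg.rpow_const (p := τ) (Or.inr hτ)
  rw [Real.one_rpow] at hgτ
  have hglog : Tendsto (fun l : ℝ =>
      ((1 + Real.log ((l + max 1 τ * Real.logb 2 l + 5 / 2) / l)) / Real.log l + 1) ^ m)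
      atTop (𝓝 1) := by
    have h1 := (hg.log one_ne_zero).const_add 1
    have h2 := ((h1.div_atTop hlog).add_const 1).pow m
    simpa using h2
  filter_upwards [eventually_ge_atTop 1, eventually_gt_atTop 1, eventually_ge_atTop ((m : ℝ) + 2),
    hgτ.eventually_le_const (by norm_num : (1 : ℝ) < 2),
    hglog.eventually_le_const (by norm_num : (1 : ℝ) < 2),
    hg.eventually_le_const (by norm_num : (1 : ℝ) < 2)] with l h1 h1' hml hpow hlogm hg2
  set g := l + max 1 τ * Real.logb 2 l + 5 / 2 with hgdef
  have hl0 : 0 < l := by linarith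
  have hlogb : 0 ≤ max 1 τ * Real.logb 2 l :=
    mul_nonneg (by positivity) (Real.logb_nonneg (by norm_num) h1)
  have hgpos : 0 < g := by linarith
  have hlow : (1 / 2 : ℝ) * (l + max 1 τ * Real.logb 2 l - 1 / 2) ≤ nOfLog τ l := Nat.le_ceil _
  have hup : (nOfLog τ l : ℝ) < (1 / 2 : ℝ) * (l + max 1 τ * Real.logb 2 l - 1 / 2) + 1 :=
    Nat.ceil_lt_add_one (by linarith)
  have hNg : ((2 * nOfLog τ l + 1 : ℕ) : ℝ) ≤ g := by push_cast; linarith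
  have hn1 : 1 ≤ nOfLog τ l := by
    have : (0 : ℝ) < nOfLog τ l := by linarith [(Nat.cast_nonneg m : (0 : ℝ) ≤ m)]
    exact_mod_cast this
  have hn1' : (1 : ℝ) ≤ nOfLog τ l := by exact_mod_cast hn1
  have hgl : g ≤ 2 * l := by rwa [div_le_iff₀ hl0] at hg2
  have hngg : (nOfLog τ l : ℝ) ≤ g := by push_cast at hNg; linarith
  have hlogl : 0 < Real.log l := Real.log_pos h1'
  refine ⟨h1, ?_, ?_, ?_, Real.log_nonneg hn1', ?_⟩
  · have : (m : ℝ) ≤ 2 * nOfLog τ l := by linarith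
    exact_mod_cast this
  · push_cast at hNg; linarith
  · calc ((2 * nOfLog τ l + 1 : ℕ) : ℝ) ^ τ ≤ g ^ τ :=
          Real.rpow_le_rpow (by positivity) hNg hτ
      _ = (g / l) ^ τ * l ^ τ := by
          rw [← Real.mul_rpow (by positivity) hl0.le, div_mul_cancel₀ _ hl0.ne']
      _ ≤ 2 * l ^ τ := by gcongr
  · calc (1 + Real.log (nOfLog τ l)) ^ m ≤ (1 + Real.log g) ^ m := by
          have := Real.log_nonneg hn1'
          gcongr
      _ = ((1 + Real.log (g / l)) / Real.log l + 1) ^ m * Real.log l ^ m := by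
          rw [← mul_pow, Real.log_div hgpos.ne' hl0.ne']
          congr 1
          field_simp
          ring
      _ ≤ 2 * Real.log l ^ m := by gcongr

/-- Since `2^L` is `1/ε` up to a constant, this absorbs all powers of `L` and `log L` into a single
factor `1/ε`. -/
lemma eventually_rpow_mul_log_pow_le {κ : ℝ} (hκ : 0 < κ) (τ : ℝ) (m : ℕ) :
    ∀ᶠ l : ℝ in atTop, l ^ τ * Real.log l ^ m ≤ κ * 2 ^ l := by
  have h := (isLittleO_rpow_exp_pos_mul_atTop (τ + m) (Real.log_pos (by norm_num : (1 : ℝ) < 2))).def hκ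
  filter_upwards [h, eventually_ge_atTop 1] with l hl h1
  have hl0 : 0 < l := by linarith
  rw [Real.norm_of_nonneg (by positivity), Real.norm_of_nonneg (by positivity)] at hl
  have h2 : Real.log l ≤ l := (Real.log_le_sub_one_of_pos hl0).trans (by linarith)
  have h3 := Real.log_nonneg h1
  calc l ^ τ * Real.log l ^ m ≤ l ^ τ * l ^ m := by gcongr
    _ = l ^ (τ + m) := by rw [Real.rpow_add hl0, Real.rpow_natCast]
    _ ≤ _ := by rwa [Real.rpow_def_of_pos (by norm_num : (0 : ℝ) < 2)]

/-! ### Amplitude vectors and unitary matrices -/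

/-- The squared norm of a vector of amplitudes. -/
def sqNorm {ι : Type*} [Fintype ι] (ψ : ι → ℂ) : ℝ := ∑ b, ‖ψ b‖ ^ 2

set_option linter.unusedSectionVars false

section Vectors

variable {ι : Type*} [Fintype ι]

lemma ofReal_sqNorm (ψ : ι → ℂ) : ((sqNorm ψ : ℝ) : ℂ) = star ψ ⬝ᵥ ψ := by
  simp [sqNorm, dotProduct, Complex.conj_mul']

lemma sqNorm_smul (a : ℂ) (ψ : ι → ℂ) : sqNorm (a • ψ) = ‖a‖ ^ 2 * sqNorm ψ := by
  simp [sqNorm, mul_pow, Finset.mul_sum]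

lemma sqNorm_add_le (χ ψ : ι → ℂ) : sqNorm (χ + ψ) ≤ 2 * sqNorm χ + 2 * sqNorm ψ := by
  simp only [sqNorm, Finset.mul_sum, ← Finset.sum_add_distrib]
  refine Finset.sum_le_sum fun b _ => ?_
  have h := norm_add_le (χ b) (ψ b)
  have h0 := norm_nonneg (χ b + ψ b)
  simp only [Pi.add_apply]
  nlinarith [sq_nonneg (‖χ b‖ - ‖ψ b‖)]

lemma star_mulVec_dotProduct {κ : Type*} [Fintype κ] (A : Matrix κ ι ℂ) (v : ι → ℂ) (w : κ → ℂ) :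
    star (A *ᵥ v) ⬝ᵥ w = star v ⬝ᵥ (Aᴴ *ᵥ w) := by
  rw [Matrix.star_mulVec, Matrix.dotProduct_mulVec]

lemma sqNorm_mulVec_of_mem_unitary [DecidableEq ι] {U : Matrix ι ι ℂ}
    (hU : U ∈ Matrix.unitaryGroup ι ℂ) (ψ : ι → ℂ) : sqNorm (U *ᵥ ψ) = sqNorm ψ := by
  have h : ((sqNorm (U *ᵥ ψ) : ℝ) : ℂ) = ((sqNorm ψ : ℝ) : ℂ) := by
    rw [ofReal_sqNorm, ofReal_sqNorm, star_mulVec_dotProduct, Matrix.mulVec_mulVec,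
      ← Matrix.star_eq_conjTranspose, Matrix.mem_unitaryGroup_iff'.1 hU, Matrix.one_mulVec]
  exact_mod_cast h

lemma sqNorm_sum_of_orthogonal {κ : Type*} [DecidableEq κ] (s : Finset κ) (v : κ → ι → ℂ)
    (h : ∀ i ∈ s, ∀ j ∈ s, i ≠ j → star (v i) ⬝ᵥ v j = 0) :
    sqNorm (∑ i ∈ s, v i) = ∑ i ∈ s, sqNorm (v i) := by
  have h1 : ((sqNorm (∑ i ∈ s, v i) : ℝ) : ℂ) = ((∑ i ∈ s, sqNorm (v i) : ℝ) : ℂ) := by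
    rw [ofReal_sqNorm, star_sum, sum_dotProduct]
    push_cast
    refine Finset.sum_congr rfl fun i hi => ?_
    rw [dotProduct_sum, Finset.sum_eq_single i (fun j hj hji => h i hi j hj hji.symm)
      (fun h => absurd hi h), ofReal_sqNorm]
  exact_mod_cast h1

/-- The vector is extended to an orthonormal basis, whose members become the columns. -/
lemma exists_unitary_mulVec_single [DecidableEq ι] {v : ι → ℂ} (hv : sqNorm v = 1) (b : ι) :
    ∃ U : Matrix.unitaryGroup ι ℂ, (U : Matrix ι ι ℂ) *ᵥ Pi.single b 1 = v := by
  let w : ι → EuclideanSpace ℂ ι := fun _ => WithLp.toLp 2 v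
  have hw : ‖(WithLp.toLp 2 v : EuclideanSpace ℂ ι)‖ = 1 := by
    rw [EuclideanSpace.norm_eq, Real.sqrt_eq_one]; exact hv
  have hon : Orthonormal ℂ (({b} : Set ι).domRestrict w) := by
    refine ⟨fun i => hw, fun i j hij => absurd (Subsingleton.elim i j) hij⟩
  obtain ⟨e, he⟩ := hon.exists_orthonormalBasis_extension_of_card_eq (by simp)
  refine ⟨⟨_, (EuclideanSpace.basisFun ι ℂ).toMatrix_orthonormalBasis_mem_unitary e⟩, ?_⟩
  ext i
  rw [Matrix.mulVec_single_one, Matrix.col_apply]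
  change ((EuclideanSpace.basisFun ι ℂ).toBasis.toMatrix e) i b = v i
  rw [Module.Basis.toMatrix_apply]
  simp [he b rfl, w]

/-- Measuring a hermitian observable: the second moment of the deviation of the outcome. -/
lemma sum_eigenvalues_sub_sq [DecidableEq ι] {A : Matrix ι ι ℂ} (hA : A.IsHermitian) (ψ : ι → ℂ)
    (v : ℝ) :
    ∑ b, (hA.eigenvalues b - v) ^ 2 *
        ‖(((star hA.eigenvectorUnitary : Matrix.unitaryGroup ι ℂ) : Matrix ι ι ℂ) *ᵥ ψ) b‖ ^ 2
      = sqNorm (A *ᵥ ψ - (v : ℂ) • ψ) := by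
  set U := hA.eigenvectorUnitary with hU
  set χ := ((star U : Matrix.unitaryGroup ι ℂ) : Matrix ι ι ℂ) *ᵥ ψ with hχ
  have h1 : A *ᵥ ψ - (v : ℂ) • ψ = (U : Matrix ι ι ℂ) *ᵥ
      (fun b => ((hA.eigenvalues b - v : ℝ) : ℂ) * χ b) := by
    have h2 : (U : Matrix ι ι ℂ) *ᵥ χ = ψ := by
      rw [hχ, Matrix.mulVec_mulVec, ← Submonoid.coe_mul]
      simp
    have h3 : A *ᵥ ψ = (U : Matrix ι ι ℂ) *ᵥ (fun b => (hA.eigenvalues b : ℂ) * χ b) := by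
      conv_lhs => rw [hA.spectral_theorem, Unitary.conjStarAlgAut_apply]
      rw [← Matrix.mulVec_mulVec, ← Matrix.mulVec_mulVec]
      congr 1
      ext b
      rw [Matrix.mulVec_diagonal]
      rfl
    have h4 : (v : ℂ) • ψ = (U : Matrix ι ι ℂ) *ᵥ ((v : ℂ) • χ) := by
      rw [Matrix.mulVec_smul, h2]
    rw [h3, h4, ← Matrix.mulVec_sub]
    congr 1
    ext b
    simp [sub_mul]
  rw [h1, sqNorm_mulVec_of_mem_unitary U.2, sqNorm]
  refine Finset.sum_congr rfl fun b _ => ?_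
  rw [norm_mul, mul_pow, Complex.norm_real, Real.norm_eq_abs, sq_abs]

/-- The permutation of the basis states as a unitary matrix. -/
def permUnitary [DecidableEq ι] (σ : Equiv.Perm ι) : Matrix.unitaryGroup ι ℂ :=
  ⟨(1 : Matrix ι ι ℂ).submatrix σ.symm id, by
    rw [Matrix.mem_unitaryGroup_iff, Matrix.star_eq_conjTranspose, Matrix.conjTranspose_submatrix,
      Matrix.conjTranspose_one]
    have := Matrix.submatrix_mul_equiv (1 : Matrix ι ι ℂ) (1 : Matrix ι ι ℂ) σ.symm (Equiv.refl ι) σ.symm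
    simpa using this⟩

lemma permUnitary_mulVec [DecidableEq ι] (σ : Equiv.Perm ι) (ψ : ι → ℂ) :
    (permUnitary σ : Matrix ι ι ℂ) *ᵥ ψ = ψ ∘ σ.symm := by
  ext b
  simp [permUnitary, Matrix.mulVec, dotProduct, Matrix.one_apply]

end Vectors

lemma ket_eq_single {Q : Type} [DecidableEq (Q → Bool)] (b : Q → Bool) : ket b = Pi.single b 1 := by
  ext b'
  simp [ket, Pi.single_apply]

lemma sqNorm_ket {Q : Type} [Fintype Q] [DecidableEq Q] (b : Q → Bool) : sqNorm (ket b) = 1 := by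
  rw [sqNorm, Finset.sum_eq_single b] <;> simp +contextual [ket]

lemma permUnitary_mulVec_ket {Q : Type} [Fintype Q] [DecidableEq Q] (σ : Equiv.Perm (Q → Bool))
    (b : Q → Bool) : (permUnitary σ : Matrix (Q → Bool) (Q → Bool) ℂ) *ᵥ ket b = ket (σ b) := by
  rw [permUnitary_mulVec]
  ext b'
  simp [ket, Equiv.symm_apply_eq]

/-! ### Block diagonal operators -/

section Blocks

variable {K D : Type}

/-- The state `|κ⟩ ⊗ χ`. -/
def tens (κ : K → Bool) (χ : (D → Bool) → ℂ) : (K ⊕ D → Bool) → ℂ :=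
  open Classical in fun b => if b ∘ Sum.inl = κ then χ (b ∘ Sum.inr) else 0

/-- The operator `∑_κ |κ⟩⟨κ| ⊗ M κ`. -/
def blockDiag (M : (K → Bool) → Matrix (D → Bool) (D → Bool) ℂ) :
    Matrix (K ⊕ D → Bool) (K ⊕ D → Bool) ℂ :=
  open Classical in
  Matrix.of fun b b' => if b ∘ Sum.inl = b' ∘ Sum.inl then
    M (b ∘ Sum.inl) (b ∘ Sum.inr) (b' ∘ Sum.inr) else 0

/-- Bit strings on `K ⊕ D` as pairs of bit strings. -/
def splitBits : (K ⊕ D → Bool) ≃ (D → Bool) × (K → Bool) :=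
  (Equiv.sumArrowEquivProdArrow K D Bool).trans (Equiv.prodComm _ _)

lemma splitBits_apply (b : K ⊕ D → Bool) : splitBits b = (b ∘ Sum.inr, b ∘ Sum.inl) := rfl

lemma tens_smul (κ : K → Bool) (a : ℂ) (χ : (D → Bool) → ℂ) : tens κ (a • χ) = a • tens κ χ := by
  ext b; simp only [tens, Pi.smul_apply]; split_ifs <;> simp

lemma tens_add (κ : K → Bool) (χ ψ : (D → Bool) → ℂ) : tens κ (χ + ψ) = tens κ χ + tens κ ψ := by
  ext b; simp only [tens, Pi.add_apply]; split_ifs <;> simp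

lemma tens_ket (κ : K → Bool) (d : D → Bool) : tens κ (ket d) = ket (Sum.elim κ d) := by
  ext b
  have h : b = Sum.elim κ d ↔ b ∘ Sum.inl = κ ∧ b ∘ Sum.inr = d := by
    constructor
    · rintro rfl; exact ⟨rfl, rfl⟩
    · rintro ⟨rfl, rfl⟩; exact (Sum.elim_comp_inl_inr b).symm
  simp only [tens, ket, h]
  split_ifs <;> simp_all

variable [Fintype K] [DecidableEq K] [Fintype D] [DecidableEq D]

/-- `Matrix.blockDiagonal` takes the block index as the second component, hence the order of the
pair in `splitBits`. -/
lemma blockDiag_eq (M : (K → Bool) → Matrix (D → Bool) (D → Bool) ℂ) :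
    blockDiag M = (Matrix.blockDiagonal M).submatrix splitBits splitBits := by
  ext b b'
  simp [blockDiag, Matrix.blockDiagonal_apply, splitBits_apply]

lemma blockDiag_mul (M M' : (K → Bool) → Matrix (D → Bool) (D → Bool) ℂ) :
    blockDiag M * blockDiag M' = blockDiag fun κ => M κ * M' κ := by
  rw [blockDiag_eq, blockDiag_eq, blockDiag_eq, Matrix.submatrix_mul_equiv, Matrix.blockDiagonal_mul]

lemma blockDiag_conjTranspose (M : (K → Bool) → Matrix (D → Bool) (D → Bool) ℂ) :
    (blockDiag M)ᴴ = blockDiag fun κ => (M κ)ᴴ := by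
  rw [blockDiag_eq, blockDiag_eq, Matrix.conjTranspose_submatrix, Matrix.blockDiagonal_conjTranspose]

lemma blockDiag_one : blockDiag (fun _ : K → Bool => (1 : Matrix (D → Bool) (D → Bool) ℂ)) = 1 := by
  rw [blockDiag_eq, show (fun _ : K → Bool => (1 : Matrix (D → Bool) (D → Bool) ℂ)) = 1 from rfl,
    Matrix.blockDiagonal_one, Matrix.submatrix_one_equiv]

lemma blockDiag_mem_unitary {M : (K → Bool) → Matrix (D → Bool) (D → Bool) ℂ}
    (hM : ∀ κ, M κ ∈ Matrix.unitaryGroup (D → Bool) ℂ) :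
    blockDiag M ∈ Matrix.unitaryGroup (K ⊕ D → Bool) ℂ := by
  rw [Matrix.mem_unitaryGroup_iff, Matrix.star_eq_conjTranspose, blockDiag_conjTranspose,
    blockDiag_mul, ← blockDiag_one]
  congr 1
  ext1 κ
  exact Matrix.mem_unitaryGroup_iff.1 (hM κ)

/-- `∑_κ |κ⟩⟨κ| ⊗ M κ` as a unitary. -/
def controlled (M : (K → Bool) → Matrix.unitaryGroup (D → Bool) ℂ) :
    Matrix.unitaryGroup (K ⊕ D → Bool) ℂ :=
  ⟨blockDiag fun κ => M κ, blockDiag_mem_unitary fun κ => (M κ).2⟩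

lemma sum_splitBits {E : Type*} [AddCommMonoid E]
    (f : (K ⊕ D → Bool) → E) :
    ∑ b, f b = ∑ κ : K → Bool, ∑ d : D → Bool, f (Sum.elim κ d) := by
  rw [← Equiv.sum_comp (splitBits (K := K) (D := D)).symm, Fintype.sum_prod_type_right]
  rfl

lemma blockDiag_mulVec_tens (M : (K → Bool) → Matrix (D → Bool) (D → Bool) ℂ) (κ : K → Bool)
    (χ : (D → Bool) → ℂ) : blockDiag M *ᵥ tens κ χ = tens κ (M κ *ᵥ χ) := by
  ext b
  rw [Matrix.mulVec, dotProduct, sum_splitBits, Finset.sum_eq_single κ]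
  · by_cases h : b ∘ Sum.inl = κ
    · subst h; simp [tens, blockDiag, Matrix.mulVec, dotProduct]
    · simp [tens, blockDiag, h]
  · intro κ' _ h
    simp [tens, h]
  · simp

lemma star_tens_dotProduct (κ κ' : K → Bool) (χ χ' : (D → Bool) → ℂ) :
    star (tens κ χ) ⬝ᵥ tens κ' χ' = if κ = κ' then star χ ⬝ᵥ χ' else 0 := by
  rw [dotProduct, sum_splitBits, Finset.sum_eq_single κ]
  · by_cases h : κ = κ'
    · subst h; simp [tens, dotProduct]
    · simp [tens, h]
  · intro κ'' _ h
    simp [tens, h]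
  · simp

lemma sqNorm_tens (κ : K → Bool) (χ : (D → Bool) → ℂ) : sqNorm (tens κ χ) = sqNorm χ := by
  have : ((sqNorm (tens κ χ) : ℝ) : ℂ) = ((sqNorm χ : ℝ) : ℂ) := by
    rw [ofReal_sqNorm, ofReal_sqNorm, star_tens_dotProduct, if_pos rfl]
  exact_mod_cast this

lemma sqNorm_sum_tens {I : Type*} [DecidableEq I] (s : Finset I) {κ : I → K → Bool}
    (hκ : Set.InjOn κ s) (χ : I → (D → Bool) → ℂ) :
    sqNorm (∑ i ∈ s, tens (κ i) (χ i)) = ∑ i ∈ s, sqNorm (χ i) := by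
  rw [sqNorm_sum_of_orthogonal]
  · simp only [sqNorm_tens]
  · intro i hi j hj hij
    rw [star_tens_dotProduct, if_neg fun h => hij (hκ hi hj h)]

/-- The operator `|κ⟩⟨κ'| ⊗ 1`. -/
def transfer (κ κ' : K → Bool) : Matrix (K ⊕ D → Bool) (K ⊕ D → Bool) ℂ :=
  Matrix.of fun b b' =>
    if b ∘ Sum.inl = κ ∧ b' ∘ Sum.inl = κ' ∧ b ∘ Sum.inr = b' ∘ Sum.inr then 1 else 0

lemma transfer_conjTranspose (κ κ' : K → Bool) :
    (transfer κ κ' : Matrix (K ⊕ D → Bool) (K ⊕ D → Bool) ℂ)ᴴ = transfer κ' κ := by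
  ext b b'
  simp only [transfer, Matrix.conjTranspose_apply, Matrix.of_apply]
  rw [apply_ite star, star_one, star_zero]
  congr 1
  rw [eq_comm (a := b' ∘ Sum.inr)]
  exact propext ⟨fun ⟨h1, h2, h3⟩ => ⟨h2, h1, h3⟩, fun ⟨h1, h2, h3⟩ => ⟨h2, h1, h3⟩⟩

lemma transfer_mulVec_tens (κ κ' κ'' : K → Bool) (χ : (D → Bool) → ℂ) :
    transfer κ κ' *ᵥ tens κ'' χ = if κ' = κ'' then tens κ χ else 0 := by
  ext b
  rw [Matrix.mulVec, dotProduct, sum_splitBits, Finset.sum_eq_single κ',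
    Finset.sum_eq_single (b ∘ Sum.inr)]
  · by_cases h : κ' = κ''
    · by_cases h' : b ∘ Sum.inl = κ <;> simp [transfer, tens, h, h']
    · simp [transfer, tens, h]
  · intro d _ hd
    simp [transfer, Ne.symm hd]
  · simp
  · intro κ₁ _ h
    refine Finset.sum_eq_zero fun d _ => ?_
    simp [transfer, h]
  · simp

end Blocks

/-! ### Operators on selected qubits -/

section OnQubits

variable {R Q : Type}

/-- Bit strings on `Q` as pairs: the bits at the positions `f r`, and the remaining ones. -/
def selectBits (f : R ↪ Q) :
    (Q → Bool) ≃ (R → Bool) × ({q // q ∉ Set.range f} → Bool) where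
  toFun b := (b ∘ f, fun q => b q)
  invFun p := open Classical in
    fun q => if h : q ∈ Set.range f then p.1 h.choose else p.2 ⟨q, h⟩
  left_inv b := by
    ext q
    by_cases h : q ∈ Set.range f
    · simp only [h, dif_pos, Function.comp_apply]
      rw [h.choose_spec]
    · simp [h]
  right_inv p := by
    refine Prod.ext ?_ ?_
    · ext r
      have h : f r ∈ Set.range f := ⟨r, rfl⟩
      simp only [Function.comp_apply, h, dif_pos]
      exact congrArg p.1 (f.injective h.choose_spec)
    · ext q
      simp [q.2]

lemma onQubits_apply_of_eq (f : R ↪ Q) (U : Matrix (R → Bool) (R → Bool) ℂ) {b b' : Q → Bool}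
    (h : ∀ q, q ∉ Set.range f → b q = b' q) : onQubits f U b b' = U (b ∘ f) (b' ∘ f) := by
  rw [onQubits, Matrix.of_apply, if_pos h]

lemma onQubits_apply_of_ne (f : R ↪ Q) (U : Matrix (R → Bool) (R → Bool) ℂ) {b b' : Q → Bool}
    (h : ¬ ∀ q, q ∉ Set.range f → b q = b' q) : onQubits f U b b' = 0 := by
  rw [onQubits, Matrix.of_apply, if_neg h]

/-- Acting as the identity on the unselected qubits means one copy of `U` per assignment of their
bits; adjoints and unitarity then follow from block diagonal matrices. -/
lemma onQubits_eq (f : R ↪ Q) (U : Matrix (R → Bool) (R → Bool) ℂ)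
    [DecidableEq ({q // q ∉ Set.range f} → Bool)] :
    onQubits f U =
      (Matrix.blockDiagonal fun _ => U).submatrix (selectBits f) (selectBits f) := by
  ext b b'
  rw [Matrix.submatrix_apply, Matrix.blockDiagonal_apply]
  have hiff : (selectBits f b).2 = (selectBits f b').2 ↔ ∀ q, q ∉ Set.range f → b q = b' q := by
    simp only [selectBits, Equiv.coe_fn_mk, funext_iff, Subtype.forall]
  by_cases h : ∀ q, q ∉ Set.range f → b q = b' q
  · rw [onQubits_apply_of_eq f U h, if_pos (hiff.2 h)]
    rfl
  · rw [onQubits_apply_of_ne f U h, if_neg fun h' => h (hiff.1 h')]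

lemma onQubits_conjTranspose (f : R ↪ Q) (U : Matrix (R → Bool) (R → Bool) ℂ) :
    (onQubits f U)ᴴ = onQubits f Uᴴ := by
  classical
  rw [onQubits_eq, onQubits_eq, Matrix.conjTranspose_submatrix, Matrix.blockDiagonal_conjTranspose]

variable [Fintype R] [DecidableEq R] [Fintype Q] [DecidableEq Q]

lemma onQubits_mem_unitary (f : R ↪ Q) {U : Matrix (R → Bool) (R → Bool) ℂ}
    (hU : U ∈ Matrix.unitaryGroup (R → Bool) ℂ) :
    onQubits f U ∈ Matrix.unitaryGroup (Q → Bool) ℂ := by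
  classical
  rw [Matrix.mem_unitaryGroup_iff, Matrix.star_eq_conjTranspose] at hU ⊢
  rw [onQubits_conjTranspose, onQubits_eq, onQubits_eq, Matrix.submatrix_mul_equiv,
    ← Matrix.blockDiagonal_mul, hU]
  have : (Matrix.blockDiagonal fun _ : {q // q ∉ Set.range f} → Bool =>
      (1 : Matrix (R → Bool) (R → Bool) ℂ)) = 1 := Matrix.blockDiagonal_one
  convert Matrix.submatrix_one_equiv (selectBits f)

lemma onQubits_mulVec_ket_of_eq (f : R ↪ Q) (U : Matrix (R → Bool) (R → Bool) ℂ) {b b' : Q → Bool}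
    (h : ∀ q, q ∉ Set.range f → b' q = b q) :
    (onQubits f U *ᵥ ket b) b' = (U *ᵥ ket (b ∘ f)) (b' ∘ f) := by
  rw [ket_eq_single, ket_eq_single, Matrix.mulVec_single_one, Matrix.mulVec_single_one]
  exact onQubits_apply_of_eq f U h

lemma onQubits_mulVec_ket_of_ne (f : R ↪ Q) (U : Matrix (R → Bool) (R → Bool) ℂ) {b b' : Q → Bool}
    (h : ¬ ∀ q, q ∉ Set.range f → b' q = b q) : (onQubits f U *ᵥ ket b) b' = 0 := by
  rw [ket_eq_single, Matrix.mulVec_single_one]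
  exact onQubits_apply_of_ne f U h

/-- An operator maps `|b⟩` to a superposition of states that differ from `|b⟩` only on the selected
qubits, as given by its action on these. -/
lemma onQubits_mulVec_ket_eq_sum (f : R ↪ Q) {U : Matrix (R → Bool) (R → Bool) ℂ} {b : Q → Bool}
    {I : Type*} (s : Finset I) (a : I → ℂ) (r : I → R → Bool) (b' : I → Q → Bool)
    (hU : U *ᵥ ket (b ∘ f) = ∑ i ∈ s, a i • ket (r i)) (hr : ∀ i, b' i ∘ f = r i)
    (hb : ∀ i, ∀ q, q ∉ Set.range f → b' i q = b q) :
    onQubits f U *ᵥ ket b = ∑ i ∈ s, a i • ket (b' i) := by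
  ext b₁
  simp only [Finset.sum_apply, Pi.smul_apply, smul_eq_mul]
  by_cases h : ∀ q, q ∉ Set.range f → b₁ q = b q
  · rw [onQubits_mulVec_ket_of_eq f U h, hU]
    simp only [Finset.sum_apply, Pi.smul_apply, smul_eq_mul]
    refine Finset.sum_congr rfl fun i _ => ?_
    congr 1
    have : b₁ ∘ f = r i ↔ b₁ = b' i := by
      rw [← hr i]
      refine ⟨fun h' => ?_, fun h' => by rw [h']⟩
      ext q
      by_cases hq : q ∈ Set.range f
      · obtain ⟨r, rfl⟩ := hq; exact congrFun h' r
      · rw [h q hq, hb i q hq]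
    by_cases hb₁ : b₁ = b' i
    · rw [ket, ket, if_pos (this.2 hb₁), if_pos hb₁]
    · rw [ket, ket, if_neg (mt this.1 hb₁), if_neg hb₁]
  · rw [onQubits_mulVec_ket_of_ne f U h]
    symm
    refine Finset.sum_eq_zero fun i _ => ?_
    have : b₁ ≠ b' i := by
      rintro rfl
      exact h (hb i)
    simp [ket, this]

lemma onQubits_mulVec_ket_eq_ket (f : R ↪ Q) {U : Matrix (R → Bool) (R → Bool) ℂ} {b : Q → Bool}
    {r : R → Bool} (b' : Q → Bool) (hU : U *ᵥ ket (b ∘ f) = ket r) (hr : b' ∘ f = r)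
    (hb : ∀ q, q ∉ Set.range f → b' q = b q) : onQubits f U *ᵥ ket b = ket b' := by
  have := onQubits_mulVec_ket_eq_sum f (b := b) (U := U) {()} (fun _ => 1) (fun _ => r)
    (fun _ => b') (by simpa using hU) (fun _ => hr) (fun _ => hb)
  simpa using this

end OnQubits

/-! ### Circuits -/

section Circuits

variable {R : OracleName → Type} [∀ k, Fintype (R k)] [∀ k, DecidableEq (R k)]
variable {Q K D : Type} [Fintype Q] [DecidableEq Q] [Fintype K] [DecidableEq K] [Fintype D]
  [DecidableEq D]
variable (O : (k : OracleName) → Matrix (R k → Bool) (R k → Bool) ℂ)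

/-- The operator performed by a circuit. -/
def circuitOp : List (Gate R Q) → Matrix (Q → Bool) (Q → Bool) ℂ
  | [] => 1
  | g :: l => circuitOp l * g.op O

lemma foldl_op (l : List (Gate R Q)) (ψ : (Q → Bool) → ℂ) :
    l.foldl (fun ψ g => g.op O *ᵥ ψ) ψ = circuitOp O l *ᵥ ψ := by
  induction l generalizing ψ with
  | nil => simp [circuitOp]
  | cons g l ih => rw [List.foldl_cons, ih, circuitOp, Matrix.mulVec_mulVec]

lemma circuitOp_append (l l' : List (Gate R Q)) :
    circuitOp O (l ++ l') = circuitOp O l' * circuitOp O l := by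
  induction l with
  | nil => simp [circuitOp]
  | cons g l ih => rw [List.cons_append, circuitOp, ih, circuitOp, mul_assoc]

lemma circuitOp_singleton (g : Gate R Q) : circuitOp O [g] = g.op O := by simp [circuitOp]

/-- The inverse gate. -/
def Gate.inverse : Gate R Q → Gate R Q
  | .free V => .free (star V)
  | .query k i f => .query k (!i) f

lemma Gate.inverse_op (g : Gate R Q) : g.inverse.op O = (g.op O)ᴴ := by
  cases g with
  | free V => rfl
  | query k i f => cases i <;> simp [Gate.inverse, Gate.op, onQubits_conjTranspose]

/-- The inverse circuit. -/
def inverseCircuit (l : List (Gate R Q)) : List (Gate R Q) := (l.map Gate.inverse).reverse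

lemma circuitOp_inverseCircuit (l : List (Gate R Q)) :
    circuitOp O (inverseCircuit l) = (circuitOp O l)ᴴ := by
  induction l with
  | nil => simp [inverseCircuit, circuitOp]
  | cons g l ih =>
    rw [inverseCircuit, List.map_cons, List.reverse_cons, circuitOp_append, circuitOp_singleton,
      Gate.inverse_op, circuitOp, Matrix.conjTranspose_mul, ← ih]
    rfl

/-- A gate on the second part of the qubits. -/
def Gate.lift : Gate R D → Gate R (K ⊕ D)
  | .free V => .free (controlled fun _ => V)
  | .query k i f => .query k i (f.trans Function.Embedding.inr)

lemma onQubits_trans_inr {R' : Type} (f : R' ↪ D) (U : Matrix (R' → Bool) (R' → Bool) ℂ) :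
    onQubits (f.trans (Function.Embedding.inr : D ↪ K ⊕ D)) U = blockDiag fun _ => onQubits f U := by
  ext b b'
  have h : (∀ q : K ⊕ D, q ∉ Set.range (f.trans (Function.Embedding.inr : D ↪ K ⊕ D)) →
      b q = b' q) ↔ b ∘ Sum.inl = b' ∘ Sum.inl ∧
        ∀ q, q ∉ Set.range f → (b ∘ Sum.inr) q = (b' ∘ Sum.inr) q := by
    simp [Sum.forall, funext_iff]
  by_cases h1 : b ∘ Sum.inl = b' ∘ Sum.inl
  · rw [blockDiag, Matrix.of_apply, if_pos h1]
    by_cases h2 : ∀ q, q ∉ Set.range f → (b ∘ Sum.inr) q = (b' ∘ Sum.inr) q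
    · rw [onQubits_apply_of_eq _ _ (h.2 ⟨h1, h2⟩), onQubits_apply_of_eq _ _ h2]
      rfl
    · rw [onQubits_apply_of_ne _ _ (mt (fun h' => (h.1 h').2) h2), onQubits_apply_of_ne _ _ h2]
  · rw [blockDiag, Matrix.of_apply, if_neg h1,
      onQubits_apply_of_ne _ _ (mt (fun h' => (h.1 h').1) h1)]

lemma Gate.lift_op (g : Gate R D) :
    (g.lift : Gate R (K ⊕ D)).op O = blockDiag fun _ => g.op O := by
  cases g with
  | free V => rfl
  | query k i f => cases i <;> exact onQubits_trans_inr _ _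

lemma circuitOp_map_lift (l : List (Gate R D)) :
    circuitOp O (l.map (Gate.lift (K := K))) = blockDiag fun _ => circuitOp O l := by
  induction l with
  | nil => simp [circuitOp, blockDiag_one]
  | cons g l ih => rw [List.map_cons, circuitOp, ih, Gate.lift_op, blockDiag_mul]; rfl

variable {O}

lemma Gate.op_mem_unitary (hO : ∀ k, O k ∈ Matrix.unitaryGroup (R k → Bool) ℂ) (g : Gate R Q) :
    g.op O ∈ Matrix.unitaryGroup (Q → Bool) ℂ := by
  cases g with
  | free V => exact V.2
  | query k i f =>
    cases i
    · exact onQubits_mem_unitary f (hO k)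
    · exact onQubits_mem_unitary f (Unitary.star_mem (hO k))

lemma circuitOp_mem_unitary (hO : ∀ k, O k ∈ Matrix.unitaryGroup (R k → Bool) ℂ)
    (l : List (Gate R Q)) : circuitOp O l ∈ Matrix.unitaryGroup (Q → Bool) ℂ := by
  induction l with
  | nil => exact one_mem _
  | cons g l ih => exact mul_mem ih (g.op_mem_unitary hO)

/-- The number of calls of oracle `k` in a circuit. -/
def circuitCost (k : OracleName) (l : List (Gate R Q)) : ℕ := (l.map (Gate.cost k)).sum

lemma circuitCost_append (k : OracleName) (l l' : List (Gate R Q)) :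
    circuitCost k (l ++ l') = circuitCost k l + circuitCost k l' := by
  simp [circuitCost]

lemma circuitCost_free (k : OracleName) (V : Matrix.unitaryGroup (Q → Bool) ℂ) :
    circuitCost (R := R) k [.free V] = 0 := rfl

lemma circuitCost_map_lift (k : OracleName) (l : List (Gate R D)) :
    circuitCost k (l.map (Gate.lift (K := K))) = circuitCost k l := by
  rw [circuitCost, List.map_map, circuitCost]
  congr 2
  ext1 g
  cases g <;> rfl

lemma circuitCost_inverseCircuit (k : OracleName) (l : List (Gate R Q)) :
    circuitCost k (inverseCircuit l) = circuitCost k l := by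
  rw [circuitCost, inverseCircuit, List.map_reverse, List.sum_reverse, List.map_map, circuitCost]
  congr 2
  ext1 g
  cases g <;> rfl

lemma circuitCost_flatMap {I : Type*} (k : OracleName) (l : List I) (f : I → List (Gate R Q)) (c : ℕ)
    (hf : ∀ i, circuitCost k (f i) = c) : circuitCost k (l.flatMap f) = l.length * c := by
  induction l with
  | nil => simp [circuitCost]
  | cons i l ih => rw [List.flatMap_cons, circuitCost_append, hf, ih, List.length_cons]; ring

end Circuits

/-! ### Powers of the walk operator -/

section Walk

variable {ι : Type*} [Fintype ι] [DecidableEq ι]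

/-- The reflection about the basis vector `b`. -/
def reflection (b : ι) : Matrix.unitaryGroup ι ℂ :=
  ⟨Matrix.diagonal fun i => if i = b then 1 else -1, by
    rw [Matrix.mem_unitaryGroup_iff, Matrix.star_eq_conjTranspose, Matrix.diagonal_conjTranspose,
      Matrix.diagonal_mul_diagonal, ← Matrix.diagonal_one]
    congr 1
    ext i
    by_cases h : i = b <;> simp [h]⟩

lemma reflection_mulVec (b : ι) (v : ι → ℂ) :
    (reflection b : Matrix ι ι ℂ) *ᵥ v = (2 * v b) • Pi.single b 1 - v := by
  ext i
  by_cases h : i = b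
  · subst h; simp [reflection, Matrix.mulVec_diagonal]; ring
  · simp [reflection, Matrix.mulVec_diagonal, h]

variable {u S : Matrix ι ι ℂ} {b : ι} {Ψ : ι → ℂ} {c : ℝ}

lemma conj_reflection_mulVec (hu : u ∈ Matrix.unitaryGroup ι ℂ) (hΨ : u *ᵥ Pi.single b 1 = Ψ)
    (v : ι → ℂ) :
    (u * (reflection b : Matrix ι ι ℂ) * uᴴ) *ᵥ v = (2 * (star Ψ ⬝ᵥ v)) • Ψ - v := by
  have h1 : (uᴴ *ᵥ v) b = star Ψ ⬝ᵥ v := by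
    rw [← hΨ, star_mulVec_dotProduct]
    simp
  rw [← Matrix.mulVec_mulVec, ← Matrix.mulVec_mulVec, reflection_mulVec, Matrix.mulVec_sub,
    Matrix.mulVec_smul, hΨ, h1, Matrix.mulVec_mulVec, ← Matrix.star_eq_conjTranspose,
    Matrix.mem_unitaryGroup_iff.1 hu, Matrix.one_mulVec]

/-- The iterates of the initial state under the walk operator satisfy the Chebyshev recurrence. -/
lemma walk_recurrence (hu : u ∈ Matrix.unitaryGroup ι ℂ) (hΨ : u *ᵥ Pi.single b 1 = Ψ)
    (hΨ1 : star Ψ ⬝ᵥ Ψ = 1) (hS : S * S = 1) (hc : star Ψ ⬝ᵥ (S *ᵥ Ψ) = c) (k : ℕ) :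
    ((u * (reflection b : Matrix ι ι ℂ) * uᴴ * S) ^ (k + 2)) *ᵥ Ψ
      + ((u * (reflection b : Matrix ι ι ℂ) * uᴴ * S) ^ k) *ᵥ Ψ
      = (2 * (c : ℂ)) • ((u * (reflection b : Matrix ι ι ℂ) * uᴴ * S) ^ (k + 1)) *ᵥ Ψ := by
  set W := u * (reflection b : Matrix ι ι ℂ) * uᴴ * S with hW
  have h1 : W *ᵥ Ψ = (2 * (c : ℂ)) • Ψ - S *ᵥ Ψ := by
    rw [hW, ← Matrix.mulVec_mulVec, conj_reflection_mulVec hu hΨ, hc]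
  have h2 : W *ᵥ (S *ᵥ Ψ) = Ψ := by
    rw [hW, ← Matrix.mulVec_mulVec, Matrix.mulVec_mulVec Ψ S S, hS, Matrix.one_mulVec,
      conj_reflection_mulVec hu hΨ, hΨ1]
    module
  -- The span of `Ψ` and `S Ψ` is invariant: `W Ψ = 2c Ψ - S Ψ` and `W (S Ψ) = Ψ`. Applying `W` to
  -- the first relation gives the recurrence at `k = 0`.
  have h3 : W ^ 2 *ᵥ Ψ + Ψ = (2 * (c : ℂ)) • W *ᵥ Ψ := by
    rw [pow_two, ← Matrix.mulVec_mulVec]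
    conv_lhs => rw [h1]
    rw [Matrix.mulVec_sub, Matrix.mulVec_smul, h2]
    module
  rw [pow_add, pow_succ W k, ← Matrix.mulVec_mulVec, ← Matrix.mulVec_mulVec, ← Matrix.mulVec_add, h3,
    Matrix.mulVec_smul]

end Walk

/-! ### The window of amplitudes of the clock register -/

/-- The unnormalised amplitudes `k (N - k)`. -/
def window (N k : ℕ) : ℝ := ((k * (N - k) : ℕ) : ℝ)

lemma abs_window_succ_sub_le (N k : ℕ) : |window N (k + 1) - window N k| ≤ N := by
  rcases Nat.lt_or_ge k N with h | h
  · obtain ⟨r, rfl⟩ := Nat.exists_eq_add_of_lt h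
    rw [window, window, show k + r + 1 - (k + 1) = r by omega, show k + r + 1 - k = r + 1 by omega]
    push_cast
    rw [abs_le]
    constructor <;> nlinarith [(Nat.cast_nonneg k : (0 : ℝ) ≤ k), (Nat.cast_nonneg r : (0 : ℝ) ≤ r)]
  · rw [window, window, Nat.sub_eq_zero_of_le h, Nat.sub_eq_zero_of_le (h.trans (Nat.le_succ k))]
    simp

lemma sum_window_sq (N : ℕ) :
    ∑ k ∈ Finset.range (N + 1), window N k ^ 2 = (N : ℝ) * ((N : ℝ) ^ 4 - 1) / 30 := by
  -- The parameter `x` is kept independent of the upper limit so that induction on `J` applies; it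
  -- is then set equal to `N`.
  have h : ∀ (x : ℝ) (J : ℕ), ∑ k ∈ Finset.range (J + 1), ((k : ℝ) * (x - k)) ^ 2
      = x ^ 2 * (J * (J + 1) * (2 * J + 1) / 6) - 2 * x * (J ^ 2 * (J + 1) ^ 2 / 4)
        + J * (J + 1) * (2 * J + 1) * (3 * J ^ 2 + 3 * J - 1) / 30 := by
    intro x J
    induction J with
    | zero => simp
    | succ J ih => rw [Finset.sum_range_succ, ih]; push_cast; ring
  rw [Finset.sum_congr rfl (g := fun k : ℕ => ((k : ℝ) * ((N : ℝ) - k)) ^ 2), h]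
  · ring
  · intro k hk
    rw [window, Nat.cast_mul, Nat.cast_sub (by have := Finset.mem_range.1 hk; omega)]

/-- The normalised amplitudes of the clock register. -/
def clockAmp (N k : ℕ) : ℝ := window N k / Real.sqrt (∑ k ∈ Finset.range (N + 1), window N k ^ 2)

lemma clockAmp_zero (N : ℕ) : clockAmp N 0 = 0 := by simp [clockAmp, window]

lemma clockAmp_of_le {N k : ℕ} (h : N ≤ k) : clockAmp N k = 0 := by
  simp [clockAmp, window, Nat.sub_eq_zero_of_le h]

lemma sum_window_sq_pos {N : ℕ} (hN : 2 ≤ N) :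
    0 < ∑ k ∈ Finset.range (N + 1), window N k ^ 2 := by
  have h2 : (2 : ℝ) ≤ N := by exact_mod_cast hN
  have h4 : (1 : ℝ) < (N : ℝ) ^ 4 := one_lt_pow₀ (by linarith) (by norm_num)
  rw [sum_window_sq]
  have : (0 : ℝ) < (N : ℝ) ^ 4 - 1 := by linarith
  positivity

lemma sum_clockAmp_sq {N : ℕ} (hN : 2 ≤ N) :
    ∑ k ∈ Finset.range (N + 1), clockAmp N k ^ 2 = 1 := by
  have h := sum_window_sq_pos hN
  simp only [clockAmp, div_pow, Real.sq_sqrt h.le]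
  rw [← Finset.sum_div, div_self h.ne']

/-- Increments of the window are at most `N`, while its squared norm is of order `N⁵/30`, so
normalised squared increments are `O(N⁻³)`. The constant is chosen so that the bound holds from `N =
2` on. -/
lemma clockAmp_succ_sub_sq_le {N : ℕ} (hN : 2 ≤ N) (k : ℕ) :
    4 * (N + 1) * (clockAmp N (k + 1) - clockAmp N k) ^ 2 ≤ 240 / (N : ℝ) ^ 2 := by
  have h := sum_window_sq_pos hN
  have h2 : (2 : ℝ) ≤ N := by exact_mod_cast hN
  rw [clockAmp, clockAmp, ← sub_div, div_pow, Real.sq_sqrt h.le, mul_div_assoc']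
  rw [div_le_div_iff₀ h (by positivity)]
  have h1 : (window N (k + 1) - window N k) ^ 2 ≤ (N : ℝ) ^ 2 := by
    rw [← sq_abs]
    exact pow_le_pow_left₀ (abs_nonneg _) (abs_window_succ_sub_le N k) 2
  rw [sum_window_sq]
  calc 4 * ((N : ℝ) + 1) * (window N (k + 1) - window N k) ^ 2 * (N : ℝ) ^ 2
      ≤ 4 * ((N : ℝ) + 1) * (N : ℝ) ^ 2 * (N : ℝ) ^ 2 := by gcongr
    _ ≤ 240 * ((N : ℝ) * ((N : ℝ) ^ 4 - 1) / 30) := by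
      have e : 240 * ((N : ℝ) * ((N : ℝ) ^ 4 - 1) / 30) - 4 * ((N : ℝ) + 1) * (N : ℝ) ^ 2 * (N : ℝ) ^ 2
          = 4 * (N * (N + 1)) * (2 * (N - 1) * (N ^ 2 + 1) - N ^ 3) := by ring
      have e2 : 0 ≤ 2 * ((N : ℝ) - 1) * (N ^ 2 + 1) - N ^ 3 := by nlinarith
      have : 0 ≤ 4 * ((N : ℝ) * (N + 1)) * (2 * (N - 1) * (N ^ 2 + 1) - N ^ 3) :=
        mul_nonneg (by positivity) e2
      linarith

/-! ### The clock register -/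

section Clock

variable {D : Type} [Fintype D] [DecidableEq D]

/-- The unary encoding of `k ≤ N`. -/
def unary (N k : ℕ) : Fin N → Bool := fun i => decide (i.val < k)

lemma unary_injOn (N : ℕ) : Set.InjOn (unary N) (Finset.range (N + 1)) := by
  have key : ∀ k l : ℕ, k ≤ N → l ≤ N → k < l → unary N k ≠ unary N l := by
    intro k l hk hl hkl h
    have := congrFun h ⟨k, by omega⟩
    simp [unary, hkl] at this
  intro k hk l hl h
  simp only [Finset.coe_range, Set.mem_Iio] at hk hl
  by_contra hne
  rcases lt_or_gt_of_ne hne with h1 | h1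
  · exact key k l (by omega) (by omega) h1 h
  · exact key l k (by omega) (by omega) h1 h.symm

lemma countP_unary {N k : ℕ} (hk : k ≤ N) : (List.finRange N).countP (unary N k) = k := by
  have h : (List.finRange N).countP (unary N k) = (List.range N).countP (fun i => decide (i < k)) := by
    rw [← List.map_coe_finRange_eq_range, List.countP_map]
    rfl
  rw [h]
  clear h
  induction N, hk using Nat.le_induction with
  | base =>
    rw [List.countP_eq_length.2]
    · simp
    · intro i hi; simpa using hi
  | succ N hN ih =>
    rw [List.range_succ, List.countP_append, ih]
    simp [hN]

/-- The hopping operator on the clock register. -/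
def hop (N : ℕ) (D : Type) [Fintype D] [DecidableEq D] :
    Matrix (Fin N ⊕ D → Bool) (Fin N ⊕ D → Bool) ℂ :=
  ∑ k ∈ Finset.range N,
    (transfer (unary N (k + 1)) (unary N k) + transfer (unary N k) (unary N (k + 1)))

lemma hop_isHermitian (N : ℕ) : (hop N D).IsHermitian := by
  rw [Matrix.IsHermitian, hop, Matrix.conjTranspose_sum]
  refine Finset.sum_congr rfl fun k _ => ?_
  rw [Matrix.conjTranspose_add, transfer_conjTranspose, transfer_conjTranspose, add_comm]

/-- The sequence shifted by one, starting with `0`. -/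
def shifted {E : Type*} [Zero E] (ξ : ℕ → E) : ℕ → E
  | 0 => 0
  | k + 1 => ξ k

lemma tens_zero {K : Type} (κ : K → Bool) : tens κ (0 : (D → Bool) → ℂ) = 0 := by
  ext b; simp [tens]

/-- On clock states the operator sums the two neighbours. The vanishing entry beyond the end lets
the formula hold at `k = N` too. -/
lemma hop_mulVec {N : ℕ} (ξ : ℕ → (D → Bool) → ℂ) (hξ : ξ (N + 1) = 0) :
    hop N D *ᵥ ∑ k ∈ Finset.range (N + 1), tens (unary N k) (ξ k)
      = ∑ k ∈ Finset.range (N + 1), tens (unary N k) (ξ (k + 1) + shifted ξ k) := by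
  have h : ∀ κ, ∀ l ≤ N, transfer κ (unary N l) *ᵥ
      ∑ k ∈ Finset.range (N + 1), tens (unary N k) (ξ k) = tens κ (ξ l) := by
    intro κ l hl
    have hl' : l ∈ Finset.range (N + 1) := Finset.mem_range.2 (by omega)
    rw [Matrix.mulVec_sum, Finset.sum_eq_single l]
    · rw [transfer_mulVec_tens, if_pos rfl]
    · intro k hk hkl
      rw [transfer_mulVec_tens, if_neg fun h => hkl (unary_injOn N hl' hk h).symm]
    · exact fun h => absurd hl' h
  rw [hop, Matrix.sum_mulVec]
  simp only [tens_add, Finset.sum_add_distrib]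
  have e1 : ∑ k ∈ Finset.range (N + 1), tens (unary N k) (ξ (k + 1))
      = ∑ k ∈ Finset.range N, tens (unary N k) (ξ (k + 1)) := by
    rw [Finset.sum_range_succ, hξ, tens_zero, add_zero]
  have e2 : ∑ k ∈ Finset.range (N + 1), tens (unary N k) (shifted ξ k)
      = ∑ k ∈ Finset.range N, tens (unary N (k + 1)) (ξ k) := by
    rw [Finset.sum_range_succ', show shifted ξ 0 = 0 from rfl, tens_zero, add_zero]
    rfl
  rw [e1, e2, ← Finset.sum_add_distrib]
  refine Finset.sum_congr rfl fun k hk => ?_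
  have hk' := Finset.mem_range.1 hk
  rw [Matrix.add_mulVec, h _ k (by omega), h _ (k + 1) (by omega), add_comm]

lemma tens_sub {K : Type} (κ : K → Bool) (χ ψ : (D → Bool) → ℂ) :
    tens κ (χ - ψ) = tens κ χ - tens κ ψ := by
  ext b; simp only [tens, Pi.sub_apply]; split_ifs <;> simp

/-- The clock state with a Chebyshev sequence attached is nearly an eigenvector of the hopping
operator. -/
lemma sqNorm_hop_sub_le {N : ℕ} (hN : 2 ≤ N) (χ : ℕ → (D → Bool) → ℂ) (hχ : ∀ k, sqNorm (χ k) = 1)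
    (c : ℝ) (hrec : ∀ k, χ (k + 2) + χ k = (2 * (c : ℂ)) • χ (k + 1)) :
    sqNorm (hop N D *ᵥ (∑ k ∈ Finset.range (N + 1), tens (unary N k) ((clockAmp N k : ℂ) • χ k))
      - ((2 * c : ℝ) : ℂ) • ∑ k ∈ Finset.range (N + 1), tens (unary N k) ((clockAmp N k : ℂ) • χ k))
      ≤ 240 / (N : ℝ) ^ 2 := by
  rw [hop_mulVec _ (by rw [clockAmp_of_le (Nat.le_succ N)]; simp), Finset.smul_sum,
    ← Finset.sum_sub_distrib]
  simp only [← tens_smul, ← tens_sub]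
  rw [sqNorm_sum_tens _ (unary_injOn N)]
  have hN0 : (0 : ℝ) < N + 1 := by positivity
  set δ : ℝ := 60 / ((N + 1) * (N : ℝ) ^ 2) with hδ
  have hΔ : ∀ k, (clockAmp N (k + 1) - clockAmp N k) ^ 2 ≤ δ := by
    intro k
    have := clockAmp_succ_sub_sq_le hN k
    have h2 : (0 : ℝ) < N := by exact_mod_cast (by omega : 0 < N)
    rw [hδ, le_div_iff₀ (by positivity)]
    rw [le_div_iff₀ (by positivity)] at this
    nlinarith
  have hδ0 : 0 ≤ δ := (sq_nonneg _).trans (hΔ 0)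
  -- By the recurrence the residual at an interior site is a difference of consecutive amplitudes on
  -- each of two unit vectors, hence at most `2δ + 2δ`. At `k = 0` one neighbour is missing, which
  -- is harmless because the amplitude vanishes there.
  have hterm : ∀ k ∈ Finset.range (N + 1),
      sqNorm ((clockAmp N (k + 1) : ℂ) • χ (k + 1) + shifted (fun k => (clockAmp N k : ℂ) • χ k) k
        - ((2 * c : ℝ) : ℂ) • (clockAmp N k : ℂ) • χ k) ≤ 4 * δ := by
    intro k _
    cases k with
    | zero =>
      have h := hΔ 0
      rw [clockAmp_zero, sub_zero] at h
      rw [clockAmp_zero]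
      simp only [shifted, Complex.ofReal_zero, zero_smul, smul_zero, add_zero, sub_zero]
      rw [sqNorm_smul, hχ, Complex.norm_real, Real.norm_eq_abs, sq_abs]
      linarith
    | succ k =>
      have e : (clockAmp N (k + 1 + 1) : ℂ) • χ (k + 1 + 1)
          + shifted (fun k => (clockAmp N k : ℂ) • χ k) (k + 1)
          - ((2 * c : ℝ) : ℂ) • (clockAmp N (k + 1) : ℂ) • χ (k + 1)
          = ((clockAmp N (k + 1 + 1) - clockAmp N (k + 1) : ℝ) : ℂ) • χ (k + 2)
            + (-((clockAmp N (k + 1) - clockAmp N k : ℝ) : ℂ)) • χ k := by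
        rw [smul_comm ((2 * c : ℝ) : ℂ)]
        push_cast
        rw [← hrec k]
        simp only [shifted]
        module
      rw [e]
      refine (sqNorm_add_le _ _).trans ?_
      rw [sqNorm_smul, sqNorm_smul, hχ, hχ, norm_neg, Complex.norm_real, Complex.norm_real,
        Real.norm_eq_abs, Real.norm_eq_abs, sq_abs, sq_abs]
      linarith [hΔ k, hΔ (k + 1)]
  refine (Finset.sum_le_sum hterm).trans (le_of_eq ?_)
  rw [Finset.sum_const, Finset.card_range, nsmul_eq_mul, hδ]
  push_cast
  field_simp
  norm_num

end Clock

/-! ### The estimation algorithm -/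

section Estimator

variable {R : OracleName → Type} [∀ k, Fintype (R k)] [∀ k, DecidableEq (R k)]
variable {D : Type} [Fintype D] [DecidableEq D]

/-- The initial state of the estimation algorithm. -/
def clockState (N : ℕ) (D : Type) : (Fin N ⊕ D → Bool) → ℂ :=
  ∑ k ∈ Finset.range (N + 1), tens (unary N k) ((clockAmp N k : ℂ) • ket fun _ => false)

lemma sqNorm_clock {N : ℕ} (hN : 2 ≤ N) (χ : ℕ → (D → Bool) → ℂ) (hχ : ∀ k, sqNorm (χ k) = 1) :
    sqNorm (∑ k ∈ Finset.range (N + 1), tens (unary N k) ((clockAmp N k : ℂ) • χ k)) = 1 := by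
  rw [sqNorm_sum_tens _ (unary_injOn N), ← sum_clockAmp_sq hN]
  refine Finset.sum_congr rfl fun k _ => ?_
  rw [sqNorm_smul, hχ, Complex.norm_real, Real.norm_eq_abs, sq_abs, mul_one]

/-- For `N < 2` the window is identically zero and cannot be normalised, so an arbitrary unitary is
used. -/
lemma exists_clockUnitary (N : ℕ) (D : Type) [Fintype D] [DecidableEq D] :
    ∃ U : Matrix.unitaryGroup (Fin N ⊕ D → Bool) ℂ, 2 ≤ N →
      (U : Matrix (Fin N ⊕ D → Bool) (Fin N ⊕ D → Bool) ℂ) *ᵥ (ket fun _ => false)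
        = clockState N D := by
  by_cases hN : 2 ≤ N
  · obtain ⟨U, hU⟩ := exists_unitary_mulVec_single
      (sqNorm_clock hN (fun _ => ket fun _ : D => false) fun _ => sqNorm_ket _) fun _ => false
    exact ⟨U, fun _ => by rw [ket_eq_single, hU]; rfl⟩
  · exact ⟨1, fun h => absurd h hN⟩

/-- A unitary that prepares the initial state of the estimation algorithm. -/
def clockUnitary (N : ℕ) (D : Type) [Fintype D] [DecidableEq D] :
    Matrix.unitaryGroup (Fin N ⊕ D → Bool) ℂ := (exists_clockUnitary N D).choose

/-- One walk step, performed if qubit `i` of the clock register is set. -/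
def walkStep {N : ℕ} (prep : List (Gate R D)) (S : Matrix.unitaryGroup (D → Bool) ℂ) (i : Fin N) :
    List (Gate R (Fin N ⊕ D)) :=
  [.free (controlled fun κ => if κ i then S else 1)] ++
    (inverseCircuit prep).map Gate.lift ++
    [.free (controlled fun κ => if κ i then reflection (fun _ => false) else 1)] ++
    prep.map Gate.lift

/-- Estimation of `⟨Ψ|S|Ψ⟩`, where `Ψ` is the state prepared by `prep`, with `N` walk steps. -/
def estimatorCircuit (N : ℕ) (prep : List (Gate R D)) (S : Matrix.unitaryGroup (D → Bool) ℂ) :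
    List (Gate R (Fin N ⊕ D)) :=
  [.free (clockUnitary N D)] ++ prep.map Gate.lift ++ (List.finRange N).flatMap (walkStep prep S) ++
    [.free (star (hop_isHermitian N).eigenvectorUnitary)]

lemma circuitCost_estimatorCircuit (N : ℕ) (prep : List (Gate R D))
    (S : Matrix.unitaryGroup (D → Bool) ℂ) (k : OracleName) :
    circuitCost k (estimatorCircuit N prep S) = circuitCost k prep * (1 + 2 * N) := by
  rw [estimatorCircuit, circuitCost_append, circuitCost_append, circuitCost_append, circuitCost_free,
    circuitCost_free, circuitCost_map_lift, circuitCost_flatMap (c := 2 * circuitCost k prep)]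
  · rw [List.length_finRange]; ring
  · intro i
    rw [walkStep, circuitCost_append, circuitCost_append, circuitCost_append, circuitCost_free,
      circuitCost_free, circuitCost_map_lift, circuitCost_map_lift, circuitCost_inverseCircuit]
    ring

variable {O : (k : OracleName) → Matrix (R k → Bool) (R k → Bool) ℂ}

/-- The walk operator for the state `u|0⟩` and the involution `S`. -/
def walkOp (u S : Matrix (D → Bool) (D → Bool) ℂ) : Matrix (D → Bool) (D → Bool) ℂ :=
  u * (reflection fun _ : D => false).1 * uᴴ * S

/-- Only the two oracle-free gates are controlled. If the control bit is off, the preparation and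
its inverse cancel, so no controlled oracle is needed. -/
lemma circuitOp_walkStep (hO : ∀ k, O k ∈ Matrix.unitaryGroup (R k → Bool) ℂ) {N : ℕ}
    (prep : List (Gate R D)) (S : Matrix.unitaryGroup (D → Bool) ℂ) (i : Fin N) :
    circuitOp O (walkStep prep S i) = blockDiag fun κ => if κ i then
      walkOp (circuitOp O prep) S.1 else 1 := by
  rw [walkStep, circuitOp_append, circuitOp_append, circuitOp_append, circuitOp_singleton,
    circuitOp_singleton, circuitOp_map_lift, circuitOp_map_lift, circuitOp_inverseCircuit]
  simp only [Gate.op, controlled]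
  rw [blockDiag_mul, blockDiag_mul, blockDiag_mul]
  congr 1
  ext1 κ
  split_ifs
  · simp only [walkOp, mul_assoc]
  · have := Matrix.mem_unitaryGroup_iff.1 (circuitOp_mem_unitary hO prep)
    rw [Matrix.star_eq_conjTranspose] at this
    simp [this]

/-- In the unary code the number of set bits is the clock value, so clock value `k` receives exactly
`k` walk steps. -/
lemma circuitOp_flatMap_walkStep (hO : ∀ k, O k ∈ Matrix.unitaryGroup (R k → Bool) ℂ) {N : ℕ}
    (prep : List (Gate R D)) (S : Matrix.unitaryGroup (D → Bool) ℂ) (l : List (Fin N)) :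
    circuitOp O (l.flatMap (walkStep prep S)) = blockDiag fun κ =>
      walkOp (circuitOp O prep) S.1 ^ l.countP κ := by
  induction l with
  | nil => simp [circuitOp, blockDiag_one]
  | cons i l ih =>
    rw [List.flatMap_cons, circuitOp_append, ih, circuitOp_walkStep hO, blockDiag_mul]
    congr 1
    ext1 κ
    rw [List.countP_cons]
    split_ifs
    · rw [pow_succ]
    · simp

/-- The last gate rotates the eigenbasis of the hopping operator to the computational basis, so the
measurement samples its spectral distribution in an approximate eigenvector for `2c`. Halving the
eigenvalues divides `240/N²` by 4. -/
theorem estimator_secondMoment (hO : ∀ k, O k ∈ Matrix.unitaryGroup (R k → Bool) ℂ) {N : ℕ}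
    (hN : 2 ≤ N) (prep : List (Gate R D)) (S : Matrix.unitaryGroup (D → Bool) ℂ)
    (hS : (S : Matrix (D → Bool) (D → Bool) ℂ) * S = 1) {Ψ : (D → Bool) → ℂ}
    (hΨ : circuitOp O prep *ᵥ (ket fun _ => false) = Ψ) {c : ℝ}
    (hc : star Ψ ⬝ᵥ ((S : Matrix (D → Bool) (D → Bool) ℂ) *ᵥ Ψ) = c) :
    ∑ b, ((hop_isHermitian (D := D) N).eigenvalues b / 2 - c) ^ 2 *
        ‖(circuitOp O (estimatorCircuit N prep S) *ᵥ (ket fun _ => false)) b‖ ^ 2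
      ≤ 60 / (N : ℝ) ^ 2 := by
  set W := walkOp (circuitOp O prep) S.1 with hW
  have hu := circuitOp_mem_unitary hO prep
  have hW1 : W ∈ Matrix.unitaryGroup (D → Bool) ℂ :=
    mul_mem (mul_mem (mul_mem hu (reflection _).2) (Unitary.star_mem hu)) S.2
  have hΨ1 : sqNorm Ψ = 1 := by rw [← hΨ, sqNorm_mulVec_of_mem_unitary hu, sqNorm_ket]
  set χ : ℕ → (D → Bool) → ℂ := fun k => W ^ k *ᵥ Ψ with hχ
  have hχ1 : ∀ k, sqNorm (χ k) = 1 := fun k => by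
    rw [hχ, sqNorm_mulVec_of_mem_unitary (pow_mem hW1 k), hΨ1]
  have hrec : ∀ k, χ (k + 2) + χ k = (2 * (c : ℂ)) • χ (k + 1) := fun k =>
    walk_recurrence hu (by rw [← ket_eq_single, hΨ]) (by rw [← ofReal_sqNorm, hΨ1]; simp) hS hc k
  have hstate : circuitOp O (estimatorCircuit N prep S) *ᵥ (ket fun _ => false)
      = ((star (hop_isHermitian (D := D) N).eigenvectorUnitary :
          Matrix.unitaryGroup (Fin N ⊕ D → Bool) ℂ) :
            Matrix (Fin N ⊕ D → Bool) (Fin N ⊕ D → Bool) ℂ) *ᵥ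
        ∑ k ∈ Finset.range (N + 1), tens (unary N k) ((clockAmp N k : ℂ) • χ k) := by
    rw [estimatorCircuit, circuitOp_append, circuitOp_append, circuitOp_append, circuitOp_singleton,
      circuitOp_singleton, circuitOp_map_lift, circuitOp_flatMap_walkStep hO,
      ← Matrix.mulVec_mulVec, ← Matrix.mulVec_mulVec, ← Matrix.mulVec_mulVec]
    simp only [Gate.op]
    rw [clockUnitary, (exists_clockUnitary N D).choose_spec hN, clockState, Matrix.mulVec_sum,
      Matrix.mulVec_sum]
    congr 1
    refine Finset.sum_congr rfl fun k hk => ?_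
    rw [blockDiag_mulVec_tens, blockDiag_mulVec_tens,
      countP_unary (by have := Finset.mem_range.1 hk; omega), Matrix.mulVec_smul, hΨ,
      Matrix.mulVec_smul]
  have hmom := sum_eigenvalues_sub_sq (hop_isHermitian (D := D) N)
    (∑ k ∈ Finset.range (N + 1), tens (unary N k) ((clockAmp N k : ℂ) • χ k)) (2 * c)
  have hbound := sqNorm_hop_sub_le hN χ hχ1 c hrec
  rw [← hmom, ← hstate] at hbound
  have e : ∀ b, ((hop_isHermitian (D := D) N).eigenvalues b / 2 - c) ^ 2 *
      ‖(circuitOp O (estimatorCircuit N prep S) *ᵥ (ket fun _ => false)) b‖ ^ 2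
      = 1 / 4 * (((hop_isHermitian (D := D) N).eigenvalues b - 2 * c) ^ 2 *
        ‖(circuitOp O (estimatorCircuit N prep S) *ᵥ (ket fun _ => false)) b‖ ^ 2) := fun b => by ring
  rw [Finset.sum_congr rfl fun b _ => e b, ← Finset.mul_sum]
  have : (60 : ℝ) / (N : ℝ) ^ 2 = 1 / 4 * (240 / (N : ℝ) ^ 2) := by ring
  rw [this]
  gcongr

/-- The estimation algorithm; its outcome is multiplied by `scale`. -/
def estimator (N : ℕ) (prep : List (Gate R D)) (S : Matrix.unitaryGroup (D → Bool) ℂ) (scale : ℝ) :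
    Algorithm R where
  Q := Fin N ⊕ D
  circuit := estimatorCircuit N prep S
  readout b := scale * ((hop_isHermitian (D := D) N).eigenvalues b / 2)

lemma estimator_calls (N : ℕ) (prep : List (Gate R D)) (S : Matrix.unitaryGroup (D → Bool) ℂ)
    (scale : ℝ) (k : OracleName) :
    (estimator N prep S scale).calls k = circuitCost k prep * (1 + 2 * N) :=
  circuitCost_estimatorCircuit N prep S k

/-- Chebyshev's inequality for the outcome of the estimation algorithm. -/
theorem estimator_successProb (hO : ∀ k, O k ∈ Matrix.unitaryGroup (R k → Bool) ℂ) {N : ℕ}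
    (hN : 2 ≤ N) (prep : List (Gate R D)) (S : Matrix.unitaryGroup (D → Bool) ℂ)
    (hS : (S : Matrix (D → Bool) (D → Bool) ℂ) * S = 1) {Ψ : (D → Bool) → ℂ}
    (hΨ : circuitOp O prep *ᵥ (ket fun _ => false) = Ψ) {c : ℝ}
    (hc : star Ψ ⬝ᵥ ((S : Matrix (D → Bool) (D → Bool) ℂ) *ᵥ Ψ) = c) {scale v tol δ : ℝ}
    (hscale : 0 ≤ scale) (hδ : 0 < δ) (hNδ : 80 ≤ N * δ) (hv : |scale * c - v| + scale * δ ≤ tol) :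
    0.99 ≤ (estimator N prep S scale).successProb O v tol := by
  have h2 := estimator_secondMoment hO hN prep S hS hΨ hc
  have h1 : sqNorm (circuitOp O (estimatorCircuit N prep S) *ᵥ (ket fun _ => false)) = 1 := by
    rw [sqNorm_mulVec_of_mem_unitary (circuitOp_mem_unitary hO _), sqNorm_ket]
  have hfin : (estimator N prep S scale).finalState O
      = circuitOp O (estimatorCircuit N prep S) *ᵥ (ket fun _ => false) := foldl_op O _ _
  rw [Algorithm.successProb, hfin]
  set ψ := circuitOp O (estimatorCircuit N prep S) *ᵥ (ket fun _ => false) with hψ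
  set lam := (hop_isHermitian (D := D) N).eigenvalues with hlam
  change (0.99 : ℝ) ≤ ∑ b : Fin N ⊕ D → Bool, _
  have hterm : ∀ b : Fin N ⊕ D → Bool,
      ‖ψ b‖ ^ 2 - 1 / δ ^ 2 * ((lam b / 2 - c) ^ 2 * ‖ψ b‖ ^ 2) ≤
      open Classical in
      if |(estimator N prep S scale).readout b - v| ≤ tol then ‖ψ b‖ ^ 2 else 0 := by
    intro b
    split_ifs with h
    · have : 0 ≤ 1 / δ ^ 2 * ((lam b / 2 - c) ^ 2 * ‖ψ b‖ ^ 2) := by positivity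
      linarith
    · have hlt : δ < |lam b / 2 - c| := by
        by_contra! hle
        refine h (le_trans ?_ hv)
        change |scale * (lam b / 2) - v| ≤ _
        calc |scale * (lam b / 2) - v| = |(scale * c - v) + scale * (lam b / 2 - c)| := by ring_nf
          _ ≤ |scale * c - v| + |scale * (lam b / 2 - c)| := abs_add_le _ _
          _ ≤ _ := by rw [abs_mul, abs_of_nonneg hscale]; gcongr
      have hsq : δ ^ 2 ≤ (lam b / 2 - c) ^ 2 := by
        rw [← sq_abs (lam b / 2 - c)]; gcongr
      have h3 : ‖ψ b‖ ^ 2 ≤ 1 / δ ^ 2 * ((lam b / 2 - c) ^ 2 * ‖ψ b‖ ^ 2) := by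
        rw [one_div, ← div_eq_inv_mul, le_div_iff₀ (by positivity), mul_comm]
        gcongr
      linarith
  refine le_trans ?_ (Finset.sum_le_sum fun b _ => hterm b)
  rw [Finset.sum_sub_distrib, ← Finset.mul_sum]
  change (0.99 : ℝ) ≤ sqNorm ψ - _
  rw [h1]
  have hN0 : (0 : ℝ) < N := by exact_mod_cast (by omega : 0 < N)
  -- The requirement `80 ≤ N δ` is made for this: `60 / 80² < 0.01`.
  have h4 : 1 / δ ^ 2 * (60 / (N : ℝ) ^ 2) ≤ 0.01 := by
    rw [div_mul_div_comm, ← mul_pow, div_le_iff₀ (by positivity), mul_comm δ]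
    nlinarith
  have h5 : 1 / δ ^ 2 * ∑ b, (lam b / 2 - c) ^ 2 * ‖ψ b‖ ^ 2 ≤ 1 / δ ^ 2 * (60 / (N : ℝ) ^ 2) := by
    gcongr
  have h6 := h5.trans h4
  norm_num at h6 ⊢
  linarith

end Estimator

/-! ### Reflections of one qubit -/

/-- The reflection `[[g, √(1-g²)], [√(1-g²), -g]]` of one qubit. -/
def mirror (g : ℝ) : Matrix (Unit → Bool) (Unit → Bool) ℂ :=
  Matrix.of fun c c' =>
    if c () = c' () then (if c () then -(g : ℂ) else g) else (Real.sqrt (1 - g ^ 2) : ℂ)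

lemma mirror_conjTranspose (g : ℝ) : (mirror g)ᴴ = mirror g := by
  ext c c'
  rw [Matrix.conjTranspose_apply, mirror, Matrix.of_apply, Matrix.of_apply]
  cases h : c () <;> cases h' : c' () <;> simp

lemma mirror_mul_self {g : ℝ} (hg : |g| ≤ 1) : mirror g * mirror g = 1 := by
  have hs : ((Real.sqrt (1 - g ^ 2) : ℝ) : ℂ) * (Real.sqrt (1 - g ^ 2) : ℝ) = 1 - (g : ℂ) ^ 2 := by
    rw [← Complex.ofReal_mul, Real.mul_self_sqrt (by nlinarith [sq_abs g, abs_nonneg g])]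
    push_cast; ring
  ext c c'
  rw [Matrix.mul_apply, ← Equiv.sum_comp (Equiv.funUnique Unit Bool).symm, Fintype.sum_bool]
  have h1 : (1 : Matrix (Unit → Bool) (Unit → Bool) ℂ) c c' = if c () = c' () then 1 else 0 := by
    rw [Matrix.one_apply]
    congr 1
    exact propext ⟨fun h => by rw [h], fun h => funext fun _ => h⟩
  rw [h1]
  simp only [mirror, Matrix.of_apply, Equiv.funUnique_symm_apply, uniqueElim_const]
  cases h : c () <;> cases h' : c' () <;> simp <;>
    first | ring1 | linear_combination hs

/-- `mirror g` as a unitary, for `|g| ≤ 1`. -/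
def mirrorUnitary (g : ℝ) (hg : |g| ≤ 1) : Matrix.unitaryGroup (Unit → Bool) ℂ :=
  ⟨mirror g, by
    rw [Matrix.mem_unitaryGroup_iff, Matrix.star_eq_conjTranspose, mirror_conjTranspose,
      mirror_mul_self hg]⟩

/-- The value sits in the corner entry of the reflection, so a mean of reals in `[-1, 1]` becomes
the expectation of an involution, as the walk requires. -/
lemma star_ket_dotProduct_mirror (g : ℝ) (a : ℂ) :
    star (a • ket fun _ : Unit => false) ⬝ᵥ (mirror g *ᵥ (a • ket fun _ : Unit => false))
      = ((‖a‖ ^ 2 * g : ℝ) : ℂ) := by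
  rw [Matrix.mulVec_smul, star_smul, smul_dotProduct, dotProduct_smul, ket_eq_single,
    Matrix.mulVec_single_one]
  have : star (Pi.single (fun _ : Unit => false) (1 : ℂ)) ⬝ᵥ (mirror g).col (fun _ => false)
      = (g : ℂ) := by
    rw [← Pi.single_star]
    simp [mirror]
  rw [this]
  push_cast
  rw [← Complex.conj_mul', smul_eq_mul, smul_eq_mul]
  simp only [RCLike.star_def]
  ring

lemma star_sum_tens_dotProduct {I : Type*} {K D : Type} [Fintype K] [DecidableEq K] [Fintype D]
    [DecidableEq D] [DecidableEq I] (s : Finset I) {κ : I → K → Bool} (hκ : Set.InjOn κ s)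
    (χ ψ : I → (D → Bool) → ℂ) :
    star (∑ i ∈ s, tens (κ i) (χ i)) ⬝ᵥ ∑ i ∈ s, tens (κ i) (ψ i) = ∑ i ∈ s, star (χ i) ⬝ᵥ ψ i := by
  rw [star_sum, sum_dotProduct]
  refine Finset.sum_congr rfl fun i hi => ?_
  rw [dotProduct_sum, Finset.sum_eq_single i]
  · rw [star_tens_dotProduct, if_pos rfl]
  · intro j hj hji
    rw [star_tens_dotProduct, if_neg fun h => hji (hκ hi hj h).symm]
  · exact fun h => absurd hi h

/-- Truncation to `[-1, 1]`. -/
def clip (t : ℝ) : ℝ := max (-1) (min 1 t)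

lemma abs_clip_le (t : ℝ) : |clip t| ≤ 1 := by
  rw [abs_le]
  exact ⟨le_max_left _ _, max_le (by norm_num) (min_le_left _ _)⟩

/-- Clipping makes the observable a reflection for every content of the value register, including
approximate values beyond `B`, and never increases the error. -/
lemma abs_clip_sub_le {t r : ℝ} (hr : |r| ≤ 1) : |clip t - r| ≤ |t - r| := by
  obtain ⟨h1, h2⟩ := abs_le.1 hr
  unfold clip
  rcases le_total t 1 with h | h
  · rw [min_eq_right h]
    rcases le_total (-1) t with h' | h'
    · rw [max_eq_right h']
    · rw [max_eq_left h', abs_of_nonpos (by linarith), abs_of_nonpos (by linarith)]; linarith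
  · rw [min_eq_left h, max_eq_right (by norm_num), abs_of_nonneg (by linarith),
      abs_of_nonneg (by linarith)]
    linarith

/-! ### The algorithm for the task -/

namespace Task

variable (T : Task.{u})

instance (k : OracleName) : Fintype (T.Reg k) := by
  cases k
  · exact inferInstanceAs (Fintype T.RegProb)
  · exact inferInstanceAs (Fintype T.RegFunc)
  · exact inferInstanceAs (Fintype T.RegCoef)
  · exact inferInstanceAs (Fintype T.RegSgn)

instance (k : OracleName) : DecidableEq (T.Reg k) := by
  cases k
  · exact inferInstanceAs (DecidableEq T.RegProb)
  · exact inferInstanceAs (DecidableEq T.RegFunc)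
  · exact inferInstanceAs (DecidableEq T.RegCoef)
  · exact inferInstanceAs (DecidableEq T.RegSgn)

variable {T} in
lemma Oracles.mat_mem_unitary (O : T.Oracles) (k : OracleName) :
    O.mat k ∈ Matrix.unitaryGroup (T.Reg k → Bool) ℂ := by
  cases k
  · exact O.prob.2
  · exact O.func.2
  · exact O.coef.2
  · exact O.sgn.2

/-- The registers of `O_F` and of `O_sign`. -/
abbrev Regs : Type := T.RegFunc ⊕ T.RegSgn

/-- All registers that hold data, and one further qubit. -/
abbrev Data : Type := T.Regs ⊕ Unit

/-- The position of the register of `O_S`. -/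
def posProb : T.RegProb ↪ T.Data := ⟨fun q => .inl (.inl (.inl q)), fun _ _ h => by simpa using h⟩

/-- The position of the register of `O_F`. -/
def posFunc : T.RegFunc ↪ T.Data := ⟨fun q => .inl (.inl q), fun _ _ h => by simpa using h⟩

/-- The position of the register of `O_coef`. -/
def posCoef : T.RegCoef ↪ T.Data := ⟨fun q => .inl (.inr (.inl q)), fun _ _ h => by simpa using h⟩

/-- The position of the register of `O_sign`. -/
def posSgn : T.RegSgn ↪ T.Data := ⟨fun q => .inl (.inr q), fun _ _ h => by simpa using h⟩

/-- Contents of the registers. -/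
def regBits (s : Fin T.wS → Bool) (ξ : Fin (T.fmt T.εt).wX → Bool) (y : Fin (T.fmt T.εt).wY → Bool)
    (j : Fin T.wJ → Bool) (θ : Bool) : T.Regs → Bool :=
  Sum.elim (Sum.elim s (Sum.elim ξ (Sum.elim y fun _ => false))) (Sum.elim j fun _ => θ)

/-- Contents of the registers, with the further qubit in the state `0`. -/
def dataBits (s : Fin T.wS → Bool) (ξ : Fin (T.fmt T.εt).wX → Bool) (y : Fin (T.fmt T.εt).wY → Bool)
    (j : Fin T.wJ → Bool) (θ : Bool) : T.Data → Bool :=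
  Sum.elim (T.regBits s ξ y j θ) fun _ => false

/-- The bit string of `x + jh` as a function of the bit string of `j`. -/
def gridCode (κ : Fin T.wJ → Bool) : Fin (T.fmt T.εt).wX → Bool :=
  open Classical in
  if h : ∃ j ∈ nodes T.n, T.codeJ j = κ then (T.fmt T.εt).codeX (T.x + h.choose * T.h)
  else fun _ => false

lemma gridCode_codeJ {j : ℤ} (hj : j ∈ nodes T.n) :
    T.gridCode (T.codeJ j) = (T.fmt T.εt).codeX (T.x + j * T.h) := by
  have h : ∃ j' ∈ nodes T.n, T.codeJ j' = T.codeJ j := ⟨j, hj, rfl⟩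
  rw [gridCode, dif_pos h, T.codeJ_inj h.choose_spec.1 hj h.choose_spec.2]

/-- Add the bit string of `x + jh` to the parameter register. -/
def addGrid (b : T.Data → Bool) : T.Data → Bool
  | .inl (.inl (.inr (.inl q))) =>
      Bool.xor (b (.inl (.inl (.inr (.inl q))))) (T.gridCode (b ∘ T.posCoef) q)
  | q => b q

lemma addGrid_comp_posCoef (b : T.Data → Bool) : T.addGrid b ∘ T.posCoef = b ∘ T.posCoef := rfl

/-- The added string depends only on the register for `j`, which is left unchanged, and XOR cancels
on repetition. The map is therefore a permutation and gives an oracle-free gate. -/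
lemma addGrid_involutive : Function.Involutive T.addGrid := by
  intro b
  ext q
  rcases q with ((q | q | q | q) | (q | q)) | q
  · rfl
  · change Bool.xor (Bool.xor (b (.inl (.inl (.inr (.inl q))))) (T.gridCode (b ∘ T.posCoef) q))
      (T.gridCode (T.addGrid b ∘ T.posCoef) q) = _
    rw [addGrid_comp_posCoef, Bool.xor_assoc, Bool.xor_self, Bool.xor_false]
  all_goals rfl

lemma addGrid_dataBits {s : Fin T.wS → Bool} {j : ℤ} (hj : j ∈ nodes T.n) :
    T.addGrid (T.dataBits s (fun _ => false) (fun _ => false) (T.codeJ j) false)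
      = T.dataBits s ((T.fmt T.εt).codeX (T.x + j * T.h)) (fun _ => false) (T.codeJ j) false := by
  ext q
  rcases q with ((q | q | q | q) | (q | q)) | q
  · rfl
  · change Bool.xor false (T.gridCode (T.codeJ j) q) = _
    rw [Bool.false_xor, T.gridCode_codeJ hj]
    rfl
  all_goals rfl

/-- The circuit that prepares a superposition of grid points, values and signs. -/
def prep : List (Gate T.Reg T.Data) :=
  [.query .prob false T.posProb, .query .coef false T.posCoef,
    .free (permUnitary T.addGrid_involutive.toPerm), .query .func false T.posFunc,
    .query .sgn false T.posSgn]

lemma circuitCost_prep (k : OracleName) : circuitCost k T.prep = 1 := by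
  cases k <;> simp [circuitCost, prep, Gate.cost]

/-- The quantity whose mean is estimated, as a function of the bits in the registers. -/
def signedValue (β : T.Regs → Bool) : ℝ :=
  (if β (.inr (.inr ())) then 1 else -1) *
    clip ((T.fmt T.εt).valY (fun q => β (.inl (.inr (.inr (.inl q))))) / T.B)

lemma abs_signedValue_le (β : T.Regs → Bool) : |T.signedValue β| ≤ 1 := by
  rw [signedValue, abs_mul]
  have := abs_clip_le ((T.fmt T.εt).valY (fun q => β (.inl (.inr (.inr (.inl q))))) / T.B)
  split_ifs <;> simpa using this

/-- The observable whose mean is estimated. -/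
def observable : Matrix.unitaryGroup (T.Data → Bool) ℂ :=
  controlled fun β => mirrorUnitary (T.signedValue β) (T.abs_signedValue_le β)

lemma observable_mul_self : T.observable.1 * T.observable.1 = 1 := by
  change blockDiag (fun β => mirror (T.signedValue β)) *
    blockDiag (fun β => mirror (T.signedValue β)) = 1
  rw [blockDiag_mul, ← blockDiag_one]
  congr 1
  ext1 β
  exact mirror_mul_self (T.abs_signedValue_le β)

/-- The factor between the estimated mean and the derivative. -/
def scale : ℝ := T.B * DSum T.m T.n / T.h ^ T.m

/-- The sum-in-QAE method. -/
def algorithm : Algorithm T.Reg :=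
  open Classical in
  if T.scale ≤ 2 * T.ε then ⟨Unit, [], fun _ => 0⟩
  else estimator ⌈80 * T.scale / T.ε⌉₊ T.prep T.observable T.scale

variable {T}

/-! ### The prepared state and the mean of the observable. -/

section Preparation

variable {O : T.Oracles} {p : T.S → ℝ} {G : T.S → ℝ → ℝ}

lemma prep_mulVec (hO : O.Implements p G) : ∃ y : T.S → ℤ → Fin (T.fmt T.εt).wY → Bool,
    (∀ s, ∀ j ∈ nodes T.n, (T.fmt T.εt).valY (y s j) = G s (T.x + j * T.h)) ∧
    circuitOp O.mat T.prep *ᵥ (ket fun _ => false) =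
      ∑ i ∈ Finset.univ ×ˢ nodes T.n,
        tens (T.regBits (T.codeS i.1) ((T.fmt T.εt).codeX (T.x + i.2 * T.h)) (y i.1 i.2)
            (T.codeJ i.2) (decide (0 ≤ dCoef T.m T.n i.2)))
          (((Real.sqrt (p i.1) * Real.sqrt (|dCoef T.m T.n i.2| / DSum T.m T.n) : ℝ) : ℂ) •
            ket fun _ : Unit => false) := by
  have hy : ∀ (s : T.S) (j : ℤ), ∃ y : Fin (T.fmt T.εt).wY → Bool, j ∈ nodes T.n →
      (T.fmt T.εt).valY y = G s (T.x + j * T.h) ∧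
      (O.func : Matrix (T.RegFunc → Bool) (T.RegFunc → Bool) ℂ) *ᵥ
          ket (T.funcBits s (T.x + j * T.h) fun _ => false) =
        ket (T.funcBits s (T.x + j * T.h) y) := by
    intro s j
    by_cases hj : j ∈ nodes T.n
    · obtain ⟨y, h⟩ := hO.func s j hj
      exact ⟨y, fun _ => h⟩
    · exact ⟨fun _ => false, fun h => absurd h hj⟩
  choose y hy using hy
  refine ⟨y, fun s j hj => (hy s j hj).1, ?_⟩
  have h0 : (fun _ => false : T.Data → Bool)
      = T.dataBits (fun _ => false) (fun _ => false) (fun _ => false) (fun _ => false) false := by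
    ext q
    rcases q with ((q | q | q | q) | (q | q)) | q <;> rfl
  have h1 : onQubits T.posProb O.prob.1 *ᵥ (ket fun _ => false)
      = ∑ s, ((Real.sqrt (p s) : ℝ) : ℂ) •
        ket (T.dataBits (T.codeS s) (fun _ => false) (fun _ => false) (fun _ => false) false) := by
    rw [h0]
    refine onQubits_mulVec_ket_eq_sum _ _ _ (fun s => T.codeS s) _ hO.prob (fun s => rfl) ?_
    rintro s (((q | q | q | q) | (q | q)) | q) hq <;> first | exact (hq ⟨_, rfl⟩).elim | rfl
  have h2 : ∀ s, onQubits T.posCoef O.coef.1 *ᵥ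
        ket (T.dataBits (T.codeS s) (fun _ => false) (fun _ => false) (fun _ => false) false)
      = ∑ j ∈ nodes T.n, ((Real.sqrt (|dCoef T.m T.n j| / DSum T.m T.n) : ℝ) : ℂ) •
        ket (T.dataBits (T.codeS s) (fun _ => false) (fun _ => false) (T.codeJ j) false) := by
    intro s
    refine onQubits_mulVec_ket_eq_sum _ _ _ (fun j => T.codeJ j) _ hO.coef (fun s => rfl) ?_
    rintro s (((q | q | q | q) | (q | q)) | q) hq <;> first | exact (hq ⟨_, rfl⟩).elim | rfl
  have h3 : ∀ s, ∀ j ∈ nodes T.n, (permUnitary T.addGrid_involutive.toPerm).1 *ᵥ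
        ket (T.dataBits (T.codeS s) (fun _ => false) (fun _ => false) (T.codeJ j) false)
      = ket (T.dataBits (T.codeS s) ((T.fmt T.εt).codeX (T.x + j * T.h)) (fun _ => false)
          (T.codeJ j) false) := by
    intro s j hj
    rw [permUnitary_mulVec_ket, ← T.addGrid_dataBits hj]
    rfl
  have h4 : ∀ s, ∀ j ∈ nodes T.n, onQubits T.posFunc O.func.1 *ᵥ
        ket (T.dataBits (T.codeS s) ((T.fmt T.εt).codeX (T.x + j * T.h)) (fun _ => false)
          (T.codeJ j) false)
      = ket (T.dataBits (T.codeS s) ((T.fmt T.εt).codeX (T.x + j * T.h)) (y s j)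
          (T.codeJ j) false) := by
    intro s j hj
    refine onQubits_mulVec_ket_eq_ket _ _ (hy s j hj).2 rfl ?_
    rintro (((q | q | q | q) | (q | q)) | q) hq <;> first | exact (hq ⟨_, rfl⟩).elim | rfl
  have h5 : ∀ s, ∀ j ∈ nodes T.n, onQubits T.posSgn O.sgn.1 *ᵥ
        ket (T.dataBits (T.codeS s) ((T.fmt T.εt).codeX (T.x + j * T.h)) (y s j)
          (T.codeJ j) false)
      = ket (T.dataBits (T.codeS s) ((T.fmt T.εt).codeX (T.x + j * T.h)) (y s j)
          (T.codeJ j) (decide (0 ≤ dCoef T.m T.n j))) := by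
    intro s j hj
    refine onQubits_mulVec_ket_eq_ket _ _ (hO.sgn j hj) rfl ?_
    rintro (((q | q | q | q) | (q | q)) | q) hq <;> first | exact (hq ⟨_, rfl⟩).elim | rfl
  have hrun : circuitOp O.mat T.prep *ᵥ (ket fun _ => false)
      = onQubits T.posSgn O.sgn.1 *ᵥ (onQubits T.posFunc O.func.1 *ᵥ
        ((permUnitary T.addGrid_involutive.toPerm).1 *ᵥ (onQubits T.posCoef O.coef.1 *ᵥ
          (onQubits T.posProb O.prob.1 *ᵥ (ket fun _ => false))))) := by
    rw [prep]
    simp only [circuitOp, one_mul, ← Matrix.mulVec_mulVec]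
    rfl
  rw [hrun, h1]
  simp only [Matrix.mulVec_sum, Matrix.mulVec_smul, h2]
  rw [Finset.sum_product]
  refine Finset.sum_congr rfl fun s _ => ?_
  rw [Finset.smul_sum]
  refine Finset.sum_congr rfl fun j hj => ?_
  rw [h3 s j hj, h4 s j hj, h5 s j hj, tens_smul, tens_ket, smul_smul]
  push_cast
  rfl

/-- The registers for `s` and `j` alone already distinguish the branches. Orthogonality therefore
holds whatever the value and sign registers contain, and nothing has to be uncomputed. -/
lemma regBits_injOn (y : T.S → ℤ → Fin (T.fmt T.εt).wY → Bool) :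
    Set.InjOn (fun i : T.S × ℤ =>
      T.regBits (T.codeS i.1) ((T.fmt T.εt).codeX (T.x + i.2 * T.h)) (y i.1 i.2) (T.codeJ i.2)
        (decide (0 ≤ dCoef T.m T.n i.2))) ((Finset.univ ×ˢ nodes T.n : Finset (T.S × ℤ)) : Set _) := by
  classical
  rintro ⟨s, j⟩ hi ⟨s', j'⟩ hi' h
  simp only [Finset.coe_product, Set.mem_prod, Finset.mem_coe] at hi hi'
  have hs : T.codeS s = T.codeS s' := funext fun q => congrFun h (.inl (.inl q))
  have hj : T.codeJ j = T.codeJ j' := funext fun q => congrFun h (.inr (.inl q))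
  rw [T.codeS_inj hs, T.codeJ_inj hi.2 hi'.2 hj]

end Preparation

variable (T) in
lemma DSum_pos' : 0 < DSum T.m T.n := DSum_pos T.one_le_m T.m_le

/-- The mean of the observable in the prepared state. -/
def meanValue (T : Task.{u}) (p : T.S → ℝ) (G : T.S → ℝ → ℝ) : ℝ :=
  ∑ s, ∑ j ∈ nodes T.n, p s * (dCoef T.m T.n j / DSum T.m T.n * clip (G s (T.x + j * T.h) / T.B))

/-- The observable is block diagonal in the orthogonal branches, so the mean is a weighted average.
The weight `|d_j|` and the sign bit recombine to `d_j`. -/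
lemma star_dotProduct_observable {O : T.Oracles} {p : T.S → ℝ} {G : T.S → ℝ → ℝ}
    (hO : O.Implements p G) (hp : ∀ s, 0 ≤ p s) :
    star (circuitOp O.mat T.prep *ᵥ (ket fun _ => false)) ⬝ᵥ
      (T.observable.1 *ᵥ (circuitOp O.mat T.prep *ᵥ (ket fun _ => false)))
      = (T.meanValue p G : ℂ) := by
  classical
  obtain ⟨y, hy, hprep⟩ := prep_mulVec hO
  have hobs : T.observable.1 = blockDiag fun β => mirror (T.signedValue β) := rfl
  rw [hprep, hobs, Matrix.mulVec_sum]
  simp only [blockDiag_mulVec_tens]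
  rw [star_sum_tens_dotProduct _ (regBits_injOn y), meanValue, ← Finset.sum_product']
  push_cast
  refine Finset.sum_congr rfl fun i hi => ?_
  have hj : i.2 ∈ nodes T.n := (Finset.mem_product.1 hi).2
  rw [← Complex.ofReal_mul, star_ket_dotProduct_mirror, Complex.norm_real, Real.norm_eq_abs, sq_abs, mul_pow,
    Real.sq_sqrt (hp i.1), Real.sq_sqrt (div_nonneg (abs_nonneg _) T.DSum_pos'.le)]
  have hval : T.signedValue (T.regBits (T.codeS i.1) ((T.fmt T.εt).codeX (T.x + i.2 * T.h))
      (y i.1 i.2) (T.codeJ i.2) (decide (0 ≤ dCoef T.m T.n i.2)))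
      = (if 0 ≤ dCoef T.m T.n i.2 then 1 else -1) * clip (G i.1 (T.x + i.2 * T.h) / T.B) := by
    rw [← hy i.1 i.2 hj]
    change (if decide (0 ≤ dCoef T.m T.n i.2) = true then (1 : ℝ) else -1) * _ = _
    simp only [decide_eq_true_eq]
    rfl
  rw [hval]
  split_ifs with h
  · rw [abs_of_nonneg h]; push_cast; ring
  · rw [abs_of_neg (not_le.1 h)]; push_cast; ring

/-! ### Accuracy and number of calls. -/

lemma abs_derivative_sub_le {p : T.S → ℝ} {F : T.S → ℝ → ℝ} (h : T.Admissible p F) :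
    |iteratedDeriv T.m (T.V p F) T.x -
      (∑ j ∈ nodes T.n, dCoef T.m T.n j * T.V p F (T.x + j * T.h)) / T.h ^ T.m| ≤ T.ε := by
  obtain ⟨A, c, σ, -, -, hG, hstep⟩ := h.V_gevrey
  exact abs_iteratedDeriv_sub_centralDifference_le T.one_le_m T.m_le hG T.h_pos hstep T.x

lemma abs_V_le {p : T.S → ℝ} {F : T.S → ℝ → ℝ} (h : T.Admissible p F) (ξ : ℝ) :
    |T.V p F ξ| ≤ T.B := by
  calc |T.V p F ξ| ≤ ∑ s, p s * T.B := by
        refine (Finset.abs_sum_le_sum_abs _ _).trans (Finset.sum_le_sum fun s _ => ?_)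
        rw [abs_mul, abs_of_nonneg (h.p_mem s).1]
        exact mul_le_mul_of_nonneg_left (h.F_bound s ξ) (h.p_mem s).1
    _ = T.B := by rw [← Finset.sum_mul, h.p_sum, one_mul]

/-- An error `ε̃` in each value is amplified by at most `D / h^m`, and `ε̃` is defined so that the
product is `ε`. -/
lemma abs_scale_mul_meanValue_sub_le {p : T.S → ℝ} {F G : T.S → ℝ → ℝ} (h : T.Admissible p F)
    (hG : ∀ s ξ, |G s ξ - F s ξ| ≤ T.εt) (hB : 0 < T.B) :
    |T.scale * T.meanValue p G -
      (∑ j ∈ nodes T.n, dCoef T.m T.n j * T.V p F (T.x + j * T.h)) / T.h ^ T.m| ≤ T.ε := by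
  have hD := T.DSum_pos'
  have hh : 0 < T.h ^ T.m := pow_pos T.h_pos _
  have hdiff : ∀ s ξ, |T.B * clip (G s ξ / T.B) - F s ξ| ≤ T.εt := by
    intro s ξ
    have h1 : |F s ξ / T.B| ≤ 1 := by
      rw [abs_div, abs_of_pos hB, div_le_one hB]; exact h.F_bound s ξ
    have h2 := abs_clip_sub_le (t := G s ξ / T.B) h1
    calc |T.B * clip (G s ξ / T.B) - F s ξ| = T.B * |clip (G s ξ / T.B) - F s ξ / T.B| := by
          rw [← abs_of_pos hB, ← abs_mul, abs_of_pos hB, mul_sub, mul_div_cancel₀ _ hB.ne']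
      _ ≤ T.B * |G s ξ / T.B - F s ξ / T.B| := by gcongr
      _ = |G s ξ - F s ξ| := by
          rw [← sub_div, abs_div, abs_of_pos hB, mul_div_cancel₀ _ hB.ne']
      _ ≤ _ := hG s ξ
  have e : T.scale * T.meanValue p G -
      (∑ j ∈ nodes T.n, dCoef T.m T.n j * T.V p F (T.x + j * T.h)) / T.h ^ T.m
      = (∑ j ∈ nodes T.n, ∑ s, dCoef T.m T.n j * (p s *
          (T.B * clip (G s (T.x + j * T.h) / T.B) - F s (T.x + j * T.h)))) / T.h ^ T.m := by
    rw [eq_div_iff hh.ne', sub_mul, div_mul_cancel₀ _ hh.ne', scale, meanValue, Finset.sum_comm,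
      mul_comm, ← mul_assoc, mul_div_cancel₀ _ hh.ne']
    simp only [V, Finset.mul_sum, ← Finset.sum_sub_distrib]
    refine Finset.sum_congr rfl fun j _ => Finset.sum_congr rfl fun s _ => ?_
    field_simp
  rw [e, abs_div, abs_of_pos hh, div_le_iff₀ hh]
  calc |∑ j ∈ nodes T.n, ∑ s, dCoef T.m T.n j * (p s *
          (T.B * clip (G s (T.x + j * T.h) / T.B) - F s (T.x + j * T.h)))|
      ≤ ∑ j ∈ nodes T.n, ∑ s, |dCoef T.m T.n j| * (p s * T.εt) := by
        refine (Finset.abs_sum_le_sum_abs _ _).trans (Finset.sum_le_sum fun j _ => ?_)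
        refine (Finset.abs_sum_le_sum_abs _ _).trans (Finset.sum_le_sum fun s _ => ?_)
        rw [abs_mul, abs_mul, abs_of_nonneg (h.p_mem s).1]
        have := (h.p_mem s).1
        gcongr
        exact hdiff _ _
    _ = DSum T.m T.n * T.εt := by
        simp only [← Finset.mul_sum, ← Finset.sum_mul, h.p_sum, one_mul, DSum]
    _ = T.ε * T.h ^ T.m := by
        rw [εt, epsTilde]; field_simp

theorem algorithm_solvedBy (T : Task.{u}) : T.SolvedBy T.algorithm := by
  intro p F G O hadm hG hO
  have hD := T.DSum_pos'
  have hh : 0 < T.h ^ T.m := pow_pos T.h_pos _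
  have hε := T.ε_pos
  have hder := abs_derivative_sub_le hadm
  rw [algorithm]
  split_ifs with hsc
  -- The difference quotient is at most `scale ≤ 2ε` in modulus and the derivative lies within `ε`
  -- of it, so the output 0 is good enough.
  · have h1 : |(∑ j ∈ nodes T.n, dCoef T.m T.n j * T.V p F (T.x + j * T.h)) / T.h ^ T.m| ≤ T.scale := by
      rw [abs_div, abs_of_pos hh, scale]
      refine div_le_div_of_nonneg_right ?_ hh.le
      rw [mul_comm, DSum, Finset.sum_mul]
      refine (Finset.abs_sum_le_sum_abs _ _).trans (Finset.sum_le_sum fun j _ => ?_)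
      rw [abs_mul]
      gcongr
      exact abs_V_le hadm _
    have h2 : |(0 : ℝ) - iteratedDeriv T.m (T.V p F) T.x| ≤ 3 * T.ε := by
      rw [zero_sub, abs_neg]
      have := abs_sub_abs_le_abs_sub (iteratedDeriv T.m (T.V p F) T.x)
        ((∑ j ∈ nodes T.n, dCoef T.m T.n j * T.V p F (T.x + j * T.h)) / T.h ^ T.m)
      linarith
    simp only [Algorithm.successProb, h2, if_true]
    change (0.99 : ℝ) ≤ sqNorm (ket fun _ : Unit => false)
    rw [sqNorm_ket]; norm_num
  · push Not at hsc
    have hs0 : 0 < T.scale := by linarith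
    have hB : 0 < T.B := by
      rcases T.B_nonneg.eq_or_lt with h | h
      · rw [scale, ← h] at hs0; simp at hs0
      · exact h
    have hN : 80 * T.scale / T.ε ≤ ⌈80 * T.scale / T.ε⌉₊ := Nat.le_ceil _
    have hN2 : (2 : ℝ) ≤ ⌈80 * T.scale / T.ε⌉₊ := by
      refine le_trans ?_ hN
      rw [le_div_iff₀ hε]; linarith
    -- The mean is needed to precision `δ = ε / scale`; rescaling turns this into the third `ε` of
    -- the error budget.
    refine estimator_successProb O.mat_mem_unitary (by exact_mod_cast hN2) _ _ T.observable_mul_self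
      rfl (star_dotProduct_observable hO fun s => (hadm.p_mem s).1) hs0.le
      (div_pos hε hs0) ?_ ?_
    · rw [div_le_iff₀ hε] at hN
      rw [mul_div_assoc', le_div_iff₀ hs0]
      exact hN
    · rw [mul_div_cancel₀ _ hs0.ne']
      have h1 := abs_scale_mul_meanValue_sub_le hadm hG hB
      have h2 := abs_sub_le (T.scale * T.meanValue p G)
        ((∑ j ∈ nodes T.n, dCoef T.m T.n j * T.V p F (T.x + j * T.h)) / T.h ^ T.m)
        (iteratedDeriv T.m (T.V p F) T.x)
      rw [abs_sub_comm] at hder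
      linarith

theorem algorithm_calls_le (T : Task.{u}) (k : OracleName) :
    (T.algorithm.calls k : ℝ) ≤
      324 * (T.m * (2 * (1 + Real.log T.n)) ^ T.m * T.B / (T.h ^ T.m * T.ε)) := by
  have hD := T.DSum_pos'
  have hh : 0 < T.h ^ T.m := pow_pos T.h_pos _
  have hε := T.ε_pos
  have hlog : 0 ≤ Real.log T.n := Real.log_natCast_nonneg _
  have hX : T.scale / T.ε ≤ 2 * (T.m * (2 * (1 + Real.log T.n)) ^ T.m * T.B / (T.h ^ T.m * T.ε)) := by
    rw [scale, div_div, mul_div_assoc']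
    refine div_le_div_of_nonneg_right ?_ (by positivity)
    have := mul_le_mul_of_nonneg_left (DSum_le_log T.one_le_m T.m_le) T.B_nonneg
    linarith
  rw [algorithm]
  split_ifs with hsc
  · have hB := T.B_nonneg
    have : (0 : ℝ) ≤ 324 * (T.m * (2 * (1 + Real.log T.n)) ^ T.m * T.B / (T.h ^ T.m * T.ε)) := by
      positivity
    simpa [Algorithm.calls] using this
  · push Not at hsc
    rw [estimator_calls, circuitCost_prep, one_mul]
    -- There are `1 + 2N` calls with `N < 80 scale/ε + 1`. The additive constant 3 is absorbed only
    -- because `scale/ε` is at least 2; this is why the other case makes no calls at all.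
    have h2 : 2 ≤ T.scale / T.ε := by rw [le_div_iff₀ hε]; linarith
    have hN := Nat.ceil_lt_add_one (a := 80 * T.scale / T.ε)
      (div_nonneg (by linarith) hε.le)
    rw [mul_div_assoc] at hN
    rw [mul_div_assoc]
    push_cast
    linarith

end Task

/-! ### Resources -/

namespace Task

variable (T : Task.{u})

lemma εt_pos : 0 < T.εt :=
  div_pos (mul_pos (pow_pos T.h_pos _) T.ε_pos) T.DSum_pos'

lemma one_div_εt_le : 1 / T.εt ≤
    2 * (T.m * (2 * (1 + Real.log T.n)) ^ T.m / (T.h ^ T.m * T.ε)) := by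
  have := mul_pos (pow_pos T.h_pos T.m) T.ε_pos
  rw [εt, epsTilde, one_div_div, mul_div_assoc']
  exact div_le_div_of_nonneg_right (DSum_le_log T.one_le_m T.m_le) this.le

variable {T}

lemma qubitsF_le_of_one_div_le_sq {a C δ₀ Y : ℝ} (ha : 0 < a) (hC : 0 < C)
    (hgrow : T.QubitGrowth a C δ₀) (h0 : T.εt ≤ δ₀) (h1 : T.εt ≤ 1) (hY : 1 / T.εt ≤ Y ^ 2) : (T.qubitsF T.εt : ℝ) ≤ 2 ^ a * C * Real.log Y ^ a := by
  have hpos := T.εt_pos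
  have hone : 1 ≤ 1 / T.εt := by rwa [le_div_iff₀ hpos, one_mul]
  have hlog0 : 0 ≤ Real.log (1 / T.εt) := Real.log_nonneg hone
  have hlog : Real.log (1 / T.εt) ≤ 2 * Real.log Y := by
    have := Real.log_le_log (by positivity) hY
    rwa [Real.log_pow, Nat.cast_two] at this
  calc (T.qubitsF T.εt : ℝ) ≤ C * Real.log (1 / T.εt) ^ a := hgrow _ hpos h0
    _ ≤ C * (2 * Real.log Y) ^ a := by gcongr
    _ = 2 ^ a * C * Real.log Y ^ a := by
      rw [Real.mul_rpow (by norm_num) (by linarith)]; ring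

lemma qubitsF_le {a C δ₀ : ℝ} (ha : 0 < a) (hC : 0 < C) (hgrow : T.QubitGrowth a C δ₀)
    (h0 : T.εt ≤ δ₀) (h1 : T.εt ≤ 1 / 4) :
    (T.qubitsF T.εt : ℝ) ≤ 2 ^ a * C *
      Real.log (T.m * (2 * (1 + Real.log T.n)) ^ T.m / (T.h ^ T.m * T.ε)) ^ a := by
  have h2 := T.one_div_εt_le
  set X := T.m * (2 * (1 + Real.log T.n)) ^ T.m / (T.h ^ T.m * T.ε) with hX
  have h4 : 4 ≤ 1 / T.εt := by
    rw [le_div_iff₀ T.εt_pos]; linarith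
  -- With `X` the argument of the logarithm, `4 ≤ 1/ε̃ ≤ 2X` forces `X ≥ 2`, so `2X ≤ X²`. This is
  -- where the bound `1/4` enters.
  exact qubitsF_le_of_one_div_le_sq ha hC hgrow h0 (by linarith) (by nlinarith)

/-- For the special choice of `h`, the resource bound in terms of `L`. -/
lemma resource_le_of_eventually {c σ : ℝ} {m n : ℕ} {l ε : ℝ} (hc : 0 < c) (hε : 0 < ε)
    (h1 : ((2 * n + 1 : ℕ) : ℝ) ^ mSig m σ ≤ 2 * l ^ mSig m σ)
    (h2 : (1 + Real.log n) ^ m ≤ 2 * Real.log l ^ m) :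
    m * (2 * (1 + Real.log n)) ^ m / (hTh c σ m n ^ m * ε) ≤
      4 * (m * (2 * Real.exp 1 * c * m) ^ m / ε * (l ^ mSig m σ * Real.log l ^ m)) := by
  have h0 := Real.log_natCast_nonneg n
  rw [hTh_pow]
  rcases Nat.eq_zero_or_pos m with rfl | hm
  · simp
  have hm' : (0 : ℝ) < m := by exact_mod_cast hm
  have hprod : (1 + Real.log n) ^ m * ((2 * n + 1 : ℕ) : ℝ) ^ mSig m σ ≤
      (2 * Real.log l ^ m) * (2 * l ^ mSig m σ) :=
    mul_le_mul h2 h1 (by positivity) ((by positivity : (0 : ℝ) ≤ (1 + Real.log n) ^ m).trans h2)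
  calc m * (2 * (1 + Real.log n)) ^ m /
        (1 / ((Real.exp 1 * c * m) ^ m * ((2 * n + 1 : ℕ) : ℝ) ^ mSig m σ) * ε)
      = m * (2 * Real.exp 1 * c * m) ^ m / ε *
          ((1 + Real.log n) ^ m * ((2 * n + 1 : ℕ) : ℝ) ^ mSig m σ) := by
        simp only [mul_pow]
        field_simp
    _ ≤ m * (2 * Real.exp 1 * c * m) ^ m / ε * ((2 * Real.log l ^ m) * (2 * l ^ mSig m σ)) := by
        gcongr
    _ = _ := by ring

/-- The lower bound `D n^m ≥ m!` caps `ε̃`. Since `l^m` is negligible against `2^l`, it follows that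
`ε̃` tends to 0 with `ε`, so that the growth assumption on the qubits applies. -/
lemma εt_le {m n : ℕ} {c σ l : ℝ} (hc : 0 < c) (hm : T.m = m) (hn : T.n = n)
    (hh : T.h = hTh c σ m n) (hl : (n : ℝ) ≤ l) :
    T.εt ≤ T.ε / (Real.exp 1 * c * m) ^ m * l ^ m := by
  have hD := factorial_le_DSum_mul_pow T.one_le_m T.m_le
  have hD0 := T.DSum_pos'
  have hε := T.ε_pos
  have h1 : (1 : ℝ) ≤ T.m ! := by exact_mod_cast Nat.factorial_pos _
  have hm1 := T.one_le_m
  rw [εt, epsTilde]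
  rw [hm, hn] at *
  have hm' : (0 : ℝ) < m := by exact_mod_cast hm1
  have h2 : T.h ^ m ≤ 1 / (Real.exp 1 * c * m) ^ m := by
    rw [hh, hTh_pow]
    refine one_div_le_one_div_of_le (by positivity) (le_mul_of_one_le_right (by positivity) ?_)
    exact Real.one_le_rpow (by exact_mod_cast (by omega : 1 ≤ 2 * n + 1)) (mSig_nonneg _ _)
  have h3 : (n : ℝ) ^ m ≤ l ^ m := by gcongr
  rw [div_le_iff₀ hD0]
  have h4 : 1 ≤ DSum m n * l ^ m :=
    (h1.trans hD).trans (mul_le_mul_of_nonneg_left h3 hD0.le)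
  calc T.h ^ m * T.ε ≤ 1 / (Real.exp 1 * c * m) ^ m * T.ε := by gcongr
    _ ≤ 1 / (Real.exp 1 * c * m) ^ m * T.ε * (DSum m n * l ^ m) :=
        le_mul_of_one_le_right (by positivity) h4
    _ = _ := by ring

end Task

lemma eq_mul_rpow_neg_logTerm {A c σ ε : ℝ} {m : ℕ} (hA : 0 < A) (hc : 0 < c) (hε : 0 < ε)
    (hm : 1 ≤ m) : ε = 2 * (Real.exp 1 * c * m) ^ m * A / Real.exp 1 * 2 ^ mSig m σ /
      2 ^ logTerm A c σ m ε := by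
  have hm' : (0 : ℝ) < m := by exact_mod_cast hm
  have h := epsPrime_eq (σ := σ) hA hc hε hm
  rw [Real.rpow_sub (by norm_num)] at h
  rw [mul_div_assoc, ← h, epsPrime]
  field_simp

lemma exists_logTerm_ge {A c : ℝ} (hA : 0 < A) (hc : 0 < c) {m : ℕ} (hm : 1 ≤ m) (σ l₀ : ℝ) :
    ∃ ε₀ : ℝ, 0 < ε₀ ∧ ∀ ε, 0 < ε → ε ≤ ε₀ → l₀ ≤ logTerm A c σ m ε := by
  have hm' : (0 : ℝ) < m := by exact_mod_cast hm
  have hκ : 0 < Real.exp 1 / (2 * (Real.exp 1 * c * m) ^ m) / A := by positivity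
  refine ⟨2 ^ (mSig m σ - l₀) / (Real.exp 1 / (2 * (Real.exp 1 * c * m) ^ m) / A), by positivity,
    fun ε hε hle => ?_⟩
  rw [le_logTerm_iff hA hc hε hm, epsPrime]
  rw [le_div_iff₀ hκ] at hle
  refine le_trans (le_of_eq ?_) hle
  ring

theorem qubitsF_le_of_nTh {a : ℝ} (ha : 0 < a) {m : ℕ} {A c B δ₀ : ℝ} (σ : ℝ) (hm : 1 ≤ m)
    (hA : 0 < A) (hc : 0 < c) (hB : 0 < B) (hδ₀ : 0 < δ₀) :
    ∃ ε₀ : ℝ, 0 < ε₀ ∧ ∀ (T : Task.{u}) (C : ℝ), 0 < C → T.QubitGrowth a C δ₀ →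
      T.m = m → T.B = B → T.ε ≤ ε₀ → T.n = nTh A c σ m T.ε → T.h = hTh c σ m T.n →
      (T.qubitsF T.εt : ℝ) ≤ 2 ^ a * C *
        Real.log (m * (2 * Real.exp 1 * c * m) ^ m * B / T.ε) ^ a := by
  have hm' : (0 : ℝ) < m := by exact_mod_cast hm
  set τ := mSig m σ with hτ
  set κ : ℝ := 2 * (Real.exp 1 * c * m) ^ m * A / Real.exp 1 * 2 ^ τ with hκ
  set M : ℝ := m * (2 * Real.exp 1 * c * m) ^ m with hM
  have hκ0 : 0 < κ := by positivity
  have hM0 : 0 < M := by positivity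
  -- The two constants are tuned to the final estimates: the first makes `1/ε̃` at most exactly `(M
  -- B / ε)²`, the second makes `ε̃` at most `min δ₀ 1`. Both use `ε = κ / 2^L`.
  have ev := (eventually_nOfLog (mSig_nonneg m σ) m).and
    ((eventually_rpow_mul_log_pow_le (κ := M * B ^ 2 / (8 * κ)) (by positivity) τ m).and
      (eventually_rpow_mul_log_pow_le (κ := min δ₀ 1 * (Real.exp 1 * c * m) ^ m / κ)
        (by positivity) m 0))
  obtain ⟨l₀, hl₀⟩ := eventually_atTop.1 ev
  obtain ⟨ε₀, hε₀, hε₀'⟩ := exists_logTerm_ge hA hc hm σ l₀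
  refine ⟨ε₀, hε₀, fun T C hC hgrow hTm hTB hTε hTn hTh => ?_⟩
  have hε := T.ε_pos
  obtain ⟨⟨h1, -, hnl, hpow, hlog0, hlog⟩, hY, hsmall⟩ := hl₀ _ (hε₀' T.ε hε hTε)
  rw [← nTh_eq, ← hTn] at hnl hpow hlog0 hlog
  have hεl := eq_mul_rpow_neg_logTerm (σ := σ) hA hc hε hm
  rw [← hτ, ← hκ] at hεl
  set l := logTerm A c σ m T.ε with hl
  have h2l : (0 : ℝ) < 2 ^ l := by positivity
  have hεt : T.εt ≤ min δ₀ 1 := by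
    refine (Task.εt_le hc hTm rfl hTh hnl).trans ?_
    rw [pow_zero, mul_one, Real.rpow_natCast] at hsmall
    calc T.ε / (Real.exp 1 * c * m) ^ m * l ^ m
        ≤ T.ε / (Real.exp 1 * c * m) ^ m *
            (min δ₀ 1 * (Real.exp 1 * c * m) ^ m / κ * 2 ^ l) := by gcongr
      _ = min δ₀ 1 := by
          rw [hεl]; field_simp
  have hres := Task.resource_le_of_eventually hc hε hpow hlog
  have hinv := T.one_div_εt_le
  rw [hTm, hTh] at hinv
  refine Task.qubitsF_le_of_one_div_le_sq ha hC hgrow (hεt.trans (min_le_left _ _))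
    (hεt.trans (min_le_right _ _)) ?_
  calc 1 / T.εt ≤ 2 * (4 * (M / T.ε * (l ^ τ * Real.log l ^ m))) := hinv.trans (by gcongr)
    _ ≤ 2 * (4 * (M / T.ε * (M * B ^ 2 / (8 * κ) * 2 ^ l))) := by gcongr
    _ = (M * B / T.ε) ^ 2 := by
        have h2lε : (2 : ℝ) ^ l = κ / T.ε := by
          rw [eq_div_iff hε.ne', mul_comm]
          exact (eq_div_iff h2l.ne').1 hεl
        rw [h2lε]
        field_simp
        norm_num

/-- The threshold depends on `m` and `σ` only, because `n_th` is a function of `mσ⁺` and `L` alone,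
and `L` depends on the other data only through `ε'`. -/
theorem resource_le_of_nTh {m : ℕ} (σ : ℝ) (hm : 1 ≤ m) :
    ∃ η : ℝ, 0 < η ∧ ∀ A c ε : ℝ, 0 < A → 0 < c → 0 < ε → epsPrime A c m ε ≤ η →
      EpsCondition A c σ m ε ∧ m ≤ 2 * nTh A c σ m ε ∧
      m * (2 * (1 + Real.log (nTh A c σ m ε))) ^ m / (hTh c σ m (nTh A c σ m ε) ^ m * ε) ≤
        4 * (m * (2 * Real.exp 1 * c * m) ^ m / ε *
          (logTerm A c σ m ε ^ mSig m σ * Real.log (logTerm A c σ m ε) ^ m)) := by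
  obtain ⟨l₀, hl₀⟩ := eventually_atTop.1 (eventually_nOfLog (mSig_nonneg m σ) m)
  set τ := mSig m σ with hτ
  refine ⟨min (2 ^ (τ - l₀)) (if Real.log 2 ≤ τ then (2 : ℝ) ^ (τ - (τ / Real.log 2) ^ 2)
    else (2 : ℝ) ^ (τ - 1)), lt_min (by positivity) (by split_ifs <;> positivity),
    fun A c ε hA hc hε h => ?_⟩
  obtain ⟨h1, hmn, hnl, hpow, hlog0, hlog⟩ :=
    hl₀ _ ((le_logTerm_iff (σ := σ) hA hc hε hm).2 (h.trans (min_le_left _ _)))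
  exact ⟨h.trans (min_le_right _ _), hmn, Task.resource_le_of_eventually hc hε hpow hlog⟩

end SumInQAE

end

/-! ### Assembly of the theorem. -/

theorem theorem4 :
    ∃ (K : ℝ) (A₃ : (T : Task.{u}) → Algorithm T.Reg), 0 < K ∧
      -- accuracy, and number of calls of each oracle
      (∀ T : Task.{u}, T.SolvedBy (A₃ T) ∧
        ∀ k : OracleName, ((A₃ T).calls k : ℝ) ≤
          K * (T.m * (2 * (1 + Real.log T.n)) ^ T.m * T.B / (T.h ^ T.m * T.ε))) ∧
      -- number of qubits of the oracle for `F`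
      (∀ a : ℝ, 0 < a → ∃ Ka : ℝ, 0 < Ka ∧
        (∀ (T : Task.{u}) (C δ₀ : ℝ), 0 < C → T.QubitGrowth a C δ₀ →
          T.εt ≤ δ₀ → T.εt ≤ 1 / 4 →
          (T.qubitsF T.εt : ℝ) ≤ Ka * C *
            Real.log (T.m * (2 * (1 + Real.log T.n)) ^ T.m / (T.h ^ T.m * T.ε)) ^ a) ∧
        -- the same for `n = n_th`, `h = h_th`, as `ε` tends to 0
        (∀ (m : ℕ) (A c σ B δ₀ : ℝ), 1 ≤ m → 0 < A → 0 < c → 0 < B → 0 < δ₀ →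
          ∃ ε₀ : ℝ, 0 < ε₀ ∧ ∀ (T : Task.{u}) (C : ℝ), 0 < C → T.QubitGrowth a C δ₀ →
            T.m = m → T.B = B → T.ε ≤ ε₀ →
            T.n = nTh A c σ m T.ε → T.h = hTh c σ m T.n →
            (T.qubitsF T.εt : ℝ) ≤ Ka * C *
              Real.log (m * (2 * Real.exp 1 * c * m) ^ m * B / T.ε) ^ a)) ∧
      -- the choice `n = n_th`, `h = h_th` satisfies the step condition
      (∀ (m : ℕ) (A c σ ε : ℝ), 1 ≤ m → 0 < A → 0 < c → 0 < ε → EpsCondition A c σ m ε →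
        m ≤ 2 * nTh A c σ m ε →
        StepCondition A c σ m (nTh A c σ m ε) (hTh c σ m (nTh A c σ m ε)) ε) ∧
      -- number of calls for `n = n_th`, `h = h_th`, as `ε'` tends to 0
      (∀ (m : ℕ) (σ : ℝ), 1 ≤ m → ∃ η : ℝ, 0 < η ∧
        ∀ (A c ε : ℝ), 0 < A → 0 < c → 0 < ε → epsPrime A c m ε ≤ η →
          EpsCondition A c σ m ε ∧ m ≤ 2 * nTh A c σ m ε ∧
          ∀ T : Task.{u}, T.m = m → T.ε = ε → T.n = nTh A c σ m ε → T.h = hTh c σ m T.n →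
            ∀ k : OracleName, ((A₃ T).calls k : ℝ) ≤
              K * (m * (2 * Real.exp 1 * c * m) ^ m * T.B / ε
                * logTerm A c σ m ε ^ mSig m σ * Real.log (logTerm A c σ m ε) ^ m)) := by
  have hX : ∀ T : Task.{u}, 0 ≤ T.m * (2 * (1 + Real.log T.n)) ^ T.m * T.B / (T.h ^ T.m * T.ε) := by
    intro T
    have h1 : 0 ≤ Real.log T.n := Real.log_natCast_nonneg _
    have h2 := T.h_pos
    have h3 := T.ε_pos
    have h4 := T.B_nonneg
    positivity
  -- `1296 = 4 · 324`: the factor 4 is lost in passing from `n_th`, `h_th` to powers of `L` and `log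
  -- L`.
  refine ⟨1296, Task.algorithm, by norm_num, fun T => ⟨T.algorithm_solvedBy, fun k => ?_⟩,
    fun a ha => ⟨2 ^ a, by positivity, fun T C δ₀ hC hgrow h0 h1 => T.qubitsF_le ha hC hgrow h0 h1,
      fun m A c σ B δ₀ hm hA hc hB hδ₀ => qubitsF_le_of_nTh ha σ hm hA hc hB hδ₀⟩,
    fun m A c σ ε hm hA hc hε hcond hmn => stepCondition_nTh_hTh hm hA hc hε hcond hmn,
    fun m σ hm => ?_⟩
  · refine (T.algorithm_calls_le k).trans ?_
    linarith [hX T]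
  · obtain ⟨η, hη, h⟩ := resource_le_of_nTh σ hm
    refine ⟨η, hη, fun A c ε hA hc hε hle => ?_⟩
    obtain ⟨h1, h2, h3⟩ := h A c ε hA hc hε hle
    refine ⟨h1, h2, fun T hTm hTε hTn hTh k => (T.algorithm_calls_le k).trans ?_⟩
    rw [hTm, hTε, hTh, hTn]
    have := mul_le_mul_of_nonneg_right h3 T.B_nonneg
    rw [mul_div_right_comm, mul_div_right_comm _ T.B]
    linarith
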